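/- Let $\mathbb{D}^n=\{z\in\mathbb{C}^n : |z_i|<1 \text{ for } i=1,\dots,n\}$ be the unit polydisc. For an integer $k\ge 0$ and $0<\alpha<1$, let $C^{k+\alpha}(\mathbb{D}^n)$ be the space of functions $f:\mathbb{D}^n\to\mathbb{C}$ that are $k$ times continuously differentiable (in the real sense) and for which $$\|f\|_{C^{k+\alpha}}=\sum_{j=0}^{k}\ \sup_{z\in\mathbb{D}^n}\|D^jf(z)\|+\sup_{z\ne w\in\mathbb{D}^n}\frac{\|D^kf(z)-D^kf(w)\|}{|z-w|^{\alpha}}$$ is finite. Let $C^{k+\alpha}_{(0,1)}(\mathbb{D}^n)$ be the space of $(0,1)$-forms $g=\sum_{j=1}^n g_j\,d\bar z_j$ with $g_j\in C^{k+\alpha}(\mathbb{D}^n)$, with norm $\|g\|_{C^{k+\alpha}}=\sum_j\|g_j\|_{C^{k+\alpha}}$, and let $Z^{k+\alpha}_{(0,1)}(\mathbb{D}^n)$ be its subspace of forms that are $\bar\partial$-closed in the sense of distributions, i.e. $\partial g_j/\partial\bar z_i=\partial g_i/\partial\bar z_j$ for all $i,j$. **Theorem.** For every $n$, every integer $k\ge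 0$ and every $0<\alpha<1$, the equation $\bar\partial u=g$ on $\mathbb{D}^n$ admits a bounded linear solution operator on $Z^{k+\alpha}_{(0,1)}(\mathbb{D}^n)$ with values in $C^{k+\alpha}(\mathbb{D}^n)$: there are a complex-linear map $$H: Z^{k+\alpha}_{(0,1)}(\mathbb{D}^n)\to C^{k+\alpha}(\mathbb{D}^n)$$ and a constant $C<\infty$ such that, for all $g\in Z^{k+\alpha}_{(0,1)}(\mathbb{D}^n)$, $\|H[g]\|_{C^{k+\alpha}}\le C\,\|g\|_{C^{k+\alpha}}$ and $\bar\partial H[g]=g$ in the sense of distributions, i.e. $\partial H[g]/\partial\bar z_j=g_j$ for all $j$. -/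

import Mathlib

open MeasureTheory
open scoped ENNReal NNReal ContDiff

noncomputable section

namespace DbarPolydisc

/-- The open unit polydisc in `ℂⁿ`. -/
def polydisc (n : ℕ) : Set (Fin n → ℂ) := {z | ∀ i, ‖z i‖ < 1}

theorem isOpen_polydisc (n : ℕ) : IsOpen (polydisc n) := by
  have : polydisc n = ⋂ i, {z : Fin n → ℂ | ‖z i‖ < 1} := by
    ext z; simp [polydisc]
  rw [this]
  exact isOpen_iInter_of_finite fun i =>
    isOpen_lt (continuous_apply i).norm continuous_const

/-- Extension by zero of a function on the polydisc to all of `ℂⁿ`. -/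
def zeroExt {n : ℕ} (f : polydisc n → ℂ) : (Fin n → ℂ) → ℂ :=
  Function.extend Subtype.val f 0

theorem zeroExt_coe {n : ℕ} (f : polydisc n → ℂ) (z : polydisc n) :
    zeroExt f z = f z :=
  Subtype.val_injective.extend_apply f 0 z

theorem zeroExt_zero {n : ℕ} : zeroExt (0 : polydisc n → ℂ) = 0 := by
  unfold zeroExt
  exact Function.extend_zero _

theorem zeroExt_add {n : ℕ} (f g : polydisc n → ℂ) :
    zeroExt (f + g) = zeroExt f + zeroExt g := by
  unfold zeroExt
  simpa using Function.extend_add (Subtype.val : polydisc n → _) f g 0 0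

theorem zeroExt_smul {n : ℕ} (c : ℂ) (f : polydisc n → ℂ) :
    zeroExt (c • f) = c • zeroExt f := by
  unfold zeroExt
  simpa using Function.extend_smul c (Subtype.val : polydisc n → _) f 0

/-- The real derivative of order `j`, as a function on the polydisc. -/
def iterDeriv {n : ℕ} (j : ℕ) (f : polydisc n → ℂ) (z : polydisc n) :
    ContinuousMultilinearMap ℝ (fun _ : Fin j => Fin n → ℂ) ℂ :=
  iteratedFDerivWithin ℝ j (zeroExt f) (polydisc n) z

/-- The `C^{k+α}` norm (possibly infinite): the suprema of the derivatives of order at most `k`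
plus the Hölder seminorm of exponent `α` of the derivative of order `k`. -/
def cNorm {n : ℕ} (k : ℕ) (α : ℝ≥0) (f : polydisc n → ℂ) : ℝ≥0∞ :=
  (∑ j ∈ Finset.range (k + 1), ⨆ z : polydisc n, ‖iterDeriv j f z‖ₑ) + eHolderNorm α (iterDeriv k f)

theorem iterDeriv_add {n k j : ℕ} (hj : j ≤ k) {f g : polydisc n → ℂ}
    (hf : ContDiffOn ℝ k (zeroExt f) (polydisc n))
    (hg : ContDiffOn ℝ k (zeroExt g) (polydisc n)) :
    iterDeriv j (f + g) = iterDeriv j f + iterDeriv j g := by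
  have hk : ((j : ℕ∞ω)) ≤ k := by exact_mod_cast hj
  funext z
  simp only [iterDeriv, zeroExt_add, Pi.add_apply]
  exact iteratedFDerivWithin_add_apply ((hf z z.2).of_le hk) ((hg z z.2).of_le hk)
    (isOpen_polydisc n).uniqueDiffOn z.2

theorem iterDeriv_smul {n k j : ℕ} (hj : j ≤ k) (c : ℂ) {f : polydisc n → ℂ}
    (hf : ContDiffOn ℝ k (zeroExt f) (polydisc n)) :
    iterDeriv j (c • f) = c • iterDeriv j f := by
  have hk : ((j : ℕ∞ω)) ≤ k := by exact_mod_cast hj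
  funext z
  simp only [iterDeriv, zeroExt_smul, Pi.smul_apply]
  exact iteratedFDerivWithin_const_smul_apply ((hf z z.2).of_le hk)
    (isOpen_polydisc n).uniqueDiffOn z.2

theorem iterDeriv_zero {n j : ℕ} : iterDeriv j (0 : polydisc n → ℂ) = 0 := by
  funext z
  simp only [iterDeriv, zeroExt_zero]
  simp

theorem cNorm_zero {n k : ℕ} {α : ℝ≥0} : cNorm k α (0 : polydisc n → ℂ) = 0 := by
  have h : ∀ j (z : polydisc n), ‖iterDeriv j (0 : polydisc n → ℂ) z‖ₑ = 0 := fun j z => by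
    rw [iterDeriv_zero, ← ofReal_norm, Pi.zero_apply, norm_zero, ENNReal.ofReal_zero]
  unfold cNorm
  simp only [h]
  rw [iterDeriv_zero, eHolderNorm_zero]
  simp

theorem cNorm_add_le {n k : ℕ} {α : ℝ≥0} {f g : polydisc n → ℂ}
    (hf : ContDiffOn ℝ k (zeroExt f) (polydisc n))
    (hg : ContDiffOn ℝ k (zeroExt g) (polydisc n)) :
    cNorm k α (f + g) ≤ cNorm k α f + cNorm k α g := by
  unfold cNorm
  rw [iterDeriv_add le_rfl hf hg, add_add_add_comm, ← Finset.sum_add_distrib]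
  refine add_le_add (Finset.sum_le_sum fun j hj => ?_) eHolderNorm_add_le
  rw [iterDeriv_add (Nat.lt_succ_iff.1 (Finset.mem_range.1 hj)) hf hg]
  exact iSup_le fun z => (enorm_add_le (iterDeriv j f z) (iterDeriv j g z)).trans
    (add_le_add (le_iSup (fun z => ‖iterDeriv j f z‖ₑ) z) (le_iSup (fun z => ‖iterDeriv j g z‖ₑ) z))

theorem cNorm_smul {n k : ℕ} {α : ℝ≥0} (c : ℂ) {f : polydisc n → ℂ}
    (hf : ContDiffOn ℝ k (zeroExt f) (polydisc n)) :
    cNorm k α (c • f) = ‖c‖ₑ * cNorm k α f := by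
  unfold cNorm
  have h : eHolderNorm α (c • iterDeriv k f) = ‖c‖₊ * eHolderNorm α (iterDeriv k f) :=
    eHolderNorm_smul (r := α) (f := iterDeriv k f) c
  rw [iterDeriv_smul le_rfl c hf, h, ← enorm_eq_nnnorm, mul_add, Finset.mul_sum]
  congr 1
  refine Finset.sum_congr rfl fun j hj => ?_
  rw [iterDeriv_smul (Nat.lt_succ_iff.1 (Finset.mem_range.1 hj)) c hf, ENNReal.mul_iSup]
  exact iSup_congr fun z => enorm_smul c (iterDeriv j f z)

/-- The Hölder space `C^{k+α}` of the polydisc: the complex-valued functions which are `k` times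
continuously differentiable (in the real sense) and have finite `C^{k+α}` norm. -/
def holderSpace (n k : ℕ) (α : ℝ≥0) : Submodule ℂ (polydisc n → ℂ) where
  carrier := {f | ContDiffOn ℝ k (zeroExt f) (polydisc n) ∧ cNorm k α f < ⊤}
  zero_mem' := ⟨by rw [zeroExt_zero]; exact contDiffOn_const, by simp [cNorm_zero]⟩
  add_mem' := fun {f g} hf hg => ⟨by rw [zeroExt_add]; exact hf.1.add hg.1,
    (cNorm_add_le hf.1 hg.1).trans_lt (ENNReal.add_lt_top.2 ⟨hf.2, hg.2⟩)⟩
  smul_mem' := fun c {f} hf => ⟨by rw [zeroExt_smul]; exact hf.1.const_smul c, by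
    rw [cNorm_smul c hf.1]; exact ENNReal.mul_lt_top enorm_lt_top hf.2⟩

/-- The Wirtinger derivative `∂φ/∂z̄ⱼ = (∂φ/∂xⱼ + i ∂φ/∂yⱼ) / 2`. -/
def dbar {n : ℕ} (j : Fin n) (φ : (Fin n → ℂ) → ℂ) (z : Fin n → ℂ) : ℂ :=
  (fderiv ℝ φ z (Pi.single j 1) + Complex.I * fderiv ℝ φ z (Pi.single j Complex.I)) / 2

/-- Test functions: smooth with compact support contained in the polydisc. -/
structure IsTest {n : ℕ} (φ : (Fin n → ℂ) → ℂ) : Prop where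
  smooth : ContDiff ℝ ∞ φ
  compact : HasCompactSupport φ
  support : tsupport φ ⊆ polydisc n

/-- `C^{k+α}` forms of type `(0,1)`: `g = ∑ⱼ gⱼ dz̄ⱼ` is given by its coefficients `gⱼ`. -/
abbrev Form (n k : ℕ) (α : ℝ≥0) : Type := Fin n → holderSpace n k α

/-- The `C^{k+α}` norm of a form. -/
def formNorm {n k : ℕ} {α : ℝ≥0} (g : Form n k α) : ℝ≥0∞ :=
  ∑ j, cNorm k α (g j : polydisc n → ℂ)

/-- `∂̄g = 0` in the sense of distributions: `∂gⱼ/∂z̄ᵢ = ∂gᵢ/∂z̄ⱼ` for all `i`, `j`. -/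
def IsDbarClosed {n k : ℕ} {α : ℝ≥0} (g : Form n k α) : Prop :=
  ∀ φ : (Fin n → ℂ) → ℂ, IsTest φ → ∀ i j : Fin n,
    ∫ z, zeroExt (g j : polydisc n → ℂ) z * dbar i φ z =
      ∫ z, zeroExt (g i : polydisc n → ℂ) z * dbar j φ z

/-- `∂̄u = g` in the sense of distributions: `∂u/∂z̄ⱼ = gⱼ` for all `j`. -/
def IsDbarSolution {n k : ℕ} {α : ℝ≥0} (u : holderSpace n k α) (g : Form n k α) : Prop :=
  ∀ φ : (Fin n → ℂ) → ℂ, IsTest φ → ∀ j : Fin n,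
    ∫ z, zeroExt (u : polydisc n → ℂ) z * dbar j φ z =
      -∫ z, zeroExt (g j : polydisc n → ℂ) z * φ z

theorem integrable_mul_dbar {n k : ℕ} {α : ℝ≥0} (u : holderSpace n k α) {φ : (Fin n → ℂ) → ℂ}
    (hφ : IsTest φ) (j : Fin n) :
    Integrable fun z => zeroExt (u : polydisc n → ℂ) z * dbar j φ z := by
  have hc : Continuous (fderiv ℝ φ) := hφ.smooth.continuous_fderiv (by simp)
  have hd : Continuous (dbar j φ) := by unfold dbar; fun_prop
  have hs : tsupport (dbar j φ) ⊆ tsupport φ := by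
    refine (closure_mono ?_).trans (tsupport_fderiv_subset ℝ (f := φ))
    intro z hz h0
    exact hz (by simp [dbar, h0])
  have hs' : tsupport (fun z => zeroExt (u : polydisc n → ℂ) z * dbar j φ z) ⊆ tsupport φ :=
    (tsupport_mul_subset_right (f := zeroExt (u : polydisc n → ℂ))).trans hs
  refine Continuous.integrable_of_hasCompactSupport ?_
    (hφ.compact.of_isClosed_subset (isClosed_tsupport _) hs')
  refine continuous_of_tsupport fun z hz => ?_
  have hz' := hφ.support (hs' hz)
  have hu : ContDiffOn ℝ k (zeroExt (u : polydisc n → ℂ)) (polydisc n) := u.2.1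
  exact (hu.continuousOn.continuousAt ((isOpen_polydisc n).mem_nhds hz')).mul hd.continuousAt

/-- The space `Z^{k+α}_{(0,1)}` of `∂̄`-closed `C^{k+α}` forms of type `(0,1)`. -/
def closedForms (n k : ℕ) (α : ℝ≥0) : Submodule ℂ (Form n k α) where
  carrier := {g | IsDbarClosed g}
  zero_mem' := fun φ _ i j => by simp [zeroExt_zero]
  add_mem' := fun {f g} hf hg φ hφ i j => by
    simp only [Pi.add_apply, Submodule.coe_add, zeroExt_add, add_mul]
    rw [integral_add (integrable_mul_dbar _ hφ _) (integrable_mul_dbar _ hφ _),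
      integral_add (integrable_mul_dbar _ hφ _) (integrable_mul_dbar _ hφ _),
      hf φ hφ i j, hg φ hφ i j]
  smul_mem' := fun c {g} hg φ hφ i j => by
    simp only [Pi.smul_apply, Submodule.coe_smul, zeroExt_smul, smul_eq_mul, mul_assoc]
    rw [integral_const_mul, integral_const_mul, hg φ hφ i j]

end DbarPolydisc

end

noncomputable section

namespace DbarPolydisc

open Complex Filter Topology

/-! The form is cut into dyadic frequency bands, each band is solved by an operator bounded in the
supremum norm, interior regularity turns supremum bounds into derivative bounds, and the solutions
are summed.

Supremum norm. On the disc the weighted Cauchy-Pompeiu formula reads `v = P v + T ∂̄v`, where `P`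
has the kernel `discProj`, holomorphic in `z`. In several variables `I - P₁⋯Pₙ` can be expanded one
variable at a time, but the kernel of `P` has no `L¹` bound uniform in `z` (it grows logarithmically
at the boundary). The remedy is to smooth the Cauchy kernel at scale `2⁻ᵐ`, which replaces `T` by
some `Tₘ`, and to put `Aₘ = I - Tₘ ∂̄`. Then `A₀ = I`, `Aₘ → P`, the kernel of `Aₘ` has mass `O(m +
1)`, and `Aₘ - Aₘ₊₁ = Dₘ ∂̄` where the kernel of `Dₘ` has mass `O(2⁻ᵐ)`, uniformly in `z`.
Telescoping the tensor powers of `Aₘ` both in `m` and in the variable writes `u - P u` as a series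
in `∂̄u` whose terms are `O((m + 2)ⁿ 2⁻ᵐ)`. The series depends on the form alone, and `P u` is
holomorphic in each variable, so it solves the equation (`polySolve_eq`, `norm_polySolve_le`). The
point mass in `discMeasure` makes the identity an integral operator like the others.

Bands. `lowPass` combines averages `∫ f((1-τ)z + τw) Φ(w) dw` with several `τ` proportional to `t`.
The dilation keeps the sample points inside the polydisc even for `z` slightly outside, so the
smoothed form is smooth everywhere and closed on a larger polydisc, by a margin proportional to `t`.
The weights are chosen so that the `j`-th derivative of the difference of two consecutive scales
annihilates polynomials of degree at most `k` along the segments `x ↦ (1-x)z + xw`. Taylor's formula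
then gives derivatives of order `j ≤ k+1` of size `t^(k+α-j)`, where `t = 2⁻ᵐ`
(`exists_norm_iteratedFDeriv_band_le`).

Gluing. A solution `F` of `∂̄F = d` on a polydisc enlarged by `ρ` satisfies `‖D^j F‖ ≲ ρ^(-j) sup
‖d‖ + ρ sup ‖D^j d‖` on the unit polydisc, when `F` is the solution from `polySolve`
(`exists_norm_iteratedFDeriv_regSolve_le`). With `ρ` comparable to `2⁻ᵐ`, the pieces obey the same
bounds `2^(-m(k+α-j))` as the bands. As `0 < α < 1`, such a series sums to a `C^{k+α}` function
(`IsDyadic`). -/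

/-! ### The Cauchy-Riemann operator in one variable -/

/-- The Wirtinger derivative `∂f/∂z̄` of a function of one complex variable. -/
def dbarC (f : ℂ → ℂ) (z : ℂ) : ℂ := (fderiv ℝ f z 1 + I * fderiv ℝ f z I) / 2

/-- `f` is real differentiable at `z` with Wirtinger derivatives `∂f/∂z = a` and `∂f/∂z̄ = b`. -/
def HasWirtingerAt (f : ℂ → ℂ) (a b z : ℂ) : Prop :=
  HasFDerivAt (𝕜 := ℝ) f (a • (1 : ℂ →L[ℝ] ℂ) + b • (conjCLE : ℂ →L[ℝ] ℂ)) z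

namespace HasWirtingerAt

variable {f g : ℂ → ℂ} {a b a' b' z : ℂ}

theorem dbarC_eq (h : HasWirtingerAt f a b z) : dbarC f z = b := by
  have h' := HasFDerivAt.fderiv h
  simp only [dbarC, h', add_apply, smul_apply, one_apply_eq_self, ContinuousLinearEquiv.coe_coe,
    conjCLE_apply, smul_eq_mul, map_one, conj_I]
  linear_combination (a - b) / 2 * I_sq

theorem congr_of_eventuallyEq (h : HasWirtingerAt f a b z) (e : g =ᶠ[𝓝 z] f) :
    HasWirtingerAt g a b z := HasFDerivAt.congr_of_eventuallyEq h e

theorem of_eq (h : HasWirtingerAt f a b z) (ha : a = a') (hb : b = b') :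
    HasWirtingerAt f a' b' z := ha ▸ hb ▸ h

theorem const (c z : ℂ) : HasWirtingerAt (fun _ => c) 0 0 z := by
  refine (hasFDerivAt_const (𝕜 := ℝ) c z).congr_fderiv ?_
  ext v; simp

theorem id (z : ℂ) : HasWirtingerAt (fun w => w) 1 0 z := by
  refine (hasFDerivAt_id (𝕜 := ℝ) z).congr_fderiv ?_
  ext v; simp

theorem conj (z : ℂ) : HasWirtingerAt (fun w => (starRingEnd ℂ) w) 0 1 z := by
  refine ((conjCLE : ℂ →L[ℝ] ℂ).hasFDerivAt (x := z)).congr_fderiv ?_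
  ext v; simp

theorem add (hf : HasWirtingerAt f a b z) (hg : HasWirtingerAt g a' b' z) :
    HasWirtingerAt (fun w => f w + g w) (a + a') (b + b') z := by
  refine (HasFDerivAt.add hf hg).congr_fderiv ?_
  ext v; simp; ring

theorem sub (hf : HasWirtingerAt f a b z) (hg : HasWirtingerAt g a' b' z) :
    HasWirtingerAt (fun w => f w - g w) (a - a') (b - b') z := by
  refine (HasFDerivAt.sub hf hg).congr_fderiv ?_
  ext v; simp; ring

theorem mul (hf : HasWirtingerAt f a b z) (hg : HasWirtingerAt g a' b' z) :
    HasWirtingerAt (fun w => f w * g w) (f z * a' + a * g z) (f z * b' + b * g z) z := by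
  refine (HasFDerivAt.mul hf hg).congr_fderiv ?_
  ext v; simp; ring

theorem inv (hf : HasWirtingerAt f a b z) (h0 : f z ≠ 0) :
    HasWirtingerAt (fun w => (f w)⁻¹) (-a / f z ^ 2) (-b / f z ^ 2) z := by
  have h1 : HasFDerivAt (𝕜 := ℝ) (fun w : ℂ => w⁻¹)
      ((ContinuousLinearMap.toSpanSingleton ℂ (-(f z ^ 2)⁻¹)).restrictScalars ℝ) (f z) :=
    ((hasDerivAt_inv h0).hasFDerivAt).restrictScalars ℝ
  refine (h1.comp z hf).congr_fderiv ?_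
  ext v; simp; ring

theorem of_differentiableAt (hf : DifferentiableAt ℝ f z) :
    HasWirtingerAt f ((fderiv ℝ f z 1 - I * fderiv ℝ f z I) / 2) (dbarC f z) z := by
  refine hf.hasFDerivAt.congr_fderiv ?_
  ext v
  have hv : fderiv ℝ f z v = v.re * fderiv ℝ f z 1 + v.im * fderiv ℝ f z I := by
    have h1 := (fderiv ℝ f z).map_smul v.re 1
    have h2 := (fderiv ℝ f z).map_smul v.im I
    have h3 : v = v.re • (1 : ℂ) + v.im • I := by simp
    conv_lhs => rw [h3, map_add, h1, h2]
    rw [real_smul, real_smul]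
  rw [hv]
  have h4 : (starRingEnd ℂ) v = v.re - v.im * I := by
    apply Complex.ext <;> simp
  simp only [add_apply, smul_apply, one_apply_eq_self, ContinuousLinearEquiv.coe_coe,
    conjCLE_apply, smul_eq_mul, dbarC, h4]
  linear_combination (v.im * fderiv ℝ f z I) * I_sq +
    (fderiv ℝ f z 1 - I * fderiv ℝ f z I) / 2 * re_add_im v

end HasWirtingerAt

theorem dbarC_mul {f g : ℂ → ℂ} {z : ℂ} (hf : DifferentiableAt ℝ f z)
    (hg : DifferentiableAt ℝ g z) :
    dbarC (fun w => f w * g w) z = f z * dbarC g z + dbarC f z * g z :=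
  ((HasWirtingerAt.of_differentiableAt hf).mul (HasWirtingerAt.of_differentiableAt hg)).dbarC_eq

theorem dbarC_eq_zero_of_differentiableAt {f : ℂ → ℂ} {z : ℂ} (hf : DifferentiableAt ℂ f z) :
    dbarC f z = 0 := by
  have h := hf.hasFDerivAt.restrictScalars ℝ
  have h1 : fderiv ℂ f z I = I * fderiv ℂ f z 1 := by
    have := (fderiv ℂ f z).map_smul I 1
    rwa [smul_eq_mul, mul_one, smul_eq_mul] at this
  rw [dbarC, h.fderiv]
  simp only [ContinuousLinearMap.coe_restrictScalars', h1]
  linear_combination (fderiv ℂ f z 1) / 2 * I_sq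

theorem continuous_dbarC {f : ℂ → ℂ} (hf : ContDiff ℝ 1 f) : Continuous (dbarC f) := by
  have := hf.continuous_fderiv (by simp)
  unfold dbarC; fun_prop

theorem tsupport_dbarC_subset (f : ℂ → ℂ) : tsupport (dbarC f) ⊆ tsupport f := by
  refine (closure_mono ?_).trans (tsupport_fderiv_subset ℝ (f := f))
  intro z hz h0
  exact hz (by simp [dbarC, h0])

theorem hasCompactSupport_dbarC {f : ℂ → ℂ} (hf : HasCompactSupport f) :
    HasCompactSupport (dbarC f) :=
  hf.of_isClosed_subset (isClosed_tsupport _) (tsupport_dbarC_subset f)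

/-- Integration by parts for the Cauchy-Riemann operator. -/
theorem integral_mul_dbarC {f g : ℂ → ℂ} (hf : ContDiff ℝ 1 f) (hg : ContDiff ℝ 1 g)
    (hc : HasCompactSupport f) :
    ∫ ζ, f ζ * dbarC g ζ = -∫ ζ, dbarC f ζ * g ζ := by
  have hf' := hf.continuous_fderiv (by simp)
  have hg' := hg.continuous_fderiv (by simp)
  have i0 : Integrable (fun x ↦ f x * g x) :=
    (hf.continuous.mul hg.continuous).integrable_of_hasCompactSupport hc.mul_right
  have i1 : ∀ v, Integrable (fun x ↦ f x * fderiv ℝ g x v) := fun v =>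
    (hf.continuous.mul (by fun_prop)).integrable_of_hasCompactSupport hc.mul_right
  have i2 : ∀ v, Integrable (fun x ↦ fderiv ℝ f x v * g x) := fun v =>
    ((by fun_prop : Continuous fun x => fderiv ℝ f x v).mul
      hg.continuous).integrable_of_hasCompactSupport
      ((hc.fderiv_apply ℝ v).mul_right)
  have key := fun v => integral_mul_fderiv_eq_neg_fderiv_mul_of_integrable (i2 v) (i1 v) i0
    (fun x _ => (hf.differentiable (by simp)) x) (fun x _ => (hg.differentiable (by simp)) x)
  have e1 : (fun ζ => f ζ * dbarC g ζ) = fun ζ =>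
      (2 : ℂ)⁻¹ * (f ζ * fderiv ℝ g ζ 1) + (I / 2) * (f ζ * fderiv ℝ g ζ I) := by
    funext ζ; simp only [dbarC]; ring
  have e2 : (fun ζ => dbarC f ζ * g ζ) = fun ζ =>
      (2 : ℂ)⁻¹ * (fderiv ℝ f ζ 1 * g ζ) + (I / 2) * (fderiv ℝ f ζ I * g ζ) := by
    funext ζ; simp only [dbarC]; ring
  rw [e1, e2, integral_add ((i1 1).const_mul _) ((i1 I).const_mul _),
    integral_add ((i2 1).const_mul _) ((i2 I).const_mul _), integral_const_mul,
    integral_const_mul, integral_const_mul, integral_const_mul, key, key]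
  ring

/-! ### Radial integrals and the regularized Cauchy kernel -/

theorem integral_fun_norm_complex (f : ℝ → ℝ) :
    ∫ w : ℂ, f ‖w‖ = 2 * Real.pi * ∫ r in Set.Ioi (0 : ℝ), r * f r := by
  have h := integral_fun_norm_addHaar (volume : Measure ℂ) f
  rw [h, Complex.finrank_real_complex]
  simp only [measureReal_def, Complex.volume_ball]
  simp [mul_assoc]

theorem integrable_fun_norm_complex {f : ℝ → ℝ} :
    Integrable (fun w : ℂ => f ‖w‖) ↔ IntegrableOn (fun r => r * f r) (Set.Ioi (0 : ℝ)) := by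
  rw [integrable_fun_norm_addHaar (volume : Measure ℂ), Complex.finrank_real_complex]
  simp

theorem hasDerivAt_neg_inv_one_add_sq (r : ℝ) :
    HasDerivAt (fun r : ℝ => -(2 * (1 + r ^ 2))⁻¹) (r * ((1 + r ^ 2) ^ 2)⁻¹) r := by
  have h1 : HasDerivAt (fun r : ℝ => 2 * (1 + r ^ 2)) (4 * r) r := by
    refine ((((hasDerivAt_id' r).pow 2).const_add 1).const_mul 2).congr_deriv ?_
    push_cast; ring
  refine (h1.inv (by positivity)).neg.congr_deriv ?_
  field_simp; ring

theorem tendsto_neg_inv_one_add_sq :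
    Tendsto (fun r : ℝ => -(2 * (1 + r ^ 2))⁻¹) atTop (𝓝 0) := by
  have : Tendsto (fun r : ℝ => 2 * (1 + r ^ 2)) atTop atTop :=
    (tendsto_atTop_add_const_left _ _ (tendsto_pow_atTop two_ne_zero)).const_mul_atTop two_pos
  simpa using this.inv_tendsto_atTop.neg

theorem integrable_inv_one_add_sq_sq :
    Integrable (fun w : ℂ => ((1 + ‖w‖ ^ 2) ^ 2)⁻¹) := by
  rw [integrable_fun_norm_complex (f := fun r => ((1 + r ^ 2) ^ 2)⁻¹)]
  exact integrableOn_Ioi_deriv_of_nonneg' (fun x _ => hasDerivAt_neg_inv_one_add_sq x)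
    (fun x hx => mul_nonneg (le_of_lt hx) (by positivity)) tendsto_neg_inv_one_add_sq

/-- This normalizes the profile of `-∂̄` of the regularized kernel: `s² / (π (|w|² + s²)²)` has
total mass one, hence is an approximate identity as `s → 0`. -/
theorem integral_inv_one_add_sq_sq : ∫ w : ℂ, ((1 + ‖w‖ ^ 2) ^ 2)⁻¹ = Real.pi := by
  rw [integral_fun_norm_complex (f := fun r => ((1 + r ^ 2) ^ 2)⁻¹),
    integral_Ioi_of_hasDerivAt_of_nonneg' (fun x _ => hasDerivAt_neg_inv_one_add_sq x)
    (fun x hx => mul_nonneg (le_of_lt hx) (by positivity)) tendsto_neg_inv_one_add_sq]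
  norm_num
  ring

/-- `1 / |w|` is locally integrable. -/
theorem integrableOn_inv_norm (R : ℝ) :
    IntegrableOn (fun w : ℂ => ‖w‖⁻¹) (Metric.ball 0 R) := by
  rw [integrableOn_fun_norm_addHaar (volume : Measure ℂ) (f := fun r => r⁻¹),
    Complex.finrank_real_complex]
  refine (integrableOn_const (C := (1 : ℝ)) (by simp)).congr_fun (fun r hr => ?_) measurableSet_Ioo
  have : r ≠ 0 := hr.1.ne'
  simp [this]

/-- This is the profile of the error made by regularizing the Cauchy kernel; it has an integrable
singularity at `0` and cubic decay at infinity. -/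
theorem integrable_inv_mul_one_add_sq :
    Integrable (fun w : ℂ => (‖w‖ * (1 + ‖w‖ ^ 2))⁻¹) := by
  rw [integrable_fun_norm_complex (f := fun r => (r * (1 + r ^ 2))⁻¹)]
  refine (integrable_inv_one_add_sq.integrableOn (s := Set.Ioi (0:ℝ))).congr_fun (fun r hr => ?_)
    measurableSet_Ioi
  have : r ≠ 0 := ne_of_gt hr
  field_simp

/-- The regularized Cauchy kernel. -/
def cauchyReg (s : ℝ) (z ζ : ℂ) : ℂ :=
  (starRingEnd ℂ) (z - ζ) * ((Real.pi * (‖z - ζ‖ ^ 2 + s ^ 2) : ℝ) : ℂ)⁻¹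

theorem ofReal_norm_sub_sq (z ζ : ℂ) :
    ((‖z - ζ‖ ^ 2 : ℝ) : ℂ) = (z - ζ) * (starRingEnd ℂ) (z - ζ) := by
  rw [mul_conj, normSq_eq_norm_sq]

/-- The derivative `∂/∂ζ` is left existential because only the `ζ̄` derivative enters the integral
formulas. -/
theorem hasWirtingerAt_cauchyReg {s : ℝ} (hs : s ≠ 0) (z ζ : ℂ) :
    ∃ a, HasWirtingerAt (cauchyReg s z) a
      (-((s ^ 2 * (Real.pi * (‖z - ζ‖ ^ 2 + s ^ 2) ^ 2)⁻¹ : ℝ) : ℂ)) ζ := by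
  have h1 : HasWirtingerAt (fun ζ => z - ζ) (0 - 1) (0 - 0) ζ :=
    (HasWirtingerAt.const z ζ).sub (HasWirtingerAt.id ζ)
  have h2 : HasWirtingerAt (fun ζ => (starRingEnd ℂ) z - (starRingEnd ℂ) ζ) (0 - 0) (0 - 1) ζ :=
    (HasWirtingerAt.const _ ζ).sub (HasWirtingerAt.conj ζ)
  have h3 := (HasWirtingerAt.const (Real.pi : ℂ) ζ).mul
    ((h1.mul h2).add (HasWirtingerAt.const ((s : ℂ) ^ 2) ζ))
  have e : ∀ ζ, (((Real.pi * (‖z - ζ‖ ^ 2 + s ^ 2) : ℝ) : ℂ)) =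
      Real.pi * ((z - ζ) * ((starRingEnd ℂ) z - (starRingEnd ℂ) ζ) + (s : ℂ) ^ 2) := by
    intro ζ
    push_cast
    rw [← ofReal_pow, ofReal_norm_sub_sq, map_sub]
  have hne : ∀ ζ, (Real.pi : ℂ) *
      ((z - ζ) * ((starRingEnd ℂ) z - (starRingEnd ℂ) ζ) + (s : ℂ) ^ 2) ≠ 0 := by
    intro ζ
    rw [← e]
    exact ofReal_ne_zero.2 (by positivity)
  have h4 := h2.mul (h3.inv (hne ζ))
  have hfun : cauchyReg s z = fun ζ => ((starRingEnd ℂ) z - (starRingEnd ℂ) ζ) *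
      (Real.pi * ((z - ζ) * ((starRingEnd ℂ) z - (starRingEnd ℂ) ζ) + (s : ℂ) ^ 2))⁻¹ := by
    funext ζ
    rw [cauchyReg, e, map_sub]
  rw [hfun]
  refine ⟨_, h4.of_eq rfl ?_⟩
  have hpi : (Real.pi : ℂ) ≠ 0 := ofReal_ne_zero.2 Real.pi_ne_zero
  have h5 := right_ne_zero_of_mul (hne ζ)
  push_cast
  rw [← ofReal_pow ‖z - ζ‖, ofReal_norm_sub_sq, map_sub]
  field_simp
  ring

theorem contDiff_cauchyReg {s : ℝ} (hs : s ≠ 0) (z : ℂ) : ContDiff ℝ 1 (cauchyReg s z) := by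
  unfold cauchyReg
  refine ContDiff.mul ?_ (ContDiff.inv ?_ ?_)
  · exact (conjCLE : ℂ →L[ℝ] ℂ).contDiff.comp (contDiff_const.sub contDiff_id)
  · refine ofRealCLM.contDiff.comp (contDiff_const.mul (ContDiff.add ?_ contDiff_const))
    exact (contDiff_const.sub contDiff_id).norm_sq ℝ
  · intro ζ
    exact ofReal_ne_zero.2 (by positivity)

theorem dbarC_cauchyReg {s : ℝ} (hs : s ≠ 0) (z ζ : ℂ) :
    dbarC (cauchyReg s z) ζ = -((s ^ 2 * (Real.pi * (‖z - ζ‖ ^ 2 + s ^ 2) ^ 2)⁻¹ : ℝ) : ℂ) :=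
  (hasWirtingerAt_cauchyReg hs z ζ).choose_spec.dbarC_eq

/-- The bound does not depend on `s` and serves as the dominating function when `s → 0`. -/
theorem norm_cauchyReg_le (s : ℝ) (z ζ : ℂ) : ‖cauchyReg s z ζ‖ ≤ ‖z - ζ‖⁻¹ := by
  rw [cauchyReg, norm_mul, RCLike.norm_conj, norm_inv, norm_real, Real.norm_of_nonneg (by positivity)]
  rcases eq_or_ne (‖z - ζ‖) 0 with h | h
  · simp [h]
  have h0 : 0 < ‖z - ζ‖ := lt_of_le_of_ne (norm_nonneg _) h.symm
  rw [← div_eq_mul_inv, div_le_iff₀ (by positivity)]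
  have := Real.pi_gt_three
  field_simp
  nlinarith [sq_nonneg s, sq_nonneg ‖z - ζ‖]

theorem tendsto_cauchyReg (z ζ : ℂ) :
    Tendsto (fun s => cauchyReg s z ζ) (𝓝 0) (𝓝 ((Real.pi * (z - ζ))⁻¹)) := by
  rcases eq_or_ne (z - ζ) 0 with h | h
  · simp [cauchyReg, h]
  have h1 : ((Real.pi * (‖z - ζ‖ ^ 2 + 0 ^ 2) : ℝ) : ℂ) ≠ 0 := by
    have : 0 < ‖z - ζ‖ := norm_pos_iff.2 h
    exact ofReal_ne_zero.2 (by positivity)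
  have h2 : Tendsto (fun s => cauchyReg s z ζ) (𝓝 0) (𝓝 (cauchyReg 0 z ζ)) := by
    unfold cauchyReg
    refine tendsto_const_nhds.mul (Tendsto.inv₀ ?_ h1)
    refine (continuous_ofReal.tendsto _).comp ?_
    exact (by fun_prop : Continuous fun s : ℝ => Real.pi * (‖z - ζ‖ ^ 2 + s ^ 2)).tendsto 0
  convert h2 using 2
  have h3 : (starRingEnd ℂ) (z - ζ) ≠ 0 := (map_ne_zero _).2 h
  have hpi : (Real.pi : ℂ) ≠ 0 := ofReal_ne_zero.2 Real.pi_ne_zero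
  rw [cauchyReg]
  push_cast
  rw [← ofReal_pow ‖z - ζ‖, ofReal_norm_sub_sq]
  rw [zero_pow two_ne_zero, add_zero]
  field_simp

theorem integrableOn_inv_norm_sub (z : ℂ) (R : ℝ) :
    IntegrableOn (fun ζ : ℂ => ‖z - ζ‖⁻¹) (Metric.ball 0 R) := by
  have h := (integrableOn_inv_norm (R + ‖z‖))
  rw [← integrable_indicator_iff measurableSet_ball] at h ⊢
  refine (h.comp_sub_left z).mono' ?_ (Eventually.of_forall fun ζ => ?_)
  · exact (Measurable.indicator (by fun_prop) measurableSet_ball).aestronglyMeasurable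
  · rw [norm_indicator_eq_indicator_norm]
    by_cases hζ : ζ ∈ Metric.ball (0 : ℂ) R
    · have : z - ζ ∈ Metric.ball (0 : ℂ) (R + ‖z‖) := by
        rw [mem_ball_zero_iff] at hζ ⊢
        linarith [norm_sub_le z ζ]
      simp [Set.indicator_of_mem, hζ, this]
    · rw [Set.indicator_of_notMem hζ]
      exact Set.indicator_nonneg (fun _ _ => by positivity) _

/-- The **Cauchy-Pompeiu formula** for compactly supported functions. -/
theorem cauchyPompeiu {f : ℂ → ℂ} (hf : ContDiff ℝ 1 f) (hc : HasCompactSupport f) (z : ℂ) :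
    ∫ ζ, (Real.pi * (z - ζ))⁻¹ * dbarC f ζ = f z := by
  obtain ⟨R, hR⟩ := hc.isBounded.subset_ball 0
  obtain ⟨M, hM⟩ := (hasCompactSupport_dbarC hc).exists_bound_of_continuous (continuous_dbarC hf)
  obtain ⟨M', hM'⟩ := hc.exists_bound_of_continuous hf.continuous
  have hs : Tendsto (fun j : ℕ => 1 / ((j : ℝ) + 1)) atTop (𝓝 0) :=
    tendsto_one_div_add_atTop_nhds_zero_nat
  have hpos : ∀ j : ℕ, (1 / ((j : ℝ) + 1)) ≠ 0 := fun j => by positivity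
  have lim1 : Tendsto (fun j : ℕ => ∫ ζ, cauchyReg (1 / ((j : ℝ) + 1)) z ζ * dbarC f ζ) atTop
      (𝓝 (∫ ζ, (Real.pi * (z - ζ))⁻¹ * dbarC f ζ)) := by
    refine tendsto_integral_of_dominated_convergence
      ((Metric.ball 0 R).indicator fun ζ => ‖z - ζ‖⁻¹ * M) (fun j => ?_) ?_ (fun j => ?_) ?_
    · exact ((contDiff_cauchyReg (hpos j) z).continuous.mul
        (continuous_dbarC hf)).aestronglyMeasurable
    · rw [integrable_indicator_iff measurableSet_ball]
      exact (integrableOn_inv_norm_sub z R).mul_const M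
    · refine Eventually.of_forall fun ζ => ?_
      by_cases hζ : ζ ∈ Metric.ball (0 : ℂ) R
      · rw [Set.indicator_of_mem hζ, norm_mul]
        exact mul_le_mul (norm_cauchyReg_le _ _ _) (hM ζ) (norm_nonneg _) (by positivity)
      · have : dbarC f ζ = 0 := image_eq_zero_of_notMem_tsupport
          fun h => hζ (hR (tsupport_dbarC_subset f h))
        simp [hζ, this]
    · exact Eventually.of_forall fun ζ => ((tendsto_cauchyReg z ζ).comp hs).mul_const _
  -- The regularized integrals, after parts and the substitution `ζ = z + s w`, are averages of `f`
  -- against a fixed probability density, so they also tend to `f z`.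
  have lim2 : Tendsto (fun j : ℕ => ∫ w : ℂ, ((Real.pi * (1 + ‖w‖ ^ 2) ^ 2)⁻¹ : ℝ) •
      f (z + (1 / ((j : ℝ) + 1)) • w)) atTop
      (𝓝 (∫ w : ℂ, ((Real.pi * (1 + ‖w‖ ^ 2) ^ 2)⁻¹ : ℝ) • f z)) := by
    refine tendsto_integral_of_dominated_convergence
      (fun w => (Real.pi⁻¹ * M') * ((1 + ‖w‖ ^ 2) ^ 2)⁻¹) (fun j => ?_) ?_ (fun j => ?_) ?_
    · refine Continuous.aestronglyMeasurable (Continuous.fun_smul ?_ ?_)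
      · exact Continuous.inv₀ (by fun_prop) fun w => by positivity
      · have := hf.continuous; fun_prop
    · exact integrable_inv_one_add_sq_sq.const_mul _
    · refine Eventually.of_forall fun w => ?_
      rw [norm_smul, Real.norm_of_nonneg (by positivity), mul_inv]
      have := hM' (z + (1 / ((j : ℝ) + 1)) • w)
      calc _ ≤ Real.pi⁻¹ * ((1 + ‖w‖ ^ 2) ^ 2)⁻¹ * M' := by gcongr
        _ = _ := by ring
    · refine Eventually.of_forall fun w => Tendsto.const_smul ?_ _
      have h1 : Tendsto (fun j : ℕ => z + (1 / ((j : ℝ) + 1)) • w) atTop (𝓝 (z + (0 : ℝ) • w)) :=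
        (hs.smul_const w).const_add z
      simp only [zero_smul, add_zero] at h1
      exact (hf.continuous.tendsto z).comp h1
  have eq : ∀ j : ℕ, ∫ ζ, cauchyReg (1 / ((j : ℝ) + 1)) z ζ * dbarC f ζ =
      ∫ w : ℂ, ((Real.pi * (1 + ‖w‖ ^ 2) ^ 2)⁻¹ : ℝ) • f (z + (1 / ((j : ℝ) + 1)) • w) := by
    intro j
    set s : ℝ := 1 / ((j : ℝ) + 1) with hsdef
    have hs0 : s ≠ 0 := hpos j
    have e1 : ∫ ζ, cauchyReg s z ζ * dbarC f ζ = -∫ ζ, f ζ * dbarC (cauchyReg s z) ζ := by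
      rw [integral_mul_dbarC hf (contDiff_cauchyReg hs0 z) hc, neg_neg]
      simp_rw [mul_comm]
    rw [e1, ← integral_neg]
    have e2 := Measure.integral_comp_smul (volume : Measure ℂ)
      (fun w => ((s ^ 2 * (Real.pi * (‖w‖ ^ 2 + s ^ 2) ^ 2)⁻¹ : ℝ) : ℂ) * f (z + w)) s
    rw [Complex.finrank_real_complex] at e2
    have e3 := integral_sub_left_eq_self (μ := (volume : Measure ℂ))
      (fun w => ((s ^ 2 * (Real.pi * (‖w‖ ^ 2 + s ^ 2) ^ 2)⁻¹ : ℝ) : ℂ) * f (z + w)) 0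
    have e4 := integral_add_right_eq_self (μ := (volume : Measure ℂ))
      (fun ζ => ((s ^ 2 * (Real.pi * (‖z - ζ‖ ^ 2 + s ^ 2) ^ 2)⁻¹ : ℝ) : ℂ) * f ζ) z
    calc ∫ ζ, -(f ζ * dbarC (cauchyReg s z) ζ)
        = ∫ ζ, ((s ^ 2 * (Real.pi * (‖z - ζ‖ ^ 2 + s ^ 2) ^ 2)⁻¹ : ℝ) : ℂ) * f ζ := by
          congr 1; funext ζ; rw [dbarC_cauchyReg hs0]; ring
      _ = ∫ w, ((s ^ 2 * (Real.pi * (‖w‖ ^ 2 + s ^ 2) ^ 2)⁻¹ : ℝ) : ℂ) * f (z + w) := by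
          rw [← e4]; congr 1; funext w
          have : z - (w + z) = -w := by ring
          rw [this, norm_neg, add_comm w z]
      _ = (s ^ 2) • ∫ w : ℂ, ((s ^ 2 * (Real.pi * (‖s • w‖ ^ 2 + s ^ 2) ^ 2)⁻¹ : ℝ) : ℂ)
            * f (z + s • w) := by
          rw [e2, smul_smul, abs_of_nonneg (by positivity), mul_inv_cancel₀ (by positivity),
            one_smul]
      _ = _ := by
          rw [← integral_smul]
          congr 1; funext w
          rw [← real_smul, smul_smul, norm_smul, Real.norm_eq_abs]
          congr 1
          rw [mul_pow, sq_abs]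
          field_simp
          ring
  have h := tendsto_nhds_unique (lim1.congr eq) lim2
  rw [h, integral_smul_const]
  simp_rw [mul_inv]
  rw [integral_const_mul, integral_inv_one_add_sq_sq, inv_mul_cancel₀ Real.pi_ne_zero, one_smul]

end DbarPolydisc

end

noncomputable section

namespace DbarPolydisc

open Complex Filter Topology

/-! ### Weighted kernels on the unit disc -/

/-- The square is what makes the truncation `C¹`; this is why `discWeight` vanishes to second order
on the circle. -/
theorem contDiff_max_zero_sq : ContDiff ℝ 1 fun x : ℝ => (max x 0) ^ 2 := by
  have hd : ∀ x : ℝ, HasDerivAt (fun x : ℝ => (max x 0) ^ 2) (2 * max x 0) x := by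
    intro x
    rcases lt_trichotomy x 0 with hx | rfl | hx
    · rw [max_eq_right hx.le, mul_zero]
      refine (hasDerivAt_const x (0 : ℝ)).congr_of_eventuallyEq ?_
      filter_upwards [eventually_lt_nhds hx] with y hy
      simp [max_eq_right hy.le]
    · rw [hasDerivAt_iff_isLittleO_nhds_zero]
      have h : (fun h : ℝ => h ^ 2) =o[𝓝 0] fun h => h := by
        simpa using Asymptotics.isLittleO_pow_id (𝕜 := ℝ) one_lt_two
      refine Asymptotics.IsBigO.trans_isLittleO (Asymptotics.IsBigO.of_bound 1 ?_) h
      refine Eventually.of_forall fun y => ?_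
      simp only [zero_add, max_self, mul_zero, smul_zero, sub_zero, one_mul, norm_pow,
        Real.norm_eq_abs, sq_abs, ne_eq, OfNat.ofNat_ne_zero, not_false_eq_true, zero_pow]
      rcases le_total y 0 with hy | hy
      · simp [max_eq_right hy, sq_nonneg]
      · simp [max_eq_left hy]
    · rw [max_eq_left hx.le]
      have h1 : HasDerivAt (fun x : ℝ => x ^ 2) (2 * x) x := by
        simpa using hasDerivAt_pow 2 x
      refine h1.congr_of_eventuallyEq ?_
      filter_upwards [eventually_gt_nhds hx] with y hy
      simp [max_eq_left hy.le]
  rw [contDiff_one_iff_deriv]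
  refine ⟨fun x => (hd x).differentiableAt, ?_⟩
  rw [funext fun x => (hd x).deriv]
  fun_prop

/-- A weight vanishing to second order on the unit circle, holomorphic in `z` and equal to `1` at
`ζ = z`. -/
def discWeight (z ζ : ℂ) : ℂ :=
  ((max (1 - ‖ζ‖ ^ 2) 0 ^ 2 : ℝ) : ℂ) * ((1 - (starRingEnd ℂ) ζ * z)⁻¹) ^ 2

theorem one_sub_conj_mul_ne_zero {z ζ : ℂ} (hz : ‖z‖ < 1) (hζ : ‖ζ‖ ≤ 1) :
    1 - (starRingEnd ℂ) ζ * z ≠ 0 := by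
  intro h
  have h1 : (1 : ℂ) = (starRingEnd ℂ) ζ * z := sub_eq_zero.1 h
  have h2 : (1 : ℝ) = ‖ζ‖ * ‖z‖ := by
    have := congrArg norm h1
    rwa [norm_one, norm_mul, RCLike.norm_conj] at this
  nlinarith [norm_nonneg z, norm_nonneg ζ]

/-- Factor `1 - |ζ|² ≤ 2 (1 - |ζ|)` and use `1 - |ζ| ≤ 1 - |ζ||z|`. The zeros of the weight thus
absorb its poles, uniformly in `z`. -/
theorem one_sub_sq_le {z ζ : ℂ} (hz : ‖z‖ < 1) (hζ : ‖ζ‖ ≤ 1) :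
    1 - ‖ζ‖ ^ 2 ≤ 2 * ‖1 - (starRingEnd ℂ) ζ * z‖ := by
  have h1 : 1 - ‖ζ‖ * ‖z‖ ≤ ‖1 - (starRingEnd ℂ) ζ * z‖ := by
    have := norm_sub_norm_le (1 : ℂ) ((starRingEnd ℂ) ζ * z)
    rwa [norm_one, norm_mul, RCLike.norm_conj] at this
  nlinarith [norm_nonneg z, norm_nonneg ζ]

/-- The squares differ by `(1 - |z|²)(1 - |ζ|²) ≥ 0`. -/
theorem norm_sub_le_norm_one_sub {z ζ : ℂ} (hz : ‖z‖ < 1) (hζ : ‖ζ‖ ≤ 1) :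
    ‖z - ζ‖ ≤ ‖1 - (starRingEnd ℂ) ζ * z‖ := by
  have h : ‖1 - (starRingEnd ℂ) ζ * z‖ ^ 2 - ‖z - ζ‖ ^ 2 = (1 - ‖z‖ ^ 2) * (1 - ‖ζ‖ ^ 2) := by
    simp only [← normSq_eq_norm_sq, normSq_apply, sub_re, sub_im, mul_re, mul_im, conj_re, conj_im,
      one_re, one_im]
    ring
  refine le_of_sq_le_sq ?_ (norm_nonneg _)
  have h1 : 0 ≤ 1 - ‖z‖ ^ 2 := by nlinarith [norm_nonneg z]
  have h2 : 0 ≤ 1 - ‖ζ‖ ^ 2 := by nlinarith [norm_nonneg ζ]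
  nlinarith [mul_nonneg h1 h2]

theorem discWeight_eq_zero {z ζ : ℂ} (hζ : 1 ≤ ‖ζ‖) : discWeight z ζ = 0 := by
  have : max (1 - ‖ζ‖ ^ 2) 0 = 0 := max_eq_right (by nlinarith)
  simp [discWeight, this]

theorem hasCompactSupport_discWeight (z : ℂ) : HasCompactSupport (discWeight z) :=
  HasCompactSupport.of_support_subset_isCompact (isCompact_closedBall (0 : ℂ) 1) fun ζ hζ => by
    rw [mem_closedBall_zero_iff]
    by_contra h
    exact hζ (discWeight_eq_zero (not_le.1 h).le)

theorem discWeight_self {z : ℂ} (hz : ‖z‖ < 1) : discWeight z z = 1 := by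
  have h0 := one_sub_conj_mul_ne_zero hz hz.le
  have h1 : max (1 - ‖z‖ ^ 2) 0 = 1 - ‖z‖ ^ 2 := max_eq_left (by nlinarith [norm_nonneg z])
  have h2 : (starRingEnd ℂ) z * z = ((‖z‖ ^ 2 : ℝ) : ℂ) := by
    rw [mul_comm, mul_conj, normSq_eq_norm_sq]
  rw [discWeight, h1]
  rw [h2] at h0 ⊢
  push_cast at h0 ⊢
  field_simp

theorem norm_discWeight_le {z : ℂ} (hz : ‖z‖ < 1) (ζ : ℂ) : ‖discWeight z ζ‖ ≤ 4 := by
  rcases le_or_gt 1 ‖ζ‖ with h | h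
  · simp [discWeight_eq_zero h]
  have h0 : 0 < ‖1 - (starRingEnd ℂ) ζ * z‖ := norm_pos_iff.2 (one_sub_conj_mul_ne_zero hz h.le)
  have h1 : 0 ≤ 1 - ‖ζ‖ ^ 2 := by nlinarith [norm_nonneg ζ]
  rw [discWeight, norm_mul, norm_pow, norm_inv, norm_real, max_eq_left h1,
    Real.norm_of_nonneg (by positivity), inv_pow, ← div_eq_mul_inv, div_le_iff₀ (by positivity)]
  nlinarith [one_sub_sq_le hz h.le]

theorem contDiff_discWeight {z : ℂ} (hz : ‖z‖ < 1) : ContDiff ℝ 1 (discWeight z) := by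
  rw [contDiff_iff_contDiffAt]
  intro ζ
  rcases lt_or_ge 1 ‖ζ‖ with h | h
  · refine (contDiffAt_const (c := (0 : ℂ))).congr_of_eventuallyEq ?_
    filter_upwards [(continuous_norm.tendsto ζ).eventually_const_lt h] with w hw
    exact discWeight_eq_zero (le_of_lt hw)
  · unfold discWeight
    have hne := one_sub_conj_mul_ne_zero hz h
    refine ContDiffAt.mul ?_ (ContDiffAt.pow (ContDiffAt.fun_inv
      (f := fun ζ : ℂ => 1 - (starRingEnd ℂ) ζ * z) ?_ hne) 2)
    · refine ContDiff.contDiffAt (ofRealCLM.contDiff.comp (contDiff_max_zero_sq.comp ?_))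
      exact contDiff_const.sub (contDiff_id.norm_sq ℝ)
    · exact contDiffAt_const.sub
        (((conjCLE : ℂ →L[ℝ] ℂ).contDiff.contDiffAt).mul contDiffAt_const)

/-- Outside the closed disc the product is locally zero; on the circle the claim follows by
continuity of the derivative. Integrals over the plane therefore reduce to the disc without boundary
terms. -/
theorem dbarC_discWeight_mul_eq_zero {z ζ : ℂ} {f : ℂ → ℂ} (hz : ‖z‖ < 1) (hf : ContDiff ℝ 1 f)
    (hζ : 1 ≤ ‖ζ‖) : dbarC (fun w => discWeight z w * f w) ζ = 0 := by
  have hcl : ζ ∈ closure {w : ℂ | 1 < ‖w‖} := by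
    have : {w : ℂ | 1 < ‖w‖} = (Metric.closedBall 0 1)ᶜ := by ext w; simp
    rw [this, closure_compl, interior_closedBall _ one_ne_zero]
    simpa using hζ
  have hz0 : {w : ℂ | 1 < ‖w‖} ⊆ {w | dbarC (fun w => discWeight z w * f w) w = 0} := by
    intro w hw1
    have : (fun w => discWeight z w * f w) =ᶠ[𝓝 w] fun _ => 0 := by
      filter_upwards [(continuous_norm.tendsto w).eventually_const_lt hw1] with y hy
      rw [discWeight_eq_zero (le_of_lt hy), zero_mul]
    exact ((HasWirtingerAt.const 0 w).congr_of_eventuallyEq this).dbarC_eq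
  exact (isClosed_eq (continuous_dbarC ((contDiff_discWeight hz).mul hf))
    continuous_const).closure_subset_iff.2 hz0 hcl

/-- The kernel of the weighted holomorphic projection of the disc. -/
def discProj (z ζ : ℂ) : ℂ :=
  (2 / Real.pi) * ((1 - ‖ζ‖ ^ 2 : ℝ) : ℂ) * ((1 - (starRingEnd ℂ) ζ * z)⁻¹) ^ 3

/-- The factor `z - ζ` cancels the Cauchy singularity, so the term of Cauchy-Pompeiu carrying `v`
itself has the kernel `discProj`, holomorphic in `z`. -/
theorem dbarC_discWeight {z ζ : ℂ} (hz : ‖z‖ < 1) (hζ : ‖ζ‖ < 1) :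
    dbarC (discWeight z) ζ = Real.pi * (z - ζ) * discProj z ζ := by
  have h1 := (HasWirtingerAt.const 1 ζ).sub ((HasWirtingerAt.id ζ).mul (HasWirtingerAt.conj ζ))
  have h2 := ((HasWirtingerAt.const 1 ζ).sub
    ((HasWirtingerAt.conj ζ).mul (HasWirtingerAt.const z ζ)))
  have hne := one_sub_conj_mul_ne_zero hz hζ.le
  have h3 := h2.inv hne
  have h4 := (h1.mul h1).mul (h3.mul h3)
  have e : discWeight z =ᶠ[𝓝 ζ] fun w => (1 - w * (starRingEnd ℂ) w) * (1 - w * (starRingEnd ℂ) w)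
      * ((1 - (starRingEnd ℂ) w * z)⁻¹ * (1 - (starRingEnd ℂ) w * z)⁻¹) := by
    filter_upwards [(continuous_norm.tendsto ζ).eventually_lt_const hζ] with w hw
    have hw : ‖w‖ < 1 := hw
    have h1 : 0 ≤ 1 - ‖w‖ ^ 2 := by nlinarith [norm_nonneg w]
    rw [discWeight, max_eq_left h1, mul_conj, normSq_eq_norm_sq]
    push_cast
    ring
  rw [(h4.congr_of_eventuallyEq e).dbarC_eq, discProj, ← normSq_eq_norm_sq, ofReal_sub,
    ← mul_conj]
  have hpi : (Real.pi : ℂ) ≠ 0 := ofReal_ne_zero.2 Real.pi_ne_zero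
  field_simp
  push_cast
  ring

/-- With `A = |1 - ζ̄z|` the left side is `2 |z-ζ|² (1-|ζ|²) / A³`, and `|z-ζ| ≤ A`, `1-|ζ|² ≤ 2A`
cancel the denominator. The constant is uniform up to the boundary. -/
theorem norm_dbarC_discWeight_le {z ζ : ℂ} (hz : ‖z‖ < 1) (hζ : ‖ζ‖ < 1) :
    ‖dbarC (discWeight z) ζ‖ * ‖z - ζ‖ ≤ 4 := by
  have h0 : 0 < ‖1 - (starRingEnd ℂ) ζ * z‖ := norm_pos_iff.2 (one_sub_conj_mul_ne_zero hz hζ.le)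
  have h1 : 0 ≤ 1 - ‖ζ‖ ^ 2 := by nlinarith [norm_nonneg ζ]
  have h2 := one_sub_sq_le hz hζ.le
  have h3 := norm_sub_le_norm_one_sub hz hζ.le
  rw [dbarC_discWeight hz hζ, discProj]
  simp only [norm_mul, norm_div, norm_pow, norm_inv, norm_real, RCLike.norm_ofNat]
  rw [Real.norm_of_nonneg h1, Real.norm_of_nonneg Real.pi_pos.le]
  set A := ‖1 - (starRingEnd ℂ) ζ * z‖
  set d := ‖z - ζ‖
  have hd : 0 ≤ d := norm_nonneg _
  have hpi := Real.pi_ne_zero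
  have : Real.pi * d * (2 / Real.pi * (1 - ‖ζ‖ ^ 2) * A⁻¹ ^ 3) * d =
      2 * (d ^ 2 * (1 - ‖ζ‖ ^ 2)) / A ^ 3 := by field_simp
  rw [this, div_le_iff₀ (by positivity)]
  have h4 : d ^ 2 ≤ A ^ 2 := by gcongr
  have h5 := mul_le_mul h4 h2 h1 (by positivity)
  nlinarith

/-! ### Dyadic scales of the weighted Cauchy-Pompeiu formula and their `L¹` bounds. -/

/-- The regularized Cauchy kernel at the scale `2⁻ᵐ`; it is zero for `m = 0`. -/
def cauchyScale (m : ℕ) (z ζ : ℂ) : ℂ := if m = 0 then 0 else cauchyReg ((2 : ℝ)⁻¹ ^ m) z ζ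

theorem contDiff_cauchyScale (m : ℕ) (z : ℂ) : ContDiff ℝ 1 (cauchyScale m z) := by
  unfold cauchyScale
  split_ifs
  · exact contDiff_const
  · exact contDiff_cauchyReg (by positivity) z

/-- The kernel of the identity minus the regularized solution operator, with respect to
`discMeasure z`. -/
def discApprox (m : ℕ) (z ζ : ℂ) : ℂ :=
  if ζ = z then 1 else dbarC (fun w => discWeight z w * cauchyScale m z w) ζ

/-- The kernel `discProj`, with respect to `discMeasure z`. -/
def discLimit (z ζ : ℂ) : ℂ := if ζ = z then 0 else discProj z ζ

/-- The difference of the weighted Cauchy kernel and its regularization at scale `2⁻ᵐ`. -/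
def discDiff (m : ℕ) (z ζ : ℂ) : ℂ :=
  discWeight z ζ * ((Real.pi * (z - ζ))⁻¹ - cauchyScale m z ζ)

/-- Lebesgue measure on the disc plus a point mass at `z`. -/
def discMeasure (z : ℂ) : Measure ℂ := Measure.dirac z + volume.restrict (Metric.ball 0 1)

instance (z : ℂ) : IsFiniteMeasure (discMeasure z) := by
  have : IsFiniteMeasure (volume.restrict (Metric.ball (0 : ℂ) 1)) :=
    isFiniteMeasure_restrict.2 measure_ball_lt_top.ne
  unfold discMeasure; infer_instance

/-- By the convention `0⁻¹ = 0`, the singular kernel vanishes at its pole and does not see the point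
mass of `discMeasure`. -/
theorem discDiff_self (m : ℕ) (z : ℂ) : discDiff m z z = 0 := by
  simp only [discDiff, sub_self, mul_zero, inv_zero, cauchyScale, cauchyReg, map_zero, zero_mul]
  split_ifs <;> simp

theorem ae_ne (z : ℂ) : ∀ᵐ ζ ∂volume.restrict (Metric.ball (0 : ℂ) 1), ζ ≠ z :=
  ae_restrict_of_ae (Measure.ae_ne volume z)

theorem integral_discMeasure {z : ℂ} {f : ℂ → ℂ} (hf : IntegrableOn f (Metric.ball 0 1)) :
    ∫ ζ, f ζ ∂discMeasure z = f z + ∫ ζ in Metric.ball 0 1, f ζ := by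
  rw [discMeasure, integral_add_measure (integrable_dirac (by simp)) hf, integral_dirac]

theorem integrable_discMeasure {z : ℂ} {f : ℂ → ℂ} (hf : IntegrableOn f (Metric.ball 0 1)) :
    Integrable f (discMeasure z) := (integrable_dirac (by simp)).add_measure hf

theorem integrableOn_ball_of_continuous {f : ℂ → ℂ} (hf : Continuous f) (R : ℝ) :
    IntegrableOn f (Metric.ball 0 R) :=
  (hf.continuousOn.integrableOn_compact (isCompact_closedBall 0 R)).mono_set
    Metric.ball_subset_closedBall

theorem measurable_discWeight (z : ℂ) : Measurable (discWeight z) := by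
  unfold discWeight
  have : Measurable (fun ζ : ℂ => (starRingEnd ℂ) ζ) := continuous_conj.measurable
  fun_prop

theorem measurable_discDiff (m : ℕ) (z : ℂ) : Measurable (discDiff m z) := by
  have h1 := measurable_discWeight z
  have h2 := (contDiff_cauchyScale m z).continuous.measurable
  unfold discDiff
  fun_prop

theorem norm_inv_sub_cauchyReg {s : ℝ} (hs : 0 < s) {z ζ : ℂ} (h : z ≠ ζ) :
    ‖(Real.pi * (z - ζ))⁻¹ - cauchyReg s z ζ‖ =
      Real.pi⁻¹ * (s ^ 2 * (‖z - ζ‖ * (‖z - ζ‖ ^ 2 + s ^ 2))⁻¹) := by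
  have h0 : z - ζ ≠ 0 := sub_ne_zero.2 h
  have hpos : 0 < ‖z - ζ‖ := norm_pos_iff.2 h0
  have h3 : (starRingEnd ℂ) (z - ζ) ≠ 0 := (map_ne_zero _).2 h0
  have hpi : (Real.pi : ℂ) ≠ 0 := ofReal_ne_zero.2 Real.pi_ne_zero
  have h4 : ((Real.pi * (‖z - ζ‖ ^ 2 + s ^ 2) : ℝ) : ℂ) ≠ 0 := ofReal_ne_zero.2 (by positivity)
  have e : (Real.pi * (z - ζ))⁻¹ - cauchyReg s z ζ =
      ((s ^ 2 : ℝ) : ℂ) * ((z - ζ) * ((Real.pi * (‖z - ζ‖ ^ 2 + s ^ 2) : ℝ) : ℂ))⁻¹ := by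
    rw [cauchyReg]
    push_cast at h4 ⊢
    rw [← ofReal_pow ‖z - ζ‖, ofReal_norm_sub_sq] at h4 ⊢
    have h5 := right_ne_zero_of_mul h4
    field_simp
    ring
  rw [e, norm_mul, norm_inv, norm_mul, norm_real, norm_real, Real.norm_of_nonneg (by positivity),
    Real.norm_of_nonneg (by positivity)]
  field_simp

theorem norm_discDiff_zero_le {z : ℂ} (hz : ‖z‖ < 1) (ζ : ℂ) :
    ‖discDiff 0 z ζ‖ ≤ 4 * ‖z - ζ‖⁻¹ := by
  rw [discDiff, norm_mul]
  refine mul_le_mul (norm_discWeight_le hz ζ) ?_ (norm_nonneg _) (by norm_num)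
  simp only [cauchyScale, if_true, sub_zero, norm_inv, norm_mul, norm_real]
  rw [Real.norm_of_nonneg Real.pi_pos.le, mul_inv]
  refine mul_le_of_le_one_left (by positivity) (inv_le_one_of_one_le₀ ?_)
  linarith [Real.pi_gt_three]

theorem norm_discDiff_le {m : ℕ} (hm : m ≠ 0) {z : ℂ} (hz : ‖z‖ < 1) (ζ : ℂ) :
    ‖discDiff m z ζ‖ ≤ 4 * (((2 : ℝ)⁻¹ ^ m) ^ 2 *
      (‖z - ζ‖ * (‖z - ζ‖ ^ 2 + ((2 : ℝ)⁻¹ ^ m) ^ 2))⁻¹) := by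
  rcases eq_or_ne z ζ with rfl | h
  · rw [discDiff_self]; simp
  rw [discDiff, norm_mul]
  refine mul_le_mul (norm_discWeight_le hz ζ) ?_ (norm_nonneg _) (by norm_num)
  rw [cauchyScale, if_neg hm, norm_inv_sub_cauchyReg (by positivity) h]
  refine mul_le_of_le_one_left (by positivity) (inv_le_one_of_one_le₀ ?_)
  linarith [Real.pi_gt_three]

/-- For `z` and `ζ` in the unit disc, `z - ζ` lies in the disc of radius `2`. This makes bounds on
convolution kernels uniform in `z`. -/
theorem ball_integral_comp_sub_le {f : ℂ → ℝ} (hf : 0 ≤ f)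
    (hi : IntegrableOn f (Metric.ball 0 2)) {z : ℂ} (hz : ‖z‖ < 1) :
    IntegrableOn (fun ζ => f (z - ζ)) (Metric.ball 0 1) ∧
      ∫ ζ in Metric.ball 0 1, f (z - ζ) ≤ ∫ w in Metric.ball 0 2, f w := by
  have hi' := hi
  rw [← integrable_indicator_iff measurableSet_ball] at hi'
  have h1 := hi'.comp_sub_left z
  have h2 : ∀ ζ ∈ Metric.ball (0 : ℂ) 1,
      (Metric.ball (0 : ℂ) 2).indicator f (z - ζ) = f (z - ζ) := fun ζ hζ => by
    refine Set.indicator_of_mem ?_ _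
    rw [mem_ball_zero_iff] at hζ ⊢
    linarith [norm_sub_le z ζ]
  refine ⟨(h1.integrableOn (s := Metric.ball 0 1)).congr_fun h2 measurableSet_ball, ?_⟩
  rw [← setIntegral_congr_fun measurableSet_ball h2,
    ← integral_indicator (measurableSet_ball (x := (0 : ℂ)) (ε := 2)),
    ← integral_sub_left_eq_self ((Metric.ball (0 : ℂ) 2).indicator f) volume z]
  exact setIntegral_le_integral h1
    (Eventually.of_forall fun ζ => Set.indicator_nonneg (fun w _ => hf w) _)

/-- By homogeneity, regularizing the Cauchy kernel at scale `s` costs an `L¹` error proportional to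
`s`. -/
theorem integral_scaled_kernel {s : ℝ} (hs : 0 < s) :
    Integrable (fun w : ℂ => s ^ 2 * (‖w‖ * (‖w‖ ^ 2 + s ^ 2))⁻¹) ∧
    ∫ w : ℂ, s ^ 2 * (‖w‖ * (‖w‖ ^ 2 + s ^ 2))⁻¹ = s * ∫ w : ℂ, (‖w‖ * (1 + ‖w‖ ^ 2))⁻¹ := by
  have key : ∀ w : ℂ, s ^ 2 * (‖s • w‖ * (‖s • w‖ ^ 2 + s ^ 2))⁻¹ =
      s⁻¹ * (‖w‖ * (1 + ‖w‖ ^ 2))⁻¹ := by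
    intro w
    rw [norm_smul, Real.norm_of_nonneg hs.le]
    rcases eq_or_ne ‖w‖ 0 with h | h
    · simp [h]
    field_simp
    ring
  have h0 : Integrable (fun w : ℂ => s ^ 2 * (‖w‖ * (‖w‖ ^ 2 + s ^ 2))⁻¹) := by
    have := (integrable_inv_mul_one_add_sq.const_mul s⁻¹)
    rw [← integrable_comp_smul_iff (volume : Measure ℂ) _ hs.ne']
    exact this.congr (Eventually.of_forall fun w => (key w).symm)
  refine ⟨h0, ?_⟩
  have h := Measure.integral_comp_smul (volume : Measure ℂ)
    (fun w => s ^ 2 * (‖w‖ * (‖w‖ ^ 2 + s ^ 2))⁻¹) s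
  rw [Complex.finrank_real_complex, abs_of_nonneg (by positivity)] at h
  simp_rw [key] at h
  rw [integral_const_mul, smul_eq_mul] at h
  field_simp at h
  field_simp
  linarith

/-- The constant in the `L¹` bounds of `discDiff`. -/
def discDiffConst : ℝ :=
  4 * (∫ w in Metric.ball (0 : ℂ) 2, ‖w‖⁻¹) + 4 * ∫ w : ℂ, (‖w‖ * (1 + ‖w‖ ^ 2))⁻¹

theorem integrableOn_discDiff (m : ℕ) {z : ℂ} (hz : ‖z‖ < 1) :
    IntegrableOn (discDiff m z) (Metric.ball 0 1) ∧
      ∫ ζ in Metric.ball 0 1, ‖discDiff m z ζ‖ ≤ discDiffConst * (2 : ℝ)⁻¹ ^ m := by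
  have hA : 0 ≤ ∫ w in Metric.ball (0 : ℂ) 2, ‖w‖⁻¹ := integral_nonneg fun _ => by positivity
  have hB : 0 ≤ ∫ w : ℂ, (‖w‖ * (1 + ‖w‖ ^ 2))⁻¹ := integral_nonneg fun _ => by positivity
  have hmeas := (measurable_discDiff m z).aestronglyMeasurable
    (μ := volume.restrict (Metric.ball (0 : ℂ) 1))
  rcases eq_or_ne m 0 with rfl | hm
  · obtain ⟨i, hi⟩ := ball_integral_comp_sub_le (f := fun w => 4 * ‖w‖⁻¹)
      (fun w => by positivity) ((integrableOn_inv_norm 2).const_mul 4) hz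
    have i2 : IntegrableOn (discDiff 0 z) (Metric.ball 0 1) :=
      i.mono' hmeas (Eventually.of_forall fun ζ => norm_discDiff_zero_le hz ζ)
    refine ⟨i2, (integral_mono i2.norm i fun ζ => norm_discDiff_zero_le hz ζ).trans
      (hi.trans ?_)⟩
    rw [integral_const_mul, pow_zero, mul_one, discDiffConst]
    linarith
  · have hs : 0 < (2 : ℝ)⁻¹ ^ m := by positivity
    obtain ⟨j1, j2⟩ := integral_scaled_kernel hs
    obtain ⟨i, hi⟩ := ball_integral_comp_sub_le (f := fun w => 4 * (((2 : ℝ)⁻¹ ^ m) ^ 2 *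
      (‖w‖ * (‖w‖ ^ 2 + ((2 : ℝ)⁻¹ ^ m) ^ 2))⁻¹))
      (fun w => by positivity) (j1.const_mul 4).integrableOn hz
    have i2 : IntegrableOn (discDiff m z) (Metric.ball 0 1) :=
      i.mono' hmeas (Eventually.of_forall fun ζ => norm_discDiff_le hm hz ζ)
    refine ⟨i2, (integral_mono i2.norm i fun ζ => norm_discDiff_le hm hz ζ).trans
      (hi.trans ?_)⟩
    have := setIntegral_le_integral (s := Metric.ball (0 : ℂ) 2) (j1.const_mul 4)
      (Eventually.of_forall fun w => by positivity)
    refine this.trans ?_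
    rw [integral_const_mul, j2, discDiffConst]
    nlinarith [mul_nonneg hA hs.le]

/-- By the product rule there are two terms, each at most `4 / (|z-ζ|² + s²)`: the bounded weight
times the approximate identity, and `∂̄` of the weight (of size `1/|z-ζ|`) times the regularized
kernel. -/
theorem norm_dbarC_mul_cauchyScale_le {m : ℕ} (hm : m ≠ 0) {z ζ : ℂ} (hz : ‖z‖ < 1) (hζ : ‖ζ‖ < 1) :
    ‖dbarC (fun w => discWeight z w * cauchyScale m z w) ζ‖ ≤
      8 * (‖z - ζ‖ ^ 2 + ((2 : ℝ)⁻¹ ^ m) ^ 2)⁻¹ := by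
  have hs : 0 < (2 : ℝ)⁻¹ ^ m := by positivity
  set s := (2 : ℝ)⁻¹ ^ m with hsdef
  have e : cauchyScale m z = cauchyReg s z := by
    funext w; rw [cauchyScale, if_neg hm]
  rw [dbarC_mul ((contDiff_discWeight hz).differentiable (by simp) ζ)
    ((contDiff_cauchyScale m z).differentiable (by simp) ζ), e, dbarC_cauchyReg hs.ne']
  refine (norm_add_le _ _).trans ?_
  have hpi1 : (1 : ℝ) ≤ Real.pi := by linarith [Real.pi_gt_three]
  have hX : 0 < ‖z - ζ‖ ^ 2 + s ^ 2 := by positivity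
  have h1 : ‖discWeight z ζ * -((s ^ 2 * (Real.pi * (‖z - ζ‖ ^ 2 + s ^ 2) ^ 2)⁻¹ : ℝ) : ℂ)‖ ≤
      4 * (‖z - ζ‖ ^ 2 + s ^ 2)⁻¹ := by
    rw [norm_mul, norm_neg, norm_real, Real.norm_of_nonneg (by positivity)]
    refine mul_le_mul (norm_discWeight_le hz ζ) ?_ (by positivity) (by norm_num)
    rw [← div_eq_mul_inv, div_le_iff₀ (by positivity)]
    have : (‖z - ζ‖ ^ 2 + s ^ 2)⁻¹ * (Real.pi * (‖z - ζ‖ ^ 2 + s ^ 2) ^ 2) =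
        Real.pi * (‖z - ζ‖ ^ 2 + s ^ 2) := by field_simp
    rw [this]
    nlinarith [sq_nonneg ‖z - ζ‖, sq_nonneg s]
  have h2 : ‖dbarC (discWeight z) ζ * cauchyReg s z ζ‖ ≤ 4 * (‖z - ζ‖ ^ 2 + s ^ 2)⁻¹ := by
    rw [cauchyReg, norm_mul, norm_mul, RCLike.norm_conj, norm_inv, norm_real,
      Real.norm_of_nonneg (by positivity), ← mul_assoc]
    refine mul_le_mul (norm_dbarC_discWeight_le hz hζ) ?_ (by positivity) (by norm_num)
    rw [mul_inv]
    exact mul_le_of_le_one_left (by positivity) (inv_le_one_of_one_le₀ hpi1)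
  linarith

/-- In polar coordinates the integral is a logarithm of the ratio of the scales `2` and `2⁻ᵐ`; hence
the growth is only linear in `m`. -/
theorem integral_ball_inv_sq_add_sq (m : ℕ) :
    IntegrableOn (fun w : ℂ => (‖w‖ ^ 2 + ((2 : ℝ)⁻¹ ^ m) ^ 2)⁻¹) (Metric.ball 0 2) ∧
    ∫ w in Metric.ball (0 : ℂ) 2, (‖w‖ ^ 2 + ((2 : ℝ)⁻¹ ^ m) ^ 2)⁻¹ ≤ 8 * Real.pi * (m + 1) := by
  set s := (2 : ℝ)⁻¹ ^ m with hsdef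
  have hs : 0 < s := by positivity
  have hcont : Continuous fun w : ℂ => (‖w‖ ^ 2 + s ^ 2)⁻¹ :=
    Continuous.inv₀ (by fun_prop) fun w => by positivity
  refine ⟨(hcont.continuousOn.integrableOn_compact (isCompact_closedBall 0 2)).mono_set
    Metric.ball_subset_closedBall, ?_⟩
  have e1 : ∫ w in Metric.ball (0 : ℂ) 2, (‖w‖ ^ 2 + s ^ 2)⁻¹ =
      ∫ w : ℂ, (Set.Iio (2 : ℝ)).indicator (fun r => (r ^ 2 + s ^ 2)⁻¹) ‖w‖ := by
    rw [← integral_indicator measurableSet_ball]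
    congr 1; funext w
    simp [Set.indicator]
  rw [e1, integral_fun_norm_complex]
  have e2 : ∫ r in Set.Ioi (0 : ℝ), r * (Set.Iio (2 : ℝ)).indicator (fun r => (r ^ 2 + s ^ 2)⁻¹) r =
      ∫ r in (0 : ℝ)..2, r * (r ^ 2 + s ^ 2)⁻¹ := by
    rw [intervalIntegral.integral_of_le (by norm_num), integral_Ioc_eq_integral_Ioo,
      ← Set.Ioi_inter_Iio, ← setIntegral_indicator measurableSet_Iio]
    congr 1; funext r
    by_cases h : r ∈ Set.Iio (2 : ℝ) <;> simp [h]
  have hd : ∀ r : ℝ, HasDerivAt (fun r : ℝ => Real.log (r ^ 2 + s ^ 2) / 2)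
      (r * (r ^ 2 + s ^ 2)⁻¹) r := by
    intro r
    have h1 : HasDerivAt (fun r : ℝ => r ^ 2 + s ^ 2) (2 * r) r := by
      simpa using (hasDerivAt_pow 2 r).add_const (s ^ 2)
    refine ((h1.log (by positivity)).div_const 2).congr_deriv ?_
    field_simp
  rw [e2, intervalIntegral.integral_eq_sub_of_hasDerivAt (fun r _ => hd r)]
  · have hlog2 : Real.log 2 ≤ 1 := by linarith [Real.log_two_lt_d9]
    have h4 : Real.log ((2 : ℝ) ^ 2 + s ^ 2) ≤ 4 := by
      have hs1 : s ≤ 1 := pow_le_one₀ (by norm_num) (by norm_num)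
      have : Real.log ((2 : ℝ) ^ 2 + s ^ 2) ≤ Real.log (2 ^ 4) :=
        Real.log_le_log (by positivity) (by nlinarith)
      rw [Real.log_pow] at this
      push_cast at this; linarith
    have h5 : Real.log ((0 : ℝ) ^ 2 + s ^ 2) = -(2 * m * Real.log 2) := by
      rw [zero_pow two_ne_zero, zero_add, Real.log_pow, hsdef, Real.log_pow, Real.log_inv]
      push_cast; ring
    rw [h5]
    have hm0 : (0 : ℝ) ≤ m := Nat.cast_nonneg m
    have h6 : (m : ℝ) * Real.log 2 ≤ m := mul_le_of_le_one_right hm0 hlog2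
    have hpi := Real.pi_pos
    have : Real.log ((2 : ℝ) ^ 2 + s ^ 2) / 2 - -(2 * m * Real.log 2) / 2 ≤ 4 * (m + 1) := by
      generalize Real.log ((2 : ℝ) ^ 2 + s ^ 2) = L at h4 ⊢
      linarith
    calc _ ≤ 2 * Real.pi * (4 * (m + 1)) := by gcongr
      _ = _ := by ring
  · refine Continuous.intervalIntegrable ?_ _ _
    exact continuous_id.mul (Continuous.inv₀ (by fun_prop) fun w => by positivity)

theorem continuous_dbarC_mul_cauchyScale (m : ℕ) {z : ℂ} (hz : ‖z‖ < 1) :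
    Continuous (dbarC (fun w => discWeight z w * cauchyScale m z w)) :=
  continuous_dbarC ((contDiff_discWeight hz).mul (contDiff_cauchyScale m z))

theorem integral_norm_dbarC_le (m : ℕ) {z : ℂ} (hz : ‖z‖ < 1) :
    ∫ ζ in Metric.ball 0 1, ‖dbarC (fun w => discWeight z w * cauchyScale m z w) ζ‖ ≤
      64 * Real.pi * (m + 1) := by
  rcases eq_or_ne m 0 with rfl | hm
  · have : (fun w => discWeight z w * cauchyScale 0 z w) = fun _ => 0 := by
      funext w; simp [cauchyScale]
    rw [this]
    have h0 : ∀ ζ, dbarC (fun _ => (0 : ℂ)) ζ = 0 := fun ζ => (HasWirtingerAt.const 0 ζ).dbarC_eq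
    simp only [h0, norm_zero, integral_zero]
    positivity
  · obtain ⟨j1, j2⟩ := integral_ball_inv_sq_add_sq m
    obtain ⟨i, hi⟩ := ball_integral_comp_sub_le
      (f := fun w => 8 * (‖w‖ ^ 2 + ((2 : ℝ)⁻¹ ^ m) ^ 2)⁻¹)
      (fun w => by positivity) (j1.const_mul 8) hz
    refine (setIntegral_mono_on ?_ i measurableSet_ball fun ζ hζ =>
      norm_dbarC_mul_cauchyScale_le hm hz (by simpa using hζ)).trans (hi.trans ?_)
    · exact (integrableOn_ball_of_continuous (continuous_dbarC_mul_cauchyScale m hz) 1).norm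
    · rw [integral_const_mul]
      linarith

theorem continuousOn_discProj {z : ℂ} (hz : ‖z‖ < 1) :
    ContinuousOn (discProj z) (Metric.closedBall 0 1) := by
  unfold discProj
  refine ContinuousOn.mul (Continuous.continuousOn (by fun_prop)) (ContinuousOn.pow
    (ContinuousOn.inv₀ (Continuous.continuousOn ?_) fun ζ hζ =>
      one_sub_conj_mul_ne_zero hz (by simpa using hζ)) 3)
  have := continuous_conj
  fun_prop

theorem integrableOn_discProj_mul {z : ℂ} (hz : ‖z‖ < 1) {v : ℂ → ℂ} (hv : Continuous v) :
    IntegrableOn (fun ζ => discProj z ζ * v ζ) (Metric.ball 0 1) :=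
  (((continuousOn_discProj hz).mul hv.continuousOn).integrableOn_compact
    (isCompact_closedBall 0 1)).mono_set Metric.ball_subset_closedBall

theorem integrable_discApprox (m : ℕ) {z : ℂ} (hz : ‖z‖ < 1) :
    Integrable (discApprox m z) (discMeasure z) ∧
      ∫ ζ, ‖discApprox m z ζ‖ ∂discMeasure z ≤ 65 * Real.pi * (m + 1) := by
  have h1 := integrableOn_ball_of_continuous (continuous_dbarC_mul_cauchyScale m hz) 1
  have ae : dbarC (fun w => discWeight z w * cauchyScale m z w)
      =ᵐ[volume.restrict (Metric.ball 0 1)] discApprox m z := by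
    filter_upwards [ae_ne z] with ζ hζ
    rw [discApprox, if_neg hζ]
  have h2 : IntegrableOn (discApprox m z) (Metric.ball 0 1) := h1.congr ae
  refine ⟨integrable_discMeasure h2, ?_⟩
  rw [discMeasure, integral_add_measure (integrable_dirac (by simp)) h2.norm, integral_dirac,
    ← integral_congr_ae (show (fun ζ => ‖dbarC (fun w => discWeight z w * cauchyScale m z w) ζ‖)
      =ᵐ[volume.restrict (Metric.ball 0 1)] fun ζ => ‖discApprox m z ζ‖ from ae.fun_comp norm)]
  have h3 := integral_norm_dbarC_le m hz
  -- The point mass contributes exactly `1`, which turns the constant `64 π` into `65 π`.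
  have h4 : ‖discApprox m z z‖ = 1 := by simp [discApprox]
  rw [h4]
  have hpi := Real.pi_gt_three
  have hm0 : (0 : ℝ) ≤ m := Nat.cast_nonneg m
  nlinarith

theorem integrable_discLimit {z : ℂ} (hz : ‖z‖ < 1) : Integrable (discLimit z) (discMeasure z) := by
  refine integrable_discMeasure (Integrable.congr (integrableOn_discProj_mul hz
    (continuous_const (y := (1 : ℂ)))) ?_)
  filter_upwards [ae_ne z] with ζ hζ
  rw [discLimit, if_neg hζ, mul_one]

theorem integrable_discDiff (m : ℕ) {z : ℂ} (hz : ‖z‖ < 1) :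
    Integrable (discDiff m z) (discMeasure z) ∧
      ∫ ζ, ‖discDiff m z ζ‖ ∂discMeasure z ≤ discDiffConst * (2 : ℝ)⁻¹ ^ m := by
  obtain ⟨h1, h2⟩ := integrableOn_discDiff m hz
  refine ⟨integrable_discMeasure h1, ?_⟩
  rw [discMeasure, integral_add_measure (integrable_dirac (by simp)) h1.norm, integral_dirac,
    discDiff_self, norm_zero, zero_add]
  exact h2

theorem setIntegral_ball_eq_integral {f : ℂ → ℂ} (hf : ∀ ζ, 1 ≤ ‖ζ‖ → f ζ = 0) :
    ∫ ζ in Metric.ball 0 1, f ζ = ∫ ζ, f ζ := by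
  refine setIntegral_eq_integral_of_forall_compl_eq_zero fun ζ hζ => hf ζ ?_
  simpa using hζ

/-- The weighted Cauchy-Pompeiu formula of the disc, regularized at scale `2⁻ᵐ`. -/
theorem integral_discApprox_mul (m : ℕ) {z : ℂ} (hz : ‖z‖ < 1) {v : ℂ → ℂ} (hv : ContDiff ℝ 1 v) :
    ∫ ζ, discApprox m z ζ * v ζ ∂discMeasure z =
      (∫ ζ, discLimit z ζ * v ζ ∂discMeasure z) + ∫ ζ, discDiff m z ζ * dbarC v ζ ∂discMeasure z := by
  have hv' := continuous_dbarC hv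
  have hw := contDiff_discWeight hz
  have hw' := continuous_dbarC hw
  have hk := contDiff_cauchyScale m z
  have hwk := hw.mul hk
  have hc := hasCompactSupport_discWeight z
  have i1 : IntegrableOn (fun ζ => dbarC (fun w => discWeight z w * cauchyScale m z w) ζ * v ζ)
      (Metric.ball 0 1) :=
    integrableOn_ball_of_continuous ((continuous_dbarC_mul_cauchyScale m hz).mul hv.continuous) 1
  have a1 : (fun ζ => dbarC (fun w => discWeight z w * cauchyScale m z w) ζ * v ζ)
      =ᵐ[volume.restrict (Metric.ball 0 1)] fun ζ => discApprox m z ζ * v ζ := by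
    filter_upwards [ae_ne z] with ζ hζ
    rw [discApprox, if_neg hζ]
  have i2 := integrableOn_discProj_mul hz hv.continuous
  have a2 : (fun ζ => discProj z ζ * v ζ)
      =ᵐ[volume.restrict (Metric.ball 0 1)] fun ζ => discLimit z ζ * v ζ := by
    filter_upwards [ae_ne z] with ζ hζ
    rw [discLimit, if_neg hζ]
  have bdd : ∀ f : ℂ → ℂ, Continuous f →
      ∀ m, IntegrableOn (fun ζ => discDiff m z ζ * f ζ) (Metric.ball 0 1) := by
    intro f hf m
    obtain ⟨M, hM⟩ := (isCompact_closedBall (0 : ℂ) 1).exists_bound_of_continuousOn hf.continuousOn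
    refine Integrable.mul_bdd (c := M) (integrableOn_discDiff m hz).1 hf.aestronglyMeasurable ?_
    exact (ae_restrict_iff' measurableSet_ball).2 (Eventually.of_forall fun ζ hζ =>
      hM ζ (Metric.ball_subset_closedBall hζ))
  have i3 := bdd _ hv' m
  have i4 := bdd _ hv' 0
  have i5 : IntegrableOn (fun ζ => discWeight z ζ * cauchyScale m z ζ * dbarC v ζ)
      (Metric.ball 0 1) := integrableOn_ball_of_continuous
        ((hw.continuous.mul hk.continuous).mul hv') 1
  rw [integral_discMeasure (i1.congr a1), integral_discMeasure (i2.congr a2),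
    integral_discMeasure i3, ← integral_congr_ae a1, ← integral_congr_ae a2, discDiff_self]
  simp only [discApprox, discLimit, if_true, one_mul, zero_mul, zero_add]
  -- Integration by parts for the smooth part of the kernel; the singular kernel is handled by
  -- Cauchy-Pompeiu in `e2`, and `e3` splits the latter into the two.
  have e1 : ∫ ζ in Metric.ball 0 1, discWeight z ζ * cauchyScale m z ζ * dbarC v ζ =
      -∫ ζ in Metric.ball 0 1, dbarC (fun w => discWeight z w * cauchyScale m z w) ζ * v ζ := by
    rw [setIntegral_ball_eq_integral, setIntegral_ball_eq_integral]
    · exact integral_mul_dbarC hwk hv hc.mul_right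
    · intro ζ hζ
      rw [dbarC_discWeight_mul_eq_zero hz hk hζ, zero_mul]
    · intro ζ hζ
      simp [discWeight_eq_zero hζ]
  have e2 : v z = (∫ ζ in Metric.ball 0 1, discProj z ζ * v ζ) +
      ∫ ζ in Metric.ball 0 1, discDiff 0 z ζ * dbarC v ζ := by
    have h := cauchyPompeiu (hw.mul hv) hc.mul_right z
    rw [discWeight_self hz, one_mul] at h
    rw [← h, ← integral_add i2 i4, ← setIntegral_ball_eq_integral]
    · refine setIntegral_congr_ae measurableSet_ball ?_
      filter_upwards [Measure.ae_ne volume z] with ζ hζ hζ1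
      have hne : z - ζ ≠ 0 := sub_ne_zero.2 hζ.symm
      have hpi : (Real.pi : ℂ) ≠ 0 := ofReal_ne_zero.2 Real.pi_ne_zero
      rw [dbarC_mul (hw.differentiable (by simp) ζ) (hv.differentiable (by simp) ζ),
        dbarC_discWeight hz (by simpa using hζ1), discDiff, cauchyScale, if_pos rfl]
      field_simp
      ring
    · intro ζ hζ
      rw [dbarC_discWeight_mul_eq_zero hz hv hζ, mul_zero]
  have e3 : ∫ ζ in Metric.ball 0 1, discDiff m z ζ * dbarC v ζ =
      (∫ ζ in Metric.ball 0 1, discDiff 0 z ζ * dbarC v ζ) -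
      ∫ ζ in Metric.ball 0 1, discWeight z ζ * cauchyScale m z ζ * dbarC v ζ := by
    rw [← integral_sub i4 i5]
    congr 1; funext ζ
    simp only [discDiff, cauchyScale, if_true]
    ring
  rw [e3, e1]
  linear_combination e2

end DbarPolydisc

end

noncomputable section

namespace DbarPolydisc

open Complex Filter Topology

/-! ### Product kernels on the polydisc -/

theorem polydisc_eq_pi (n : ℕ) : polydisc n = Set.univ.pi fun _ : Fin n => Metric.ball (0 : ℂ) 1 := by
  ext z; simp [polydisc]

theorem measurableSet_polydisc (n : ℕ) : MeasurableSet (polydisc n) :=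
  (isOpen_polydisc n).measurableSet

/-- The product of the measures `discMeasure (z i)`. -/
def polyMeasure {n : ℕ} (z : Fin n → ℂ) : Measure (Fin n → ℂ) := Measure.pi fun i => discMeasure (z i)

theorem discMeasure_restrict_ball {z : ℂ} (hz : ‖z‖ < 1) :
    (discMeasure z).restrict (Metric.ball 0 1) = discMeasure z := by
  refine Measure.restrict_eq_self_of_ae_mem ?_
  rw [discMeasure, ae_add_measure_iff]
  exact ⟨(ae_dirac_iff measurableSet_ball).2 (by simpa using hz), ae_restrict_mem measurableSet_ball⟩

theorem polyMeasure_restrict {n : ℕ} {z : Fin n → ℂ} (hz : z ∈ polydisc n) :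
    (polyMeasure z).restrict (polydisc n) = polyMeasure z := by
  rw [polyMeasure, polydisc_eq_pi, Measure.restrict_pi_pi]
  simp_rw [fun i => discMeasure_restrict_ball (hz i)]

/-- Continuous and bounded on the polydisc. -/
structure ContBddOn {n : ℕ} (u : (Fin n → ℂ) → ℂ) (M : ℝ) : Prop where
  cont : ContinuousOn u (polydisc n)
  bdd : ∀ ζ ∈ polydisc n, ‖u ζ‖ ≤ M

variable {n : ℕ}

theorem ContBddOn.aestronglyMeasurable {u : (Fin n → ℂ) → ℂ} {M : ℝ} (hu : ContBddOn u M)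
    {z : Fin n → ℂ} (hz : z ∈ polydisc n) : AEStronglyMeasurable u (polyMeasure z) := by
  rw [← polyMeasure_restrict hz]
  exact hu.cont.aestronglyMeasurable (measurableSet_polydisc n)

theorem ContBddOn.ae_bdd {u : (Fin n → ℂ) → ℂ} {M : ℝ} (hu : ContBddOn u M)
    {z : Fin n → ℂ} (hz : z ∈ polydisc n) : ∀ᵐ ζ ∂polyMeasure z, ‖u ζ‖ ≤ M := by
  rw [← polyMeasure_restrict hz]
  exact (ae_restrict_iff' (measurableSet_polydisc n)).2 (Eventually.of_forall hu.bdd)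

theorem integrable_prod_mul {z : Fin n → ℂ} (hz : z ∈ polydisc n) {k : Fin n → ℂ → ℂ}
    (hk : ∀ l, Integrable (k l) (discMeasure (z l))) {u : (Fin n → ℂ) → ℂ} {M : ℝ}
    (hu : ContBddOn u M) :
    Integrable (fun ζ => (∏ l, k l (ζ l)) * u ζ) (polyMeasure z) :=
  Integrable.mul_bdd (c := M) (Integrable.fintype_prod hk) (hu.aestronglyMeasurable hz)
    (hu.ae_bdd hz)

theorem norm_integral_prod_mul_le {z : Fin n → ℂ} (hz : z ∈ polydisc n) {k : Fin n → ℂ → ℂ}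
    (hk : ∀ l, Integrable (k l) (discMeasure (z l))) {u : (Fin n → ℂ) → ℂ} {M : ℝ}
    (hu : ContBddOn u M) :
    ‖∫ ζ, (∏ l, k l (ζ l)) * u ζ ∂polyMeasure z‖ ≤ (∏ l, ∫ w, ‖k l w‖ ∂discMeasure (z l)) * M := by
  refine (norm_integral_le_integral_norm _).trans ?_
  have h1 : Integrable (fun ζ : Fin n → ℂ => ∏ l, ‖k l (ζ l)‖) (polyMeasure z) :=
    Integrable.fintype_prod fun l => (hk l).norm
  have h2 : ∫ ζ, ∏ l, ‖k l (ζ l)‖ ∂polyMeasure z = ∏ l, ∫ w, ‖k l w‖ ∂discMeasure (z l) :=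
    integral_fintype_prod_eq_prod (μ := fun l => discMeasure (z l)) fun l w => ‖k l w‖
  rw [← h2, ← integral_mul_const]
  refine integral_mono_ae (integrable_prod_mul hz hk hu).norm (h1.mul_const M) ?_
  filter_upwards [hu.ae_bdd hz] with ζ hζ
  simp only [norm_mul, norm_prod]
  exact mul_le_mul_of_nonneg_left hζ (Finset.prod_nonneg fun _ _ => norm_nonneg _)

/-! ### Telescoping of product kernels over the variables. -/

/-- The kernels `h'` before the index `i`, `b` at `i`, and `h` after `i`. -/
def mixKernel (h h' b : Fin n → ℂ → ℂ) (i l : Fin n) : ℂ → ℂ :=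
  if l < i then h' l else if l = i then b l else h l

theorem prod_sub_prod_eq_sum {R : Type*} [CommRing R] (f g : Fin n → R) :
    ∏ l, f l - ∏ l, g l =
      ∑ i, ∏ l, (if l < i then g l else if l = i then f l - g l else f l) := by
  induction n with
  | zero => simp
  | succ n ih =>
    have := ih (fun l => f l.succ) (fun l => g l.succ)
    simp only [Fin.sum_univ_succ, Fin.prod_univ_succ, Fin.not_lt_zero, if_false, if_true,
      Fin.succ_ne_zero, Fin.succ_lt_succ_iff, Fin.succ_inj, Fin.succ_pos, ← Finset.mul_sum]
    rw [← this]
    ring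

theorem integrable_mixKernel {z : Fin n → ℂ} {h h' b : Fin n → ℂ → ℂ}
    (hh : ∀ l, Integrable (h l) (discMeasure (z l)))
    (hh' : ∀ l, Integrable (h' l) (discMeasure (z l)))
    (hb : ∀ l, Integrable (b l) (discMeasure (z l))) (i l : Fin n) :
    Integrable (mixKernel h h' b i l) (discMeasure (z l)) := by
  unfold mixKernel
  split_ifs
  exacts [hh' l, hb l, hh l]

/-- By Fubini the `i`-th variable is integrated on its own, so a one-variable identity on slices may
be substituted there: this is where `u` is traded for its `∂̄ᵢ` derivative. -/
theorem integral_mixKernel_eq {z : Fin n → ℂ} (hz : z ∈ polydisc n) {h h' b c : Fin n → ℂ → ℂ}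
    (hh : ∀ l, Integrable (h l) (discMeasure (z l)))
    (hh' : ∀ l, Integrable (h' l) (discMeasure (z l)))
    (hb : ∀ l, Integrable (b l) (discMeasure (z l)))
    (hc : ∀ l, Integrable (c l) (discMeasure (z l)))
    {u v : (Fin n → ℂ) → ℂ} {M N : ℝ} (hu : ContBddOn u M) (hv : ContBddOn v N) (i : Fin n)
    (hs : ∀ ζ ∈ polydisc n, ∫ w, c i w * u (Function.update ζ i w) ∂discMeasure (z i) =
      ∫ w, b i w * v (Function.update ζ i w) ∂discMeasure (z i)) :
    ∫ ζ, (∏ l, mixKernel h h' c i l (ζ l)) * u ζ ∂polyMeasure z =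
      ∫ ζ, (∏ l, mixKernel h h' b i l (ζ l)) * v ζ ∂polyMeasure z := by
  cases n with
  | zero => exact i.elim0
  | succ n =>
    have hmp := (measurePreserving_piFinSuccAbove (fun l => discMeasure (z l)) i).symm
    have i1 := integrable_prod_mul hz (integrable_mixKernel hh hh' hc i) hu
    have i2 := integrable_prod_mul hz (integrable_mixKernel hh hh' hb i) hv
    unfold polyMeasure at i1 i2 ⊢
    rw [← hmp.integral_comp', ← hmp.integral_comp']
    rw [← hmp.integrable_comp_emb (MeasurableEquiv.measurableEmbedding _)] at i1 i2
    simp only [Function.comp_def] at i1 i2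
    rw [integral_prod_symm _ i1, integral_prod_symm _ i2]
    have hz' : (fun l => z (i.succAbove l)) ∈ polydisc n := fun l => hz _
    have hmem : ∀ᵐ η ∂Measure.pi (fun l => discMeasure (z (i.succAbove l))), η ∈ polydisc n := by
      have := polyMeasure_restrict hz'
      unfold polyMeasure at this
      rw [← this]
      exact ae_restrict_mem (measurableSet_polydisc n)
    refine integral_congr_ae ?_
    filter_upwards [hmem] with η hη
    have hins : ∀ w : ℂ, (MeasurableEquiv.piFinSuccAbove (fun _ => ℂ) i).symm (w, η) =
        i.insertNth (α := fun _ => ℂ) w η := fun w => rfl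
    have hupd : ∀ w : ℂ, i.insertNth (α := fun _ => ℂ) w η =
        Function.update (i.insertNth (α := fun _ => ℂ) 0 η) i w := by
      intro w
      rw [Fin.update_insertNth]
    have hmem0 : i.insertNth (α := fun _ => ℂ) 0 η ∈ polydisc (n + 1) := by
      intro l
      refine Fin.succAboveCases i ?_ (fun j => ?_) l
      · simp
      · simpa using hη j
    -- The other factors do not involve the `i`-th kernel, so `mixKernel` may be rewritten there
    -- with any filler, here `h`.
    have key : ∀ (d : Fin (n + 1) → ℂ → ℂ) (q : (Fin (n + 1) → ℂ) → ℂ),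
        ∫ w, (∏ l, mixKernel h h' d i l (i.insertNth (α := fun _ => ℂ) w η l)) *
          q (i.insertNth (α := fun _ => ℂ) w η) ∂discMeasure (z i) =
        (∏ j, mixKernel h h' h i (i.succAbove j) (η j)) *
          ∫ w, d i w * q (Function.update (i.insertNth (α := fun _ => ℂ) 0 η) i w)
            ∂discMeasure (z i) := by
      intro d q
      rw [← integral_const_mul]
      congr 1; funext w
      rw [Fin.prod_univ_succAbove _ i, ← hupd]
      simp only [Fin.insertNth_apply_same, Fin.insertNth_apply_succAbove]
      have e1 : mixKernel h h' d i i = d i := by simp [mixKernel]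
      have e2 : ∀ j, mixKernel h h' d i (i.succAbove j) = mixKernel h h' h i (i.succAbove j) := by
        intro j
        simp [mixKernel, Fin.succAbove_ne]
      simp_rw [e1, e2]
      ring
    simp only [hins, key]
    rw [hs _ hmem0]

/-- Replacing the kernels `h l` by `h' l` one variable at a time. -/
theorem integral_prod_sub_integral_prod {z : Fin n → ℂ} (hz : z ∈ polydisc n)
    {h h' b : Fin n → ℂ → ℂ}
    (hh : ∀ l, Integrable (h l) (discMeasure (z l)))
    (hh' : ∀ l, Integrable (h' l) (discMeasure (z l)))
    (hb : ∀ l, Integrable (b l) (discMeasure (z l)))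
    {u : (Fin n → ℂ) → ℂ} {g : Fin n → (Fin n → ℂ) → ℂ} {M N : ℝ} (hu : ContBddOn u M)
    (hg : ∀ i, ContBddOn (g i) N)
    (hs : ∀ ζ ∈ polydisc n, ∀ i,
      ∫ w, (h i w - h' i w) * u (Function.update ζ i w) ∂discMeasure (z i) =
      ∫ w, b i w * g i (Function.update ζ i w) ∂discMeasure (z i)) :
    (∫ ζ, (∏ l, h l (ζ l)) * u ζ ∂polyMeasure z) - ∫ ζ, (∏ l, h' l (ζ l)) * u ζ ∂polyMeasure z =
      ∑ i, ∫ ζ, (∏ l, mixKernel h h' b i l (ζ l)) * g i ζ ∂polyMeasure z := by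
  have hc : ∀ l, Integrable (fun w => h l w - h' l w) (discMeasure (z l)) :=
    fun l => (hh l).sub (hh' l)
  rw [← integral_sub (integrable_prod_mul hz hh hu) (integrable_prod_mul hz hh' hu)]
  have e : (fun ζ : Fin n → ℂ => (∏ l, h l (ζ l)) * u ζ - (∏ l, h' l (ζ l)) * u ζ) =
      fun ζ => ∑ i, (∏ l, mixKernel h h' (fun l w => h l w - h' l w) i l (ζ l)) * u ζ := by
    funext ζ
    rw [← sub_mul, prod_sub_prod_eq_sum, Finset.sum_mul]
    refine Finset.sum_congr rfl fun i _ => ?_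
    congr 1
    refine Finset.prod_congr rfl fun l _ => ?_
    unfold mixKernel
    split_ifs <;> rfl
  rw [e, integral_finsetSum _ fun i _ =>
    integrable_prod_mul hz (integrable_mixKernel hh hh' hc i) hu]
  exact Finset.sum_congr rfl fun i _ =>
    integral_mixKernel_eq hz hh hh' hb hc hu (hg i) i fun ζ hζ => hs ζ hζ i

theorem discMeasure_restrict_compl (z : ℂ) :
    (discMeasure z).restrict {z}ᶜ = volume.restrict (Metric.ball 0 1) := by
  rw [discMeasure, Measure.restrict_add, restrict_dirac' (measurableSet_singleton z).compl,
    if_neg (by simp), zero_add, restrict_compl_singleton]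

/-- Kernels which vanish at the point masses are integrated against Lebesgue measure. -/
theorem integral_polyMeasure_eq_setIntegral (z : Fin n → ℂ) {k : Fin n → ℂ → ℂ}
    (hk : ∀ l, k l (z l) = 0) (u : (Fin n → ℂ) → ℂ) :
    ∫ ζ, (∏ l, k l (ζ l)) * u ζ ∂polyMeasure z = ∫ ζ in polydisc n, (∏ l, k l (ζ l)) * u ζ := by
  have h1 : ∫ ζ, (∏ l, k l (ζ l)) * u ζ ∂polyMeasure z =
      ∫ ζ in Set.univ.pi (fun l => ({z l}ᶜ : Set ℂ)), (∏ l, k l (ζ l)) * u ζ ∂polyMeasure z := by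
    refine (setIntegral_eq_integral_of_forall_compl_eq_zero fun ζ hζ => ?_).symm
    simp only [Set.mem_pi, Set.mem_univ, true_implies, not_forall, Set.mem_compl_iff,
      Set.mem_singleton_iff, not_not] at hζ
    obtain ⟨l, hl⟩ := hζ
    rw [Finset.prod_eq_zero (Finset.mem_univ l) (by rw [hl, hk l]), zero_mul]
  rw [h1, polyMeasure, Measure.restrict_pi_pi, polydisc_eq_pi, volume_pi, Measure.restrict_pi_pi]
  simp_rw [discMeasure_restrict_compl]

end DbarPolydisc

end

noncomputable section

namespace DbarPolydisc

open Complex Filter Topology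

variable {n : ℕ}

/-! ### A solution operator bounded in the supremum norm -/

/-- The contribution of the scale `2⁻ᵐ` to the solution operator `polySolve`. -/
def polyTerm (m : ℕ) (g : Fin n → (Fin n → ℂ) → ℂ) (z : Fin n → ℂ) : ℂ :=
  ∑ i, ∫ ζ, (∏ l, mixKernel (fun l => discApprox m (z l)) (fun l => discApprox (m + 1) (z l))
    (fun l w => discDiff m (z l) w - discDiff (m + 1) (z l) w) i l (ζ l)) * g i ζ ∂polyMeasure z

/-- A solution operator of the Cauchy-Riemann equations on the polydisc. -/
def polySolve (g : Fin n → (Fin n → ℂ) → ℂ) (z : Fin n → ℂ) : ℂ := ∑' m, polyTerm m g z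

/-- One factor is small and the other `n - 1` grow at most like `A`; since `A ≥ 1` the exponent is
rounded up to `n`. -/
theorem prod_le_of_le_of_ne {a : Fin n → ℝ} {A b : ℝ} (hA : 1 ≤ A) (ha0 : ∀ l, 0 ≤ a l) (i : Fin n)
    (hi : a i ≤ b) (ha : ∀ l, l ≠ i → a l ≤ A) : ∏ l, a l ≤ b * A ^ n := by
  rw [← Finset.mul_prod_erase _ _ (Finset.mem_univ i)]
  have hb : 0 ≤ b := (ha0 i).trans hi
  refine mul_le_mul hi ?_ (Finset.prod_nonneg fun l _ => ha0 l) hb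
  calc ∏ l ∈ Finset.univ.erase i, a l ≤ ∏ _l ∈ Finset.univ.erase i, A :=
        Finset.prod_le_prod (fun l _ => ha0 l) fun l hl => ha l (Finset.ne_of_mem_erase hl)
    _ ≤ A ^ n := by
        rw [Finset.prod_const]
        refine pow_le_pow_right₀ hA ?_
        exact (Finset.card_le_univ _).trans (by simp)

theorem integrable_discDiff_sub (m : ℕ) {z : ℂ} (hz : ‖z‖ < 1) :
    Integrable (fun w => discDiff m z w - discDiff (m + 1) z w) (discMeasure z) :=
  (integrable_discDiff m hz).1.sub (integrable_discDiff (m + 1) hz).1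

theorem discDiffConst_nonneg : 0 ≤ discDiffConst := by
  unfold discDiffConst
  have hA : 0 ≤ ∫ w in Metric.ball (0 : ℂ) 2, ‖w‖⁻¹ := integral_nonneg fun _ => by positivity
  have hB : 0 ≤ ∫ w : ℂ, (‖w‖ * (1 + ‖w‖ ^ 2))⁻¹ := integral_nonneg fun _ => by positivity
  positivity

theorem integral_norm_discDiff_sub_le (m : ℕ) {z : ℂ} (hz : ‖z‖ < 1) :
    ∫ w, ‖discDiff m z w - discDiff (m + 1) z w‖ ∂discMeasure z ≤
      2 * discDiffConst * (2 : ℝ)⁻¹ ^ m := by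
  obtain ⟨i1, h1⟩ := integrable_discDiff m hz
  obtain ⟨i2, h2⟩ := integrable_discDiff (m + 1) hz
  calc _ ≤ ∫ w, (‖discDiff m z w‖ + ‖discDiff (m + 1) z w‖) ∂discMeasure z :=
        integral_mono (i1.sub i2).norm (i1.norm.add i2.norm) fun w => norm_sub_le _ _
    _ = _ := integral_add i1.norm i2.norm
    _ ≤ discDiffConst * (2 : ℝ)⁻¹ ^ m + discDiffConst * (2 : ℝ)⁻¹ ^ (m + 1) := add_le_add h1 h2
    _ ≤ _ := by
        have h3 : (2 : ℝ)⁻¹ ^ (m + 1) ≤ (2 : ℝ)⁻¹ ^ m :=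
          pow_le_pow_of_le_one (by norm_num) (by norm_num) (by simp)
        nlinarith [mul_le_mul_of_nonneg_left h3 discDiffConst_nonneg]

/-- The bound of `polyTerm m`. -/
def polyBound (n m : ℕ) : ℝ :=
  n * (2 * discDiffConst * (2 : ℝ)⁻¹ ^ m * (65 * Real.pi * (m + 2)) ^ n)

theorem polyBound_nonneg (n m : ℕ) : 0 ≤ polyBound n m := by
  have := discDiffConst_nonneg
  unfold polyBound; positivity

theorem summable_polyBound (n : ℕ) : Summable (polyBound n) := by
  have h1 : Summable fun m : ℕ => ((m : ℝ)) ^ n * (2 : ℝ)⁻¹ ^ m :=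
    summable_pow_mul_geometric_of_norm_lt_one n (by norm_num)
  have h2 := ((summable_nat_add_iff 2).2 h1).mul_left
    (n * (2 * discDiffConst * (65 * Real.pi) ^ n * 4))
  refine h2.congr fun m => ?_
  unfold polyBound
  push_cast
  rw [pow_add, mul_pow (65 * Real.pi)]
  ring

/-- In each summand the variable `i` contributes `2⁻ᵐ` and every other variable at most `65 π (m +
2)`, the mass of `discApprox` at scale `m` or `m + 1`. -/
theorem norm_polyTerm_le {z : Fin n → ℂ} (hz : z ∈ polydisc n) {g : Fin n → (Fin n → ℂ) → ℂ}
    {N : ℝ} (hg : ∀ i, ContBddOn (g i) N) (m : ℕ) :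
    ‖polyTerm m g z‖ ≤ polyBound n m * N := by
  have hN : ∀ _ : Fin n, 0 ≤ N := fun i => (norm_nonneg _).trans ((hg i).bdd z hz)
  have hpi := Real.pi_gt_three
  have hm : (0 : ℝ) ≤ m := Nat.cast_nonneg m
  have hA : 1 ≤ 65 * Real.pi * (m + 2) := by nlinarith
  refine (norm_sum_le _ _).trans ?_
  have key : ∀ i ∈ Finset.univ, ‖∫ ζ, (∏ l, mixKernel (fun l => discApprox m (z l))
      (fun l => discApprox (m + 1) (z l))
      (fun l w => discDiff m (z l) w - discDiff (m + 1) (z l) w) i l (ζ l)) * g i ζ ∂polyMeasure z‖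
      ≤ 2 * discDiffConst * (2 : ℝ)⁻¹ ^ m * (65 * Real.pi * (m + 2)) ^ n * N := by
    intro i _
    refine (norm_integral_prod_mul_le hz (integrable_mixKernel
      (fun l => (integrable_discApprox m (hz l)).1)
      (fun l => (integrable_discApprox (m + 1) (hz l)).1)
      (fun l => integrable_discDiff_sub m (hz l)) i) (hg i)).trans ?_
    refine mul_le_mul_of_nonneg_right ?_ (hN i)
    refine prod_le_of_le_of_ne hA (fun l => integral_nonneg fun _ => norm_nonneg _) i ?_ ?_
    · simp only [mixKernel, lt_self_iff_false, if_false, if_true]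
      exact integral_norm_discDiff_sub_le m (hz i)
    · intro l hl
      simp only [mixKernel, hl, if_false]
      split_ifs
      · refine (integrable_discApprox (m + 1) (hz l)).2.trans (le_of_eq ?_)
        push_cast; ring
      · refine (integrable_discApprox m (hz l)).2.trans ?_
        gcongr; norm_num
  refine (Finset.sum_le_sum key).trans (le_of_eq ?_)
  rw [Finset.sum_const, Finset.card_univ, Fintype.card_fin, nsmul_eq_mul, polyBound]
  ring

theorem summable_polyTerm {z : Fin n → ℂ} (hz : z ∈ polydisc n) {g : Fin n → (Fin n → ℂ) → ℂ}
    {N : ℝ} (hg : ∀ i, ContBddOn (g i) N) : Summable fun m => polyTerm m g z :=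
  Summable.of_norm_bounded ((summable_polyBound n).mul_right N) (norm_polyTerm_le hz hg)

/-- The norm of `polySolve` in the supremum norm is at most `polyConst n`. -/
def polyConst (n : ℕ) : ℝ := ∑' m, polyBound n m

theorem polyConst_nonneg (n : ℕ) : 0 ≤ polyConst n := tsum_nonneg (polyBound_nonneg n)

theorem norm_polySolve_le {z : Fin n → ℂ} (hz : z ∈ polydisc n) {g : Fin n → (Fin n → ℂ) → ℂ}
    {N : ℝ} (hg : ∀ i, ContBddOn (g i) N) : ‖polySolve g z‖ ≤ polyConst n * N := by
  unfold polySolve polyConst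
  rw [← tsum_mul_right]
  exact tsum_of_norm_bounded ((summable_polyBound n).mul_right N).hasSum (norm_polyTerm_le hz hg)

theorem polyTerm_add {z : Fin n → ℂ} (hz : z ∈ polydisc n) {f g : Fin n → (Fin n → ℂ) → ℂ}
    {M N : ℝ} (hf : ∀ i, ContBddOn (f i) M) (hg : ∀ i, ContBddOn (g i) N) (m : ℕ) :
    polyTerm m (f + g) z = polyTerm m f z + polyTerm m g z := by
  unfold polyTerm
  rw [← Finset.sum_add_distrib]
  refine Finset.sum_congr rfl fun i _ => ?_
  have hk := integrable_mixKernel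
      (fun l => (integrable_discApprox m (hz l)).1)
      (fun l => (integrable_discApprox (m + 1) (hz l)).1)
      (fun l => integrable_discDiff_sub m (hz l)) i
  rw [← integral_add (integrable_prod_mul hz hk (hf i)) (integrable_prod_mul hz hk (hg i))]
  simp only [Pi.add_apply, mul_add]

theorem polySolve_add {z : Fin n → ℂ} (hz : z ∈ polydisc n) {f g : Fin n → (Fin n → ℂ) → ℂ}
    {M N : ℝ} (hf : ∀ i, ContBddOn (f i) M) (hg : ∀ i, ContBddOn (g i) N) :
    polySolve (f + g) z = polySolve f z + polySolve g z := by
  unfold polySolve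
  rw [← (summable_polyTerm hz hf).tsum_add (summable_polyTerm hz hg)]
  exact tsum_congr fun m => polyTerm_add hz hf hg m

theorem polySolve_smul (c : ℂ) (g : Fin n → (Fin n → ℂ) → ℂ) (z : Fin n → ℂ) :
    polySolve (c • g) z = c * polySolve g z := by
  unfold polySolve
  rw [← tsum_mul_left]
  refine tsum_congr fun m => ?_
  unfold polyTerm
  rw [Finset.mul_sum]
  refine Finset.sum_congr rfl fun i _ => ?_
  rw [← integral_const_mul]
  simp only [Pi.smul_apply, smul_eq_mul]
  congr 1; funext ζ; ring

theorem dbarC_update {u : (Fin n → ℂ) → ℂ} {ζ : Fin n → ℂ} {i : Fin n} {w : ℂ}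
    (hu : DifferentiableAt ℝ u (Function.update ζ i w)) :
    dbarC (fun w => u (Function.update ζ i w)) w = dbar i u (Function.update ζ i w) := by
  have h := hu.hasFDerivAt.comp w (hasFDerivAt_update (𝕜 := ℝ) ζ w)
  have e : ∀ a : ℂ, (ContinuousLinearMap.pi (Pi.single (M := fun _ => ℂ →L[ℝ] ℂ) i
      (ContinuousLinearMap.id ℝ ℂ))) a = (Pi.single i a : Fin n → ℂ) := by
    intro a
    ext j
    rcases eq_or_ne j i with rfl | hj
    · simp
    · simp [hj]
  have h' := h.fderiv
  simp only [Function.comp_def] at h'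
  simp only [dbarC, dbar, h', ContinuousLinearMap.comp_apply, e]

theorem contDiff_update (ζ : Fin n → ℂ) (i : Fin n) (N : WithTop ℕ∞) :
    ContDiff ℝ N (Function.update ζ i : ℂ → Fin n → ℂ) := by
  rw [contDiff_pi]
  intro j
  rcases eq_or_ne j i with rfl | hj
  · simpa using contDiff_fun_id
  · simpa [hj] using contDiff_const

theorem update_mem_polydisc {ζ : Fin n → ℂ} (hζ : ζ ∈ polydisc n) (i : Fin n) {w : ℂ}
    (hw : ‖w‖ < 1) : Function.update ζ i w ∈ polydisc n := by
  intro j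
  rcases eq_or_ne j i with rfl | hj
  · simpa using hw
  · simpa [hj] using hζ j

theorem ae_discMeasure_norm_lt {z : ℂ} (hz : ‖z‖ < 1) : ∀ᵐ w ∂discMeasure z, ‖w‖ < 1 := by
  rw [← discMeasure_restrict_ball hz]
  filter_upwards [ae_restrict_mem measurableSet_ball] with w hw
  simpa using hw

theorem exists_contBddOn {u : (Fin n → ℂ) → ℂ} (hu : Continuous u) : ∃ M, ContBddOn u M := by
  obtain ⟨M, hM⟩ := (isCompact_closedBall (0 : Fin n → ℂ) 1).exists_bound_of_continuousOn
    hu.continuousOn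
  refine ⟨M, hu.continuousOn, fun ζ hζ => hM ζ ?_⟩
  rw [mem_closedBall_zero_iff, pi_norm_le_iff_of_nonneg zero_le_one]
  exact fun i => (hζ i).le

theorem ContBddOn.congr {u v : (Fin n → ℂ) → ℂ} {M : ℝ} (hu : ContBddOn u M)
    (h : ∀ ζ ∈ polydisc n, v ζ = u ζ) : ContBddOn v M :=
  ⟨hu.cont.congr h, fun ζ hζ => (h ζ hζ) ▸ hu.bdd ζ hζ⟩

theorem continuous_dbar {u : (Fin n → ℂ) → ℂ} (hu : ContDiff ℝ 1 u) (i : Fin n) :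
    Continuous (dbar i u) := by
  have := hu.continuous_fderiv (by simp)
  unfold dbar; fun_prop

theorem integrable_mul_slice {z : ℂ} (hz : ‖z‖ < 1) {k v : ℂ → ℂ}
    (hk : Integrable k (discMeasure z)) (hv : Continuous v) :
    Integrable (fun w => k w * v w) (discMeasure z) := by
  obtain ⟨M, hM⟩ := (isCompact_closedBall (0 : ℂ) 1).exists_bound_of_continuousOn hv.continuousOn
  refine Integrable.mul_bdd (c := M) hk hv.aestronglyMeasurable ?_
  filter_upwards [ae_discMeasure_norm_lt hz] with w hw
  exact hM w (by simpa using hw.le)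

/-! ### The two ends of the telescoping: the holomorphic projection and the identity. -/

/-- The weighted holomorphic projection of the polydisc. -/
def polyProj (u : (Fin n → ℂ) → ℂ) (z : Fin n → ℂ) : ℂ :=
  ∫ ζ in polydisc n, (∏ l, discProj (z l) (ζ l)) * u ζ

/-- `discLimit` differs from `discProj` only at the point mass, where it vanishes, so Lebesgue
measure alone remains. -/
theorem integral_discLimit_eq (z : Fin n → ℂ) (u : (Fin n → ℂ) → ℂ) :
    ∫ ζ, (∏ l, discLimit (z l) (ζ l)) * u ζ ∂polyMeasure z = polyProj u z := by
  rw [integral_polyMeasure_eq_setIntegral z (fun l => by simp [discLimit]), polyProj]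
  refine integral_congr_ae (ae_restrict_of_ae ?_)
  have : ∀ᵐ ζ : Fin n → ℂ, ∀ l, ζ l ≠ z l := ae_all_iff.2 fun l => by
    rw [volume_pi]; exact Measure.ae_eval_ne (fun _ : Fin n => (volume : Measure ℂ)) l (z l)
  filter_upwards [this] with ζ hζ
  simp [discLimit, hζ]

theorem discApprox_zero (z ζ : ℂ) : discApprox 0 z ζ = if ζ = z then 1 else 0 := by
  have : (fun w => discWeight z w * cauchyScale 0 z w) = fun _ => 0 := by
    funext w; simp [cauchyScale]
  rw [discApprox, this, (HasWirtingerAt.const 0 ζ).dbarC_eq]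

/-- At scale zero each kernel is the indicator of the point `z l`, which has mass one for
`discMeasure (z l)`: the product operator is the identity. -/
theorem integral_discApprox_zero (z : Fin n → ℂ) (u : (Fin n → ℂ) → ℂ) :
    ∫ ζ, (∏ l, discApprox 0 (z l) (ζ l)) * u ζ ∂polyMeasure z = u z := by
  have h0 := discApprox_zero
  have e : (fun ζ => (∏ l, discApprox 0 (z l) (ζ l)) * u ζ) =
      fun ζ => (∏ l, discApprox 0 (z l) (ζ l)) * u z := by
    funext ζ
    by_cases h : ζ = z
    · rw [h]
    · obtain ⟨l, hl⟩ := Function.ne_iff.1 h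
      have : ∏ l, discApprox 0 (z l) (ζ l) = 0 :=
        Finset.prod_eq_zero (Finset.mem_univ l) (by rw [h0, if_neg hl])
      rw [this, zero_mul, zero_mul]
  have h1 : ∀ l, ∫ w, discApprox 0 (z l) w ∂discMeasure (z l) = 1 := by
    intro l
    have hae : ∀ᵐ w ∂volume.restrict (Metric.ball (0 : ℂ) 1), discApprox 0 (z l) w = 0 := by
      filter_upwards [ae_ne (z l)] with w hw
      rw [h0, if_neg hw]
    have hi : IntegrableOn (discApprox 0 (z l)) (Metric.ball 0 1) :=
      (integrable_zero ℂ ℂ (volume.restrict (Metric.ball (0 : ℂ) 1))).congr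
        (hae.mono fun w hw => hw.symm)
    rw [integral_discMeasure hi, integral_congr_ae (hae.mono fun w hw => hw)]
    simp [h0]
  rw [e, integral_mul_const]
  have h2 : ∫ ζ, ∏ l, discApprox 0 (z l) (ζ l) ∂polyMeasure z =
      ∏ l, ∫ w, discApprox 0 (z l) w ∂discMeasure (z l) :=
    integral_fintype_prod_eq_prod (μ := fun l => discMeasure (z l)) fun l w => discApprox 0 (z l) w
  rw [h2]
  simp [h1]

section Solve

variable {u : (Fin n → ℂ) → ℂ} {g : Fin n → (Fin n → ℂ) → ℂ} {z : Fin n → ℂ}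

theorem integral_slice_congr (hu : ContDiff ℝ 1 u) (hg : ∀ i, ∀ ζ ∈ polydisc n, g i ζ = dbar i u ζ)
    (hz : z ∈ polydisc n) {ζ : Fin n → ℂ} (hζ : ζ ∈ polydisc n) (i : Fin n) (k : ℂ → ℂ) :
    ∫ w, k w * g i (Function.update ζ i w) ∂discMeasure (z i) =
      ∫ w, k w * dbarC (fun w => u (Function.update ζ i w)) w ∂discMeasure (z i) := by
  refine integral_congr_ae ?_
  filter_upwards [ae_discMeasure_norm_lt (hz i)] with w hw
  rw [hg i _ (update_mem_polydisc hζ i hw), dbarC_update (hu.differentiable (by simp) _)]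

theorem sum_polyTerm (hu : ContDiff ℝ 1 u) (hg : ∀ i, ∀ ζ ∈ polydisc n, g i ζ = dbar i u ζ)
    {N : ℝ} (hgb : ∀ i, ContBddOn (g i) N) (hz : z ∈ polydisc n) (m : ℕ) :
    ∑ j ∈ Finset.range m, polyTerm j g z =
      u z - ∫ ζ, (∏ l, discApprox m (z l) (ζ l)) * u ζ ∂polyMeasure z := by
  induction m with
  | zero => simp [integral_discApprox_zero]
  | succ m ih =>
    obtain ⟨M, hM⟩ := exists_contBddOn hu.continuous
    rw [Finset.sum_range_succ, ih, polyTerm, ← integral_prod_sub_integral_prod hz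
      (fun l => (integrable_discApprox m (hz l)).1)
      (fun l => (integrable_discApprox (m + 1) (hz l)).1)
      (fun l => integrable_discDiff_sub m (hz l)) hM hgb]
    · ring
    · intro ζ hζ i
      have hv : ContDiff ℝ 1 (fun w => u (Function.update ζ i w)) :=
        hu.comp (contDiff_update ζ i 1)
      rw [integral_slice_congr hu hg hz hζ i]
      simp only [sub_mul]
      -- The formulas at scales `m` and `m + 1` share the projection term, which cancels and leaves
      -- the two `discDiff` terms.
      rw [integral_sub, integral_sub, integral_discApprox_mul m (hz i) hv,
        integral_discApprox_mul (m + 1) (hz i) hv]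
      · ring
      · exact integrable_mul_slice (hz i) (integrable_discDiff _ (hz i)).1 (continuous_dbarC hv)
      · exact integrable_mul_slice (hz i) (integrable_discDiff _ (hz i)).1 (continuous_dbarC hv)
      · exact integrable_mul_slice (hz i) (integrable_discApprox _ (hz i)).1 hv.continuous
      · exact integrable_mul_slice (hz i) (integrable_discApprox _ (hz i)).1 hv.continuous

/-- The same telescoping over variables, now from scale `m` directly to the limit kernel. The
constant `c` depends on `z`, which is harmless because only pointwise convergence is needed. -/
theorem tendsto_integral_discApprox (hu : ContDiff ℝ 1 u)
    (hg : ∀ i, ∀ ζ ∈ polydisc n, g i ζ = dbar i u ζ)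
    {N : ℝ} (hgb : ∀ i, ContBddOn (g i) N) (hz : z ∈ polydisc n) :
    Tendsto (fun m => ∫ ζ, (∏ l, discApprox m (z l) (ζ l)) * u ζ ∂polyMeasure z) atTop
      (𝓝 (polyProj u z)) := by
  have hN : ∀ _ : Fin n, 0 ≤ N := fun i => (norm_nonneg _).trans ((hgb i).bdd z hz)
  obtain ⟨M, hM⟩ := exists_contBddOn hu.continuous
  set c : ℝ := 1 + ∑ l, ∫ w, ‖discLimit (z l) w‖ ∂discMeasure (z l) with hc
  have hl0 : ∀ l, 0 ≤ ∫ w, ‖discLimit (z l) w‖ ∂discMeasure (z l) :=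
    fun l => integral_nonneg fun _ => norm_nonneg _
  have hlc : ∀ l, ∫ w, ‖discLimit (z l) w‖ ∂discMeasure (z l) ≤ c := fun l => by
    have := Finset.single_le_sum (fun l _ => hl0 l) (Finset.mem_univ l)
    linarith
  have hc1 : 1 ≤ c := by
    have := Finset.sum_nonneg fun l (_ : l ∈ Finset.univ) => hl0 l
    linarith
  have hpi := Real.pi_gt_three
  have bound : ∀ m, ‖(∫ ζ, (∏ l, discApprox m (z l) (ζ l)) * u ζ ∂polyMeasure z) - polyProj u z‖ ≤
      c ^ n * (polyBound n m * N) := by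
    intro m
    have hm : (0 : ℝ) ≤ m := Nat.cast_nonneg m
    have hA : 1 ≤ c * (65 * Real.pi * (m + 2)) := one_le_mul_of_one_le_of_one_le hc1 (by nlinarith)
    rw [← integral_discLimit_eq, integral_prod_sub_integral_prod hz
      (fun l => (integrable_discApprox m (hz l)).1)
      (fun l => integrable_discLimit (hz l))
      (fun l => (integrable_discDiff m (hz l)).1) hM hgb]
    · refine (norm_sum_le _ _).trans ?_
      have key : ∀ i ∈ Finset.univ, ‖∫ ζ, (∏ l, mixKernel (fun l => discApprox m (z l))
          (fun l => discLimit (z l)) (fun l => discDiff m (z l)) i l (ζ l)) * g i ζ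
          ∂polyMeasure z‖ ≤
          2 * discDiffConst * (2 : ℝ)⁻¹ ^ m * (c * (65 * Real.pi * (m + 2))) ^ n * N := by
        intro i _
        refine (norm_integral_prod_mul_le hz (integrable_mixKernel
          (fun l => (integrable_discApprox m (hz l)).1)
          (fun l => integrable_discLimit (hz l))
          (fun l => (integrable_discDiff m (hz l)).1) i) (hgb i)).trans ?_
        refine mul_le_mul_of_nonneg_right ?_ (hN i)
        refine prod_le_of_le_of_ne hA (fun l => integral_nonneg fun _ => norm_nonneg _) i ?_ ?_
        · simp only [mixKernel, lt_self_iff_false, if_false, if_true]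
          refine (integrable_discDiff m (hz i)).2.trans ?_
          have := discDiffConst_nonneg
          gcongr
          linarith
        · intro l hl
          simp only [mixKernel, hl, if_false]
          split_ifs
          · refine (hlc l).trans (le_mul_of_one_le_right (by linarith) (by nlinarith))
          · refine (integrable_discApprox m (hz l)).2.trans ?_
            refine le_trans ?_ (le_mul_of_one_le_left (by positivity) hc1)
            gcongr; norm_num
      refine (Finset.sum_le_sum key).trans (le_of_eq ?_)
      rw [Finset.sum_const, Finset.card_univ, Fintype.card_fin, nsmul_eq_mul, polyBound,
        mul_pow c]
      ring
    · intro ζ hζ i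
      have hv : ContDiff ℝ 1 (fun w => u (Function.update ζ i w)) :=
        hu.comp (contDiff_update ζ i 1)
      rw [integral_slice_congr hu hg hz hζ i]
      simp only [sub_mul]
      rw [integral_sub, integral_discApprox_mul m (hz i) hv]
      · ring
      · exact integrable_mul_slice (hz i) (integrable_discApprox _ (hz i)).1 hv.continuous
      · exact integrable_mul_slice (hz i) (integrable_discLimit (hz i)) hv.continuous
  rw [tendsto_iff_norm_sub_tendsto_zero]
  refine squeeze_zero (fun _ => norm_nonneg _) bound ?_
  simpa using ((summable_polyBound n).tendsto_atTop_zero.mul_const N).const_mul (c ^ n)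

/-- The series telescopes from the identity to the projection. Once some smooth solution `u` is
known, `polySolve g` is seen to differ from it by a function holomorphic in each variable. -/
theorem polySolve_eq (hu : ContDiff ℝ 1 u) (hg : ∀ i, ∀ ζ ∈ polydisc n, g i ζ = dbar i u ζ)
    (hz : z ∈ polydisc n) : polySolve g z = u z - polyProj u z := by
  have hN : ∃ N, ∀ i, ContBddOn (g i) N := by
    choose N hN using fun i => exists_contBddOn (continuous_dbar hu i)
    refine ⟨∑ i, |N i|, fun i => ContBddOn.congr ⟨(hN i).cont, fun ζ hζ => ?_⟩ (hg i)⟩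
    exact (((hN i).bdd ζ hζ).trans (le_abs_self _)).trans
      (Finset.single_le_sum (f := fun i => |N i|) (fun _ _ => abs_nonneg _) (Finset.mem_univ i))
  obtain ⟨N, hgb⟩ := hN
  have h1 := (summable_polyTerm hz hgb).hasSum.tendsto_sum_nat
  have h2 := (tendsto_integral_discApprox hu hg hgb hz).const_sub (u z)
  refine tendsto_nhds_unique h1 (h2.congr fun m => ?_)
  rw [sum_polyTerm hu hg hgb hz]

end Solve

/-! ### Regularity of the projection -/

theorem norm_one_sub_conj_mul_ge {r : ℝ} {z ζ : ℂ} (hz : ‖z‖ ≤ r) (hζ : ‖ζ‖ ≤ 1) :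
    1 - r ≤ ‖1 - (starRingEnd ℂ) ζ * z‖ := by
  have := norm_sub_norm_le (1 : ℂ) ((starRingEnd ℂ) ζ * z)
  rw [norm_one, norm_mul, RCLike.norm_conj] at this
  nlinarith [norm_nonneg z, norm_nonneg ζ]

theorem norm_two_div_pi_mul_le {ζ : ℂ} (hζ : ‖ζ‖ ≤ 1) :
    ‖(2 / Real.pi : ℂ) * ((1 - ‖ζ‖ ^ 2 : ℝ) : ℂ)‖ ≤ 1 := by
  have h1 : 0 ≤ 1 - ‖ζ‖ ^ 2 := by nlinarith [norm_nonneg ζ]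
  rw [norm_mul, norm_div, norm_real, norm_real, RCLike.norm_ofNat, Real.norm_of_nonneg h1,
    Real.norm_of_nonneg Real.pi_pos.le]
  have h2 : 2 / Real.pi ≤ 1 := by
    rw [div_le_one Real.pi_pos]; linarith [Real.pi_gt_three]
  have h3 : 1 - ‖ζ‖ ^ 2 ≤ 1 := by nlinarith [norm_nonneg ζ]
  exact mul_le_one₀ h2 h1 h3

theorem norm_discProj_le {r : ℝ} (hr : r < 1) {z ζ : ℂ} (hz : ‖z‖ ≤ r) (hζ : ‖ζ‖ ≤ 1) :
    ‖discProj z ζ‖ ≤ ((1 - r)⁻¹) ^ 3 := by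
  rw [discProj, norm_mul, norm_pow, norm_inv]
  have h0 : 0 < 1 - r := by linarith
  refine (mul_le_mul (norm_two_div_pi_mul_le hζ) (pow_le_pow_left₀ (by positivity)
    (inv_anti₀ h0 (norm_one_sub_conj_mul_ge hz hζ)) 3) (by positivity) zero_le_one).trans ?_
  rw [one_mul]

theorem hasDerivAt_discProj {z ζ : ℂ} (hz : ‖z‖ < 1) (hζ : ‖ζ‖ ≤ 1) :
    HasDerivAt (fun z => discProj z ζ) ((2 / Real.pi) * ((1 - ‖ζ‖ ^ 2 : ℝ) : ℂ) *
      (3 * (starRingEnd ℂ) ζ * ((1 - (starRingEnd ℂ) ζ * z)⁻¹) ^ 4)) z := by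
  have hne := one_sub_conj_mul_ne_zero hz hζ
  have h1 : HasDerivAt (fun z => 1 - (starRingEnd ℂ) ζ * z) (-(starRingEnd ℂ) ζ) z := by
    simpa using ((hasDerivAt_id z).const_mul ((starRingEnd ℂ) ζ)).const_sub 1
  refine (((h1.inv hne).pow 3).const_mul _).congr_deriv ?_
  simp only [Pi.inv_apply]
  push_cast
  field_simp

theorem continuousOn_prod_discProj {z : Fin n → ℂ} (hz : z ∈ polydisc n) :
    ContinuousOn (fun ζ : Fin n → ℂ => ∏ l, discProj (z l) (ζ l)) (polydisc n) :=
  continuousOn_finsetProd _ fun l _ => (continuousOn_discProj (hz l)).comp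
    (continuous_apply l).continuousOn fun ζ hζ => by simpa using (hζ l).le

theorem isFiniteMeasure_polydisc (n : ℕ) : IsFiniteMeasure (volume.restrict (polydisc n)) := by
  refine isFiniteMeasure_restrict.2 (lt_of_le_of_lt (measure_mono ?_)
    (measure_closedBall_lt_top (x := (0 : Fin n → ℂ)) (r := 1))).ne
  intro z hz
  rw [mem_closedBall_zero_iff, pi_norm_le_iff_of_nonneg zero_le_one]
  exact fun i => (hz i).le

theorem continuousOn_polyProj {u : (Fin n → ℂ) → ℂ} {M : ℝ} (hu : ContBddOn u M) :
    ContinuousOn (polyProj u) (polydisc n) := by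
  intro z hz
  have := isFiniteMeasure_polydisc n
  refine ContinuousAt.continuousWithinAt ?_
  obtain ⟨r, hzr, hr⟩ : ∃ r < 1, ∀ l, ‖z l‖ < r := by
    rcases isEmpty_or_nonempty (Fin n) with h | h
    · exact ⟨0, by norm_num, fun l => h.elim l⟩
    · have h1 : ‖z‖ < 1 := (pi_norm_lt_iff zero_lt_one).2 hz
      obtain ⟨r, h2, h3⟩ := exists_between h1
      exact ⟨r, h3, fun l => (norm_le_pi_norm z l).trans_lt h2⟩
  have hev : ∀ᶠ y in 𝓝 z, ∀ l, ‖y l‖ < r := by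
    rw [eventually_all]
    exact fun l => ((continuous_apply l).norm.tendsto z).eventually_lt_const (hr l)
  refine tendsto_integral_filter_of_dominated_convergence
    (fun _ => (((1 - r)⁻¹) ^ 3) ^ n * M) ?_ ?_ (integrable_const _) ?_
  · filter_upwards [hev] with y hy
    exact ((continuousOn_prod_discProj fun l => (hy l).trans hzr).mul
      hu.cont).aestronglyMeasurable (measurableSet_polydisc n)
  · filter_upwards [hev] with y hy
    refine (ae_restrict_iff' (measurableSet_polydisc n)).2 (Eventually.of_forall fun ζ hζ => ?_)
    rw [norm_mul, norm_prod]
    refine mul_le_mul ?_ (hu.bdd ζ hζ) (norm_nonneg _) (by positivity)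
    calc ∏ l, ‖discProj (y l) (ζ l)‖ ≤ ∏ _l : Fin n, ((1 - r)⁻¹) ^ 3 :=
          Finset.prod_le_prod (fun _ _ => norm_nonneg _) fun l _ =>
            norm_discProj_le hzr (hy l).le (hζ l).le
      _ = _ := by simp
  · refine (ae_restrict_iff' (measurableSet_polydisc n)).2 (Eventually.of_forall fun ζ hζ => ?_)
    refine Tendsto.mul_const _ (tendsto_finsetProd _ fun l _ => ?_)
    exact ((hasDerivAt_discProj (hz l) (hζ l).le).continuousAt.tendsto).comp
      ((continuous_apply l).tendsto z)

/-- Differentiation under the integral: only `discProj` depends on `w`, holomorphically, with bounds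
uniform on `|w| ≤ r < 1`. -/
theorem differentiableOn_polyProj_slice {u : (Fin n → ℂ) → ℂ} {M : ℝ} (hu : ContBddOn u M)
    {z : Fin n → ℂ} (hz : z ∈ polydisc n) (i : Fin n) :
    DifferentiableOn ℂ (fun w => polyProj u (Function.update z i w)) (Metric.ball 0 1) := by
  intro w₀ hw₀
  have := isFiniteMeasure_polydisc n
  rw [mem_ball_zero_iff] at hw₀
  obtain ⟨r, hr0, hr1⟩ := exists_between hw₀
  have h0 : 0 < 1 - r := by linarith
  have hM0 : 0 ≤ M := (norm_nonneg _).trans (hu.bdd z hz)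
  set C : (Fin n → ℂ) → ℂ := fun ζ => (∏ l ∈ Finset.univ.erase i, discProj (z l) (ζ l)) * u ζ
  have hCcont : ContinuousOn C (polydisc n) :=
    (continuousOn_finsetProd _ fun l _ => (continuousOn_discProj (hz l)).comp
      (continuous_apply l).continuousOn fun ζ hζ => by simpa using (hζ l).le).mul hu.cont
  obtain ⟨K, hK⟩ : ∃ K, ∀ ζ ∈ polydisc n, ‖C ζ‖ ≤ K := by
    refine ⟨(∏ l ∈ Finset.univ.erase i, ((1 - ‖z l‖)⁻¹) ^ 3) * M, fun ζ hζ => ?_⟩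
    rw [norm_mul, norm_prod]
    refine mul_le_mul (Finset.prod_le_prod (fun _ _ => norm_nonneg _) fun l _ =>
      norm_discProj_le (hz l) le_rfl (hζ l).le) (hu.bdd ζ hζ) (norm_nonneg _)
      (Finset.prod_nonneg fun l _ => ?_)
    have := hz l
    have : 0 < 1 - ‖z l‖ := by linarith
    positivity
  have hK0 : 0 ≤ K := (norm_nonneg _).trans (hK z hz)
  have e : ∀ w, polyProj u (Function.update z i w) =
      ∫ ζ in polydisc n, discProj w (ζ i) * C ζ := by
    intro w
    unfold polyProj
    congr 1; funext ζ
    rw [← Finset.mul_prod_erase _ _ (Finset.mem_univ i), mul_assoc]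
    congr 2
    · simp
    · refine Finset.prod_congr rfl fun l hl => ?_
      rw [Function.update_of_ne (Finset.ne_of_mem_erase hl)]
  simp_rw [e]
  have hs : Metric.ball (0 : ℂ) r ∈ 𝓝 w₀ := Metric.isOpen_ball.mem_nhds (by simpa using hr0)
  have hmeas : ∀ w : ℂ, ‖w‖ < 1 → AEStronglyMeasurable (fun ζ => discProj w (ζ i) * C ζ)
      (volume.restrict (polydisc n)) := fun w hw =>
    (((continuousOn_discProj hw).comp (continuous_apply i).continuousOn fun ζ hζ => by
      simpa using (hζ i).le).mul hCcont).aestronglyMeasurable (measurableSet_polydisc n)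
  have hconj := continuous_conj
  refine ((hasDerivAt_integral_of_dominated_loc_of_deriv_le (bound := fun _ =>
    3 * ((1 - r)⁻¹) ^ 4 * K) (F' := fun w ζ => (2 / Real.pi) * ((1 - ‖ζ i‖ ^ 2 : ℝ) : ℂ) *
      (3 * (starRingEnd ℂ) (ζ i) * ((1 - (starRingEnd ℂ) (ζ i) * w)⁻¹) ^ 4) * C ζ) hs ?_ ?_ ?_ ?_
      (integrable_const _) ?_).2.differentiableAt).differentiableWithinAt
  · filter_upwards [hs] with w hw
    exact hmeas w ((mem_ball_zero_iff.1 hw).trans hr1)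
  · refine (integrable_const (((1 - r)⁻¹) ^ 3 * K)).mono' (hmeas w₀ hw₀)
      ((ae_restrict_iff' (measurableSet_polydisc n)).2 (Eventually.of_forall fun ζ hζ => ?_))
    rw [norm_mul]
    exact mul_le_mul (norm_discProj_le hr1 hr0.le (hζ i).le) (hK ζ hζ) (norm_nonneg _)
      (by positivity)
  · refine ContinuousOn.aestronglyMeasurable (ContinuousOn.mul (ContinuousOn.mul
      (Continuous.continuousOn (by fun_prop)) (ContinuousOn.mul
      (Continuous.continuousOn (by fun_prop)) (ContinuousOn.pow (ContinuousOn.inv₀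
      (Continuous.continuousOn (by fun_prop)) ?_) 4))) hCcont) (measurableSet_polydisc n)
    exact fun ζ hζ => one_sub_conj_mul_ne_zero hw₀ (hζ i).le
  · refine (ae_restrict_iff' (measurableSet_polydisc n)).2 (Eventually.of_forall
      fun ζ hζ w hw => ?_)
    have hw' : ‖w‖ ≤ r := (mem_ball_zero_iff.1 hw).le
    rw [norm_mul]
    refine mul_le_mul ?_ (hK ζ hζ) (norm_nonneg _) (by positivity)
    rw [norm_mul]
    refine (mul_le_of_le_one_left (norm_nonneg _) (norm_two_div_pi_mul_le (hζ i).le)).trans ?_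
    rw [norm_mul, norm_mul, norm_pow, norm_inv, RCLike.norm_ofNat, RCLike.norm_conj]
    have h5 := pow_le_pow_left₀ (by positivity)
      (inv_anti₀ h0 (norm_one_sub_conj_mul_ge hw' (hζ i).le)) 4
    refine mul_le_mul ?_ h5 (by positivity) (by norm_num)
    have := (hζ i).le
    linarith
  · refine (ae_restrict_iff' (measurableSet_polydisc n)).2 (Eventually.of_forall
      fun ζ hζ w hw => ?_)
    exact (hasDerivAt_discProj ((mem_ball_zero_iff.1 hw).trans hr1) (hζ i).le).mul_const _

end DbarPolydisc

end

noncomputable section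

namespace DbarPolydisc

open Complex Filter Topology

variable {n : ℕ}

/-! ### Averages of translates -/

section Average

variable {E : Type} [NormedAddCommGroup E] [NormedSpace ℝ E] [FiniteDimensional ℝ E]
  {Ω : Type*} [MeasurableSpace Ω]

/-- The average of the translates of `F` by `p w`, with weights `κ w`. -/
def avg {G : Type} [NormedAddCommGroup G] [NormedSpace ℝ G] [NormedSpace ℂ G] (μ : Measure Ω)
    (κ : Ω → ℂ) (p : Ω → E) (F : E → G) (z : E) : G :=
  ∫ w, κ w • F (z + p w) ∂μ

variable {μ : Measure Ω} {κ : Ω → ℂ} {p : Ω → E} {R : ℝ}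

theorem integrable_avg (hκ : Integrable κ μ)
    (hp : AEStronglyMeasurable p μ) (hR : ∀ᵐ w ∂μ, ‖p w‖ ≤ R) {G : Type} [NormedAddCommGroup G]
    [NormedSpace ℂ G] {F : E → G} (hF : Continuous F)
    (z : E) : Integrable (fun w => κ w • F (z + p w)) μ := by
  have : ProperSpace E := FiniteDimensional.proper ℝ E
  obtain ⟨C, hC⟩ := (isCompact_closedBall (0 : E) (‖z‖ + R)).exists_bound_of_continuousOn
    hF.continuousOn
  refine (hκ.norm.mul_const C).mono' (hκ.aestronglyMeasurable.smul
    (hF.comp_aestronglyMeasurable (hp.const_add z))) ?_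
  filter_upwards [hR] with w hw
  rw [norm_smul]
  refine mul_le_mul_of_nonneg_left (hC _ ?_) (norm_nonneg _)
  rw [mem_closedBall_zero_iff]
  exact (norm_add_le _ _).trans (by linarith)

variable {G : Type} [NormedAddCommGroup G] [NormedSpace ℝ G] [NormedSpace ℂ G]
  [SMulCommClass ℝ ℂ G]

theorem hasFDerivAt_avg (hκ : Integrable κ μ)
    (hp : AEStronglyMeasurable p μ) (hR : ∀ᵐ w ∂μ, ‖p w‖ ≤ R) {F : E → G} (hF : ContDiff ℝ 1 F)
    (z : E) : HasFDerivAt (avg μ κ p F) (avg μ κ p (fderiv ℝ F) z) z := by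
  have : ProperSpace E := FiniteDimensional.proper ℝ E
  have hF' := hF.continuous_fderiv (by simp)
  obtain ⟨C, hC⟩ := (isCompact_closedBall (0 : E) (‖z‖ + 1 + R)).exists_bound_of_continuousOn
    hF'.continuousOn
  refine hasFDerivAt_integral_of_dominated_of_fderiv_le (bound := fun w => ‖κ w‖ * C)
    (F' := fun x w => κ w • fderiv ℝ F (x + p w))
    (Metric.ball_mem_nhds z one_pos)
    (Eventually.of_forall fun x => (integrable_avg hκ hp hR hF.continuous x).aestronglyMeasurable)
    (integrable_avg hκ hp hR hF.continuous z)
    (integrable_avg hκ hp hR hF' z).aestronglyMeasurable ?_ (hκ.norm.mul_const C) ?_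
  · filter_upwards [hR] with w hw x hx
    rw [norm_smul]
    refine mul_le_mul_of_nonneg_left (hC _ ?_) (norm_nonneg _)
    rw [mem_closedBall_zero_iff]
    have h1 : ‖x‖ ≤ ‖z‖ + 1 := by
      have h2 := norm_add_le z (x - z)
      rw [add_sub_cancel] at h2
      have h3 : ‖x - z‖ < 1 := by rwa [← dist_eq_norm]
      linarith
    exact (norm_add_le _ _).trans (add_le_add h1 hw)
  · refine Eventually.of_forall fun w x _ => ?_
    have h1 : HasFDerivAt (fun x => F (x + p w)) (fderiv ℝ F (x + p w)) x :=
      (hasFDerivAt_comp_add_right (p w)).2 (hF.differentiable (by simp) (x + p w)).hasFDerivAt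
    exact h1.const_smul (κ w)

/-- One derivative is given away to keep the induction short; this costs nothing for smooth `F`. The
target space varies because the induction passes to `fderiv ℝ F`. -/
theorem contDiff_avg_nat (hκ : Integrable κ μ)
    (hp : AEStronglyMeasurable p μ) (hR : ∀ᵐ w ∂μ, ‖p w‖ ≤ R) (m : ℕ) :
    ∀ {G : Type} [NormedAddCommGroup G] [NormedSpace ℝ G] [NormedSpace ℂ G] [SMulCommClass ℝ ℂ G]
    {F : E → G}, ContDiff ℝ (m + 1) F → ContDiff ℝ m (avg μ κ p F) := by
  induction m with
  | zero =>
    intro G _ _ _ _ F hF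
    have hF : ContDiff ℝ 1 F := by simpa using hF
    have h : Differentiable ℝ (avg μ κ p F) := fun z =>
      (hasFDerivAt_avg hκ hp hR hF z).differentiableAt
    simpa using (contDiff_zero (𝕜 := ℝ)).2 h.continuous
  | succ m ih =>
    intro G _ _ _ _ F hF
    have h1 : ContDiff ℝ 1 F := hF.of_le (by exact_mod_cast Nat.le_add_left 1 (m + 1))
    have hd : ∀ z, HasFDerivAt (avg μ κ p F) (avg μ κ p (fderiv ℝ F) z) z :=
      fun z => hasFDerivAt_avg hκ hp hR h1 z
    push_cast at hF ⊢
    rw [contDiff_succ_iff_fderiv]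
    refine ⟨fun z => (hd z).differentiableAt, by simp, ?_⟩
    rw [funext fun z => (hd z).fderiv]
    exact ih (hF.fderiv_right le_rfl)

theorem contDiff_avg (hκ : Integrable κ μ)
    (hp : AEStronglyMeasurable p μ) (hR : ∀ᵐ w ∂μ, ‖p w‖ ≤ R) {F : E → G} (hF : ContDiff ℝ ∞ F) :
    ContDiff ℝ ∞ (avg μ κ p F) :=
  contDiff_infty.2 fun m => contDiff_avg_nat hκ hp hR m (hF.of_le (by exact_mod_cast le_top))

theorem norm_iteratedFDeriv_avg_le (hκ : Integrable κ μ)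
    (hp : AEStronglyMeasurable p μ) (hR : ∀ᵐ w ∂μ, ‖p w‖ ≤ R) (j : ℕ) :
    ∀ {G : Type} [NormedAddCommGroup G] [NormedSpace ℝ G] [NormedSpace ℂ G] [SMulCommClass ℝ ℂ G]
    {F : E → G} {z : E} {C : ℝ}, ContDiff ℝ ∞ F →
    (∀ᵐ w ∂μ, ‖iteratedFDeriv ℝ j F (z + p w)‖ ≤ C) →
    ‖iteratedFDeriv ℝ j (avg μ κ p F) z‖ ≤ (∫ w, ‖κ w‖ ∂μ) * C := by
  induction j with
  | zero =>
    intro G _ _ _ _ F z C hF hC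
    simp only [norm_iteratedFDeriv_zero] at hC ⊢
    rw [← integral_mul_const]
    refine norm_integral_le_of_norm_le (hκ.norm.mul_const C) ?_
    filter_upwards [hC] with w hw
    rw [norm_smul]
    exact mul_le_mul_of_nonneg_left hw (norm_nonneg _)
  | succ j ih =>
    intro G _ _ _ _ F z C hF hC
    have hd : ∀ z, HasFDerivAt (avg μ κ p F) (avg μ κ p (fderiv ℝ F) z) z :=
      fun z => hasFDerivAt_avg hκ hp hR (hF.of_le (by exact_mod_cast le_top)) z
    simp only [← norm_iteratedFDeriv_fderiv] at hC ⊢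
    rw [funext fun z => (hd z).fderiv]
    exact ih (hF.fderiv_right (by simp)) hC

end Average

/-! ### The Dolbeault lemma for smooth forms -/

/-- The polydisc of polyradius `r`. -/
def polyball (n : ℕ) (r : ℝ) : Set (Fin n → ℂ) := {z | ∀ i, ‖z i‖ < r}

theorem isOpen_polyball (n : ℕ) (r : ℝ) : IsOpen (polyball n r) := by
  have : polyball n r = ⋂ i, {z : Fin n → ℂ | ‖z i‖ < r} := by
    ext z; simp [polyball]
  rw [this]
  exact isOpen_iInter_of_finite fun i =>
    isOpen_lt (continuous_apply i).norm continuous_const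

theorem polyball_mono {r s : ℝ} (h : r ≤ s) : polyball n r ⊆ polyball n s :=
  fun _ hz i => (hz i).trans_le h

theorem dbar_add {u v : (Fin n → ℂ) → ℂ} {z : Fin n → ℂ} (hu : DifferentiableAt ℝ u z)
    (hv : DifferentiableAt ℝ v z) (i : Fin n) :
    dbar i (fun z => u z + v z) z = dbar i u z + dbar i v z := by
  simp only [dbar, fderiv_fun_add hu hv, add_apply]
  ring

theorem dbar_sub {u v : (Fin n → ℂ) → ℂ} {z : Fin n → ℂ} (hu : DifferentiableAt ℝ u z)
    (hv : DifferentiableAt ℝ v z) (i : Fin n) :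
    dbar i (fun z => u z - v z) z = dbar i u z - dbar i v z := by
  simp only [dbar, fderiv_fun_sub hu hv, sub_apply]
  ring

theorem dbar_mul {u v : (Fin n → ℂ) → ℂ} {z : Fin n → ℂ} (hu : DifferentiableAt ℝ u z)
    (hv : DifferentiableAt ℝ v z) (i : Fin n) :
    dbar i (fun z => u z * v z) z = u z * dbar i v z + dbar i u z * v z := by
  simp only [dbar, fderiv_fun_mul hu hv, add_apply, smul_apply, smul_eq_mul]
  ring

theorem dbar_congr {u v : (Fin n → ℂ) → ℂ} {z : Fin n → ℂ} (h : u =ᶠ[𝓝 z] v) (i : Fin n) :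
    dbar i u z = dbar i v z := by
  simp only [dbar, h.fderiv_eq]

theorem dbar_const (c : ℂ) (i : Fin n) (z : Fin n → ℂ) : dbar i (fun _ => c) z = 0 := by
  simp [dbar]

theorem contDiff_dbar {u : (Fin n → ℂ) → ℂ} (hu : ContDiff ℝ ∞ u) (i : Fin n) :
    ContDiff ℝ ∞ (dbar i u) := by
  have h : ContDiff ℝ ∞ (fderiv ℝ u) := hu.fderiv_right (by simp)
  have h1 : ∀ e : Fin n → ℂ, ContDiff ℝ ∞ fun z => fderiv ℝ u z e := fun e =>
    h.clm_apply contDiff_const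
  unfold dbar
  exact ((h1 _).add (contDiff_const.mul (h1 _))).div_const _

theorem dbar_comm {u : (Fin n → ℂ) → ℂ} (hu : ContDiff ℝ ∞ u) (i j : Fin n) (z : Fin n → ℂ) :
    dbar i (dbar j u) z = dbar j (dbar i u) z := by
  have hd : DifferentiableAt ℝ (fderiv ℝ u) z :=
    (hu.fderiv_right (m := ∞) (by simp)).differentiable (by simp) z
  have h1 : ∀ e v : Fin n → ℂ, fderiv ℝ (fun z => fderiv ℝ u z e) z v =
      fderiv ℝ (fderiv ℝ u) z v e := by
    intro e v
    have := (hd.hasFDerivAt.clm_apply (hasFDerivAt_const e z)).fderiv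
    rw [this]; simp
  have hde : ∀ e : Fin n → ℂ, DifferentiableAt ℝ (fun z => fderiv ℝ u z e) z := fun e =>
    hd.clm_apply (differentiableAt_const e)
  have h2 : ∀ (k : Fin n) (v : Fin n → ℂ), fderiv ℝ (dbar k u) z v =
      (fderiv ℝ (fderiv ℝ u) z v (Pi.single k 1) +
        I * fderiv ℝ (fderiv ℝ u) z v (Pi.single k I)) / 2 := by
    intro k v
    have : HasFDerivAt (dbar k u) ((2 : ℂ)⁻¹ • (fderiv ℝ (fun z => fderiv ℝ u z (Pi.single k 1)) z +
        I • fderiv ℝ (fun z => fderiv ℝ u z (Pi.single k I)) z)) z := by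
      have h3 := ((hde (Pi.single k 1)).hasFDerivAt.add
        ((hde (Pi.single k I)).hasFDerivAt.const_mul I)).const_mul (2 : ℂ)⁻¹
      refine h3.congr_of_eventuallyEq (Eventually.of_forall fun y => ?_)
      simp only [dbar, Pi.add_apply]
      ring
    rw [this.fderiv]
    simp only [smul_apply, add_apply, smul_eq_mul, h1]
    ring
  have hsymm : IsSymmSndFDerivAt ℝ u z := by
    refine (hu.contDiffAt (x := z)).isSymmSndFDerivAt ?_
    rw [minSmoothness_of_isRCLikeNormedField]
    exact WithTop.coe_le_coe.2 le_top
  unfold dbar at h2 ⊢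
  simp only [h2]
  rw [hsymm (Pi.single i 1) (Pi.single j 1), hsymm (Pi.single i 1) (Pi.single j I),
    hsymm (Pi.single i I) (Pi.single j 1), hsymm (Pi.single i I) (Pi.single j I)]
  ring

theorem dbar_avg {Ω : Type*} [MeasurableSpace Ω] {μ : Measure Ω} {κ : Ω → ℂ} {p : Ω → Fin n → ℂ}
    {R : ℝ} (hκ : Integrable κ μ) (hp : AEStronglyMeasurable p μ) (hR : ∀ᵐ w ∂μ, ‖p w‖ ≤ R)
    {F : (Fin n → ℂ) → ℂ} (hF : ContDiff ℝ 1 F) (z : Fin n → ℂ) (i : Fin n) :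
    dbar i (avg μ κ p F) z = ∫ w, κ w * dbar i F (z + p w) ∂μ := by
  have hint := integrable_avg hκ hp hR (hF.continuous_fderiv (by simp)) z
  have happ : ∀ e, avg μ κ p (fderiv ℝ F) z e = ∫ w, κ w * fderiv ℝ F (z + p w) e ∂μ := by
    intro e
    unfold avg
    rw [ContinuousLinearMap.integral_apply hint]
    simp
  have hinte : ∀ e, Integrable (fun w => κ w * fderiv ℝ F (z + p w) e) μ := by
    intro e
    have := hint.apply_continuousLinearMap e
    simpa using this
  rw [dbar, (hasFDerivAt_avg hκ hp hR hF z).fderiv, happ, happ, ← integral_const_mul,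
    ← integral_add (hinte _) ((hinte _).const_mul I), ← integral_div]
  congr 1; funext w
  simp only [dbar]
  ring

theorem norm_single_le (i : Fin n) (w : ℂ) : ‖(Pi.single i w : Fin n → ℂ)‖ ≤ ‖w‖ := by
  rw [pi_norm_le_iff_of_nonneg (norm_nonneg _)]
  intro j
  rcases eq_or_ne j i with rfl | hj
  · simp
  · simp [hj]

theorem add_single_eq_update (z : Fin n → ℂ) (i : Fin n) (w : ℂ) :
    z + Pi.single i w = Function.update z i (z i + w) := by
  ext j
  rcases eq_or_ne j i with rfl | hj
  · simp
  · simp [hj]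

/-- Solving the Cauchy-Riemann equation in one of several variables. -/
theorem exists_dbar_eq_one_variable {g : (Fin n → ℂ) → ℂ} (hg : ContDiff ℝ ∞ g) (i : Fin n)
    {r' r : ℝ} (h0 : 0 < r') (hr : r' < r) :
    ∃ v : (Fin n → ℂ) → ℂ, ContDiff ℝ ∞ v ∧ (∀ z ∈ polyball n r', dbar i v z = g z) ∧
      ∀ j ≠ i, (∀ z ∈ polyball n r, dbar j g z = 0) → ∀ z ∈ polyball n r', dbar j v z = 0 := by
  let θ : ContDiffBump (0 : ℂ) := ⟨r', r, h0, hr⟩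
  have hθ : ContDiff ℝ ∞ fun z : Fin n → ℂ => ((θ (z i) : ℝ) : ℂ) :=
    ofRealCLM.contDiff.comp (θ.contDiff.comp (contDiff_apply ℝ ℂ i))
  set F : (Fin n → ℂ) → ℂ := fun z => ((θ (z i) : ℝ) : ℂ) * g z with hFdef
  have hF : ContDiff ℝ ∞ F := hθ.mul hg
  have hF1 : ContDiff ℝ 1 F := hF.of_le (by exact_mod_cast le_top)
  -- For `|z i| < r` and `ζ` in the support `|ζ| ≤ r` of the cut-off slice, the translation `ζ - z
  -- i` has modulus below `2 r`, so restricting the Cauchy kernel loses nothing.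
  set μ := (volume : Measure ℂ).restrict (Metric.ball 0 (2 * r)) with hμ
  set κ : ℂ → ℂ := fun w => (Real.pi * -w)⁻¹ with hκdef
  have hκ : Integrable κ μ := by
    refine ((integrableOn_inv_norm (2 * r)).const_mul Real.pi⁻¹).mono' ?_
      (Eventually.of_forall fun w => ?_)
    · exact (by fun_prop : Measurable κ).aestronglyMeasurable
    · simp [κ, abs_of_pos Real.pi_pos, mul_comm]
  have hp : AEStronglyMeasurable (fun w : ℂ => (Pi.single i w : Fin n → ℂ)) μ := by
    refine Continuous.aestronglyMeasurable ?_
    exact continuous_pi fun j => by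
      rcases eq_or_ne j i with rfl | hj
      · simpa using! continuous_id
      · simpa [hj] using continuous_const
  have hR : ∀ᵐ w ∂μ, ‖(Pi.single i w : Fin n → ℂ)‖ ≤ 2 * r := by
    filter_upwards [ae_restrict_mem measurableSet_ball] with w hw
    exact (norm_single_le i w).trans (mem_ball_zero_iff.1 hw).le
  have hθ0 : ∀ w : ℂ, r ≤ ‖w‖ → θ w = 0 := fun w hw => θ.zero_of_le_dist (by simpa using hw)
  refine ⟨avg μ κ (fun w => Pi.single i w) F,
    contDiff_avg hκ hp hR hF, fun z hz => ?_, fun j hj hgj z hz => ?_⟩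
  · rw [dbar_avg hκ hp hR hF1]
    have hf1 : ContDiff ℝ 1 fun w => F (Function.update z i w) := hF1.comp (contDiff_update z i 1)
    have hfc : HasCompactSupport fun w => F (Function.update z i w) := by
      refine HasCompactSupport.of_support_subset_isCompact (isCompact_closedBall (0 : ℂ) r)
        fun w hw => ?_
      rw [mem_closedBall_zero_iff]
      by_contra h
      exact hw (by simp [hFdef, hθ0 w (not_le.1 h).le])
    have hcp := cauchyPompeiu hf1 hfc (z i)
    rw [Function.update_eq_self] at hcp
    have h1 : F z = g z := by
      have : θ (z i) = 1 := θ.one_of_mem_closedBall (by simpa using (hz i).le)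
      simp [hFdef, this]
    rw [← h1, ← hcp, ← integral_add_left_eq_self (fun ζ => (Real.pi * (z i - ζ))⁻¹ *
      dbarC (fun w => F (Function.update z i w)) ζ) (z i), hμ]
    have e : ∀ w, κ w * dbar i F (z + Pi.single i w) = (Real.pi * (z i - (z i + w)))⁻¹ *
        dbarC (fun w => F (Function.update z i w)) (z i + w) := by
      intro w
      rw [dbarC_update (hF1.differentiable (by simp) _), add_single_eq_update, sub_add_cancel_left]
    simp_rw [e]
    refine setIntegral_eq_integral_of_forall_compl_eq_zero fun w hw => ?_
    have h2 : dbarC (fun w => F (Function.update z i w)) (z i + w) = 0 := by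
      refine image_eq_zero_of_notMem_tsupport fun hmem => hw ?_
      have h3 := tsupport_dbarC_subset _ hmem
      have h4 : tsupport (fun w => F (Function.update z i w)) ⊆ Metric.closedBall 0 r := by
        refine closure_minimal (fun w hw => ?_) Metric.isClosed_closedBall
        rw [mem_closedBall_zero_iff]
        by_contra h
        exact hw (by simp [hFdef, hθ0 w (not_le.1 h).le])
      have h5 := h4 h3
      rw [mem_closedBall_zero_iff] at h5
      rw [mem_ball_zero_iff]
      have h6 := norm_sub_le (z i + w) (z i)
      rw [add_sub_cancel_left] at h6
      have := hz i
      linarith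
    rw [h2, mul_zero]
  · rw [dbar_avg hκ hp hR hF1]
    refine integral_eq_zero_of_ae (Eventually.of_forall fun w => ?_)
    have hθj : dbar j (fun z : Fin n → ℂ => ((θ (z i) : ℝ) : ℂ)) (z + Pi.single i w) = 0 := by
      set y := z + Pi.single i w
      have hy : y = Function.update y j (y j) := by simp
      rw [hy, ← dbarC_update (hθ.differentiable (by simp) _)]
      have : (fun w => ((θ (Function.update y j w i) : ℝ) : ℂ)) = fun _ => ((θ (y i) : ℝ) : ℂ) := by
        funext w; rw [Function.update_of_ne hj.symm]
      rw [this]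
      exact (HasWirtingerAt.const _ _).dbarC_eq
    simp only [Pi.zero_apply, hFdef]
    rw [dbar_mul (hθ.differentiable (by simp) _) (hg.differentiable (by simp) _), hθj, zero_mul,
      add_zero]
    rcases le_or_gt r ‖(z + Pi.single i w : Fin n → ℂ) i‖ with h | h
    · rw [hθ0 _ h]; simp
    · rw [hgj, mul_zero, mul_zero]
      intro l
      rcases eq_or_ne l i with rfl | hl
      · exact h
      · simpa [hl] using (hz l).trans hr

/-- The Dolbeault lemma: smooth closed forms of type `(0,1)` on a polydisc are exact on smaller
polydiscs. -/
theorem exists_dbar_eq {g : Fin n → (Fin n → ℂ) → ℂ} (hg : ∀ i, ContDiff ℝ ∞ (g i)) {r' r : ℝ}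
    (h0 : 0 < r') (hr : r' < r)
    (hc : ∀ i j, ∀ z ∈ polyball n r, dbar i (g j) z = dbar j (g i) z) :
    ∃ u : (Fin n → ℂ) → ℂ, ContDiff ℝ ∞ u ∧ ∀ j, ∀ z ∈ polyball n r', dbar j u z = g j z := by
  -- Induction on the number `m` of leading coefficients that may be nonzero; the outer radius
  -- varies since each step shrinks it.
  suffices H : ∀ m : ℕ, ∀ (g : Fin n → (Fin n → ℂ) → ℂ) (r : ℝ), (∀ i, ContDiff ℝ ∞ (g i)) →
      r' < r → (∀ i j, ∀ z ∈ polyball n r, dbar i (g j) z = dbar j (g i) z) →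
      (∀ j : Fin n, m ≤ j → ∀ z ∈ polyball n r, g j z = 0) →
      ∃ u : (Fin n → ℂ) → ℂ, ContDiff ℝ ∞ u ∧ ∀ j, ∀ z ∈ polyball n r', dbar j u z = g j z from
    H n g r hg hr hc fun j hj => absurd j.2 (not_lt.2 hj)
  intro m
  induction m with
  | zero =>
    intro g r _ hr _ hz
    exact ⟨fun _ => 0, contDiff_const, fun j z hzj => by
      rw [dbar_const, hz j (Nat.zero_le _) z (polyball_mono hr.le hzj)]⟩
  | succ m ih =>
    intro g r hg hr hc hz
    by_cases hm : m < n
    swap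
    · exact ih g r hg hr hc fun j hj => absurd (hj.trans_lt j.2) hm
    obtain ⟨s, hs1, hs2⟩ := exists_between hr
    obtain ⟨v, hv, hv1, hv2⟩ := exists_dbar_eq_one_variable (hg ⟨m, hm⟩) ⟨m, hm⟩ (h0.trans hs1) hs2
    have hdv : ∀ j, ContDiff ℝ ∞ (dbar j v) := contDiff_dbar hv
    have hdiff : ∀ {f : (Fin n → ℂ) → ℂ}, ContDiff ℝ ∞ f → ∀ z, DifferentiableAt ℝ f z :=
      fun hf z => hf.differentiable (by simp) z
    -- Subtracting `∂̄v` removes the coefficient `m`. Those beyond remain zero, because closedness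
    -- gives `∂̄ⱼ g_m = ∂̄_m gⱼ = 0` there and `v` inherits this.
    obtain ⟨u, hu, hu'⟩ := ih (fun j z => g j z - dbar j v z) s (fun j => (hg j).sub (hdv j)) hs1
      (fun i j z hzs => by
        rw [dbar_sub (hdiff (hg j) z) (hdiff (hdv j) z), dbar_sub (hdiff (hg i) z)
          (hdiff (hdv i) z), hc i j z (polyball_mono hs2.le hzs), dbar_comm hv])
      (fun j hj z hzs => by
        rcases hj.eq_or_lt with h | h
        · have : j = ⟨m, hm⟩ := Fin.ext h.symm
          subst this
          rw [hv1 z hzs, sub_self]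
        · rw [hz j h z (polyball_mono hs2.le hzs), zero_sub, neg_eq_zero]
          refine hv2 j (fun e => ?_) (fun y hy => ?_) z hzs
          · rw [e] at h; exact lt_irrefl _ h
          · rw [hc j ⟨m, hm⟩ y hy]
            have : g j =ᶠ[𝓝 y] fun _ => 0 := by
              filter_upwards [(isOpen_polyball n r).mem_nhds hy] with x hx
              exact hz j h x hx
            rw [dbar_congr this, dbar_const])
    refine ⟨fun z => u z + v z, hu.add hv, fun j z hzj => ?_⟩
    rw [dbar_add (hdiff hu z) (hdiff hv z), hu' j z hzj]
    ring

end DbarPolydisc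

end

noncomputable section

namespace DbarPolydisc

open Complex Filter Topology

variable {n : ℕ}

/-! ### Mollification with dilation -/

section Moll

variable {G : Type} [NormedAddCommGroup G] [NormedSpace ℝ G] [NormedSpace ℂ G]

/-- The mollification `z ↦ ∫ f(a z + τ w) Φ(w) dw`. -/
def moll (f : (Fin n → ℂ) → ℂ) (a τ : ℝ) (Φ : (Fin n → ℂ) → G) (z : Fin n → ℂ) : G :=
  ∫ w, f (a • z + τ • w) • Φ w

variable {f : (Fin n → ℂ) → ℂ} {R a τ : ℝ} {Φ : (Fin n → ℂ) → G}

/-- The substitution `y = a z + τ w` moves the dependence on `z` from the rough `f` to the smooth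
`Φ`. -/
theorem moll_eq_avg (hfR : ∀ y, R < ‖y‖ → f y = 0) (ha : a ≠ 0) (hτ : τ ≠ 0) :
    moll f a τ Φ = fun z => |(τ ^ Module.finrank ℝ (Fin n → ℂ))⁻¹| •
      avg (volume.restrict (Metric.closedBall (0 : Fin n → ℂ) R)) f (fun y => -a⁻¹ • y)
        (fun x => Φ ((-(a / τ)) • x)) z := by
  funext z
  have h1 : ∀ w, f (a • z + τ • w) • Φ w =
      (fun y => f (a • z + y) • Φ (τ⁻¹ • y)) (τ • w) := by
    intro w
    simp only [smul_smul, inv_mul_cancel₀ hτ, one_smul]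
  rw [moll, integral_congr_ae (Eventually.of_forall h1), avg,
    Measure.integral_comp_smul volume (fun y => f (a • z + y) • Φ (τ⁻¹ • y)) τ]
  congr 1
  have h2 : ∀ y, f (a • z + y) • Φ (τ⁻¹ • y) =
      (fun y => f y • Φ ((-(a / τ)) • (z + -a⁻¹ • y))) (a • z + y) := by
    intro y
    have : (-(a / τ)) • (z + -a⁻¹ • (a • z + y)) = τ⁻¹ • y := by
      simp only [smul_add, smul_smul]
      rw [← add_assoc, ← add_smul]
      have e1 : -(a / τ) + -(a / τ) * (-a⁻¹ * a) = 0 := by field_simp; ring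
      have e2 : -(a / τ) * -a⁻¹ = τ⁻¹ := by field_simp
      rw [e1, e2, zero_smul, zero_add]
    simp only [this]
  rw [integral_congr_ae (Eventually.of_forall h2),
    integral_add_left_eq_self (fun y => f y • Φ ((-(a / τ)) • (z + -a⁻¹ • y)))]
  refine (setIntegral_eq_integral_of_forall_compl_eq_zero fun y hy => ?_).symm
  rw [hfR y (by simpa using hy), zero_smul]

variable [SMulCommClass ℝ ℂ G]

/-- After the substitution `Φ` is evaluated at `(y - a z) / τ`, which explains the factor `-(a / τ)`
carried by each derivative. -/
theorem hasFDerivAt_moll (hf : Integrable f) (hfR : ∀ y, R < ‖y‖ → f y = 0) (ha : a ≠ 0)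
    (hτ : τ ≠ 0) (hΦ : ContDiff ℝ 1 Φ) (z : Fin n → ℂ) :
    HasFDerivAt (moll f a τ Φ) ((-(a / τ)) • moll f a τ (fderiv ℝ Φ) z) z := by
  have hF : ContDiff ℝ 1 fun x : Fin n → ℂ => Φ ((-(a / τ)) • x) :=
    hΦ.comp (contDiff_const_smul _)
  have hp : AEStronglyMeasurable (fun y : Fin n → ℂ => -a⁻¹ • y)
      (volume.restrict (Metric.closedBall (0 : Fin n → ℂ) R)) :=
    (continuous_const_smul (-a⁻¹)).aestronglyMeasurable
  have hpR : ∀ᵐ y ∂(volume.restrict (Metric.closedBall (0 : Fin n → ℂ) R)),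
      ‖-a⁻¹ • y‖ ≤ ‖-a⁻¹‖ * R := by
    filter_upwards [ae_restrict_mem measurableSet_closedBall] with y hy
    rw [norm_smul]
    exact mul_le_mul_of_nonneg_left (mem_closedBall_zero_iff.1 hy) (norm_nonneg _)
  have hd : ∀ x, fderiv ℝ (fun x : Fin n → ℂ => Φ ((-(a / τ)) • x)) x =
      (-(a / τ)) • fderiv ℝ Φ ((-(a / τ)) • x) := fun x => fderiv_comp_smul _
  have h := (hasFDerivAt_avg hf.restrict hp hpR hF z).const_smul
    |(τ ^ Module.finrank ℝ (Fin n → ℂ))⁻¹|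
  rw [moll_eq_avg hfR ha hτ, moll_eq_avg hfR ha hτ]
  refine h.congr_fderiv ?_
  rw [smul_comm]
  congr 1
  unfold avg
  simp only [hd]
  rw [← integral_smul]
  congr 1; funext y
  rw [smul_comm]

end Moll

theorem integrable_moll {G : Type} [NormedAddCommGroup G] [NormedSpace ℂ G]
    {f : (Fin n → ℂ) → ℂ} {a τ : ℝ} {Φ : (Fin n → ℂ) → G} (hf : Integrable f) (hτ : τ ≠ 0)
    (hΦ : Continuous Φ) (hc : HasCompactSupport Φ) (z : Fin n → ℂ) :
    Integrable fun w => f (a • z + τ • w) • Φ w := by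
  obtain ⟨C, hC⟩ := hc.exists_bound_of_continuous hΦ
  have h1 : Integrable fun w => f (a • z + τ • w) :=
    (hf.comp_add_left (a • z)).comp_smul hτ
  exact h1.smul_bdd C hΦ.aestronglyMeasurable (Eventually.of_forall hC)

theorem contDiff_moll_nat {f : (Fin n → ℂ) → ℂ} {R a τ : ℝ} (hf : Integrable f)
    (hfR : ∀ y, R < ‖y‖ → f y = 0) (ha : a ≠ 0) (hτ : τ ≠ 0) (m : ℕ) :
    ∀ {G : Type} [NormedAddCommGroup G] [NormedSpace ℝ G] [NormedSpace ℂ G] [SMulCommClass ℝ ℂ G]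
    {Φ : (Fin n → ℂ) → G}, ContDiff ℝ ∞ Φ → ContDiff ℝ m (moll f a τ Φ) := by
  induction m with
  | zero =>
    intro G _ _ _ _ Φ hΦ
    have h : Differentiable ℝ (moll f a τ Φ) := fun z =>
      (hasFDerivAt_moll hf hfR ha hτ (hΦ.of_le (by exact_mod_cast le_top)) z).differentiableAt
    simpa using (contDiff_zero (𝕜 := ℝ)).2 h.continuous
  | succ m ih =>
    intro G _ _ _ _ Φ hΦ
    have hd : ∀ z, HasFDerivAt (moll f a τ Φ) ((-(a / τ)) • moll f a τ (fderiv ℝ Φ) z) z :=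
      fun z => hasFDerivAt_moll hf hfR ha hτ (hΦ.of_le (by exact_mod_cast le_top)) z
    push_cast
    rw [contDiff_succ_iff_fderiv]
    refine ⟨fun z => (hd z).differentiableAt, by simp, ?_⟩
    rw [funext fun z => (hd z).fderiv]
    exact (ih (hΦ.fderiv_right (by simp))).const_smul _

theorem contDiff_moll {f : (Fin n → ℂ) → ℂ} {R a τ : ℝ} (hf : Integrable f)
    (hfR : ∀ y, R < ‖y‖ → f y = 0) (ha : a ≠ 0) (hτ : τ ≠ 0) {Φ : (Fin n → ℂ) → ℂ}
    (hΦ : ContDiff ℝ ∞ Φ) : ContDiff ℝ ∞ (moll f a τ Φ) :=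
  contDiff_infty.2 fun m => contDiff_moll_nat hf hfR ha hτ m hΦ

/-- The derivatives of a linear combination of mollifications. -/
theorem norm_iteratedFDeriv_sum_moll_le {f : (Fin n → ℂ) → ℂ} {R : ℝ} (hf : Integrable f)
    (hfR : ∀ y, R < ‖y‖ → f y = 0) {ι : Type*} (s : Finset ι) {a τ : ι → ℝ}
    (ha : ∀ c ∈ s, a c ≠ 0) (hτ : ∀ c ∈ s, τ c ≠ 0) (j : ℕ) :
    ∀ {G : Type} [NormedAddCommGroup G] [NormedSpace ℝ G] [NormedSpace ℂ G] [SMulCommClass ℝ ℂ G]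
    [IsScalarTower ℝ ℂ G]
    {Φ : (Fin n → ℂ) → G} (lam : ι → ℝ) (z : Fin n → ℂ), ContDiff ℝ ∞ Φ → HasCompactSupport Φ →
    ‖iteratedFDeriv ℝ j (fun z => ∑ c ∈ s, lam c • moll f (a c) (τ c) Φ z) z‖ ≤
      ∫ w, ‖∑ c ∈ s, (lam c * (-(a c / τ c)) ^ j) • f (a c • z + τ c • w)‖ *
        ‖iteratedFDeriv ℝ j Φ w‖ := by
  induction j with
  | zero =>
    intro G _ _ _ _ _ Φ lam z hΦ hc
    simp only [norm_iteratedFDeriv_zero, pow_zero, mul_one]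
    -- The sum over `c` stays inside one integral and one norm, so that cancellation between the
    -- dilations is preserved.
    have h1 : ∑ c ∈ s, lam c • moll f (a c) (τ c) Φ z =
        ∫ w, (∑ c ∈ s, lam c • f (a c • z + τ c • w)) • Φ w := by
      simp only [moll, Finset.sum_smul, ← integral_smul, smul_assoc]
      rw [integral_finsetSum]
      intro c hcs
      exact (integrable_moll hf (hτ c hcs) hΦ.continuous hc z).smul (lam c)
    rw [h1]
    refine (norm_integral_le_integral_norm _).trans_eq ?_
    simp only [norm_smul]
  | succ j ih =>
    intro G _ _ _ _ _ Φ lam z hΦ hc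
    have hd : ∀ z, HasFDerivAt (fun z => ∑ c ∈ s, lam c • moll f (a c) (τ c) Φ z)
        (∑ c ∈ s, (lam c * (-(a c / τ c))) • moll f (a c) (τ c) (fderiv ℝ Φ) z) z := by
      intro z
      refine HasFDerivAt.fun_sum fun c hcs => ?_
      rw [mul_smul]
      exact (hasFDerivAt_moll hf hfR (ha c hcs) (hτ c hcs)
        (hΦ.of_le (by exact_mod_cast le_top)) z).const_smul (lam c)
    simp only [← norm_iteratedFDeriv_fderiv]
    rw [funext fun z => (hd z).fderiv]
    refine (ih (fun c => lam c * (-(a c / τ c))) z (hΦ.fderiv_right (by simp))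
      (hc.fderiv ℝ)).trans_eq ?_
    simp only [pow_succ', mul_assoc]

end DbarPolydisc

end

noncomputable section

namespace DbarPolydisc

open Complex Filter Topology

variable {n : ℕ}

/-! ### Interior regularity -/

/-- A smooth cutoff function on the disc, equal to `1` near the origin. -/
def cutoff (w : ℂ) : ℂ :=
  (((⟨1 / 4, 1 / 2, by norm_num, by norm_num⟩ : ContDiffBump (0 : ℂ)) w : ℝ) : ℂ)

/-- The truncated Cauchy kernel. -/
def nearKer (w : ℂ) : ℂ := (Real.pi * (0 - w))⁻¹ * cutoff w

/-- The smooth remainder created by the truncation of the Cauchy kernel. -/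
def farKer (w : ℂ) : ℂ := (Real.pi * (0 - w))⁻¹ * dbarC cutoff w

theorem contDiff_cutoff : ContDiff ℝ ∞ cutoff :=
  ofRealCLM.contDiff.comp (ContDiffBump.contDiff _)

theorem cutoff_eq_zero {w : ℂ} (hw : 1 / 2 ≤ ‖w‖) : cutoff w = 0 := by
  unfold cutoff
  rw [ContDiffBump.zero_of_le_dist _ (by simpa using hw), ofReal_zero]

theorem cutoff_eq_one {w : ℂ} (hw : ‖w‖ < 1 / 4) : cutoff w = 1 := by
  unfold cutoff
  rw [ContDiffBump.one_of_mem_closedBall _ (by simpa using hw.le), ofReal_one]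

theorem norm_cutoff_le (w : ℂ) : ‖cutoff w‖ ≤ 1 := by
  unfold cutoff
  rw [norm_real, Real.norm_of_nonneg (ContDiffBump.nonneg _)]
  exact ContDiffBump.le_one _

theorem tsupport_cutoff_subset : tsupport cutoff ⊆ Metric.closedBall 0 (1 / 2) := by
  refine closure_minimal (fun w hw => ?_) Metric.isClosed_closedBall
  rw [mem_closedBall_zero_iff]
  by_contra h
  exact hw (cutoff_eq_zero (not_le.1 h).le)

theorem contDiff_dbarC {f : ℂ → ℂ} (hf : ContDiff ℝ ∞ f) : ContDiff ℝ ∞ (dbarC f) := by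
  have h : ContDiff ℝ ∞ (fderiv ℝ f) := hf.fderiv_right (by simp)
  have h1 : ∀ e : ℂ, ContDiff ℝ ∞ fun z => fderiv ℝ f z e := fun e => h.clm_apply contDiff_const
  unfold dbarC
  exact ((h1 _).add (contDiff_const.mul (h1 _))).div_const _

theorem dbarC_cutoff_eq_zero {w : ℂ} (hw : ‖w‖ < 1 / 4) : dbarC cutoff w = 0 := by
  have : cutoff =ᶠ[𝓝 w] fun _ => 1 := by
    filter_upwards [(isOpen_lt continuous_norm continuous_const).mem_nhds hw] with y hy
    exact cutoff_eq_one hy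
  exact ((HasWirtingerAt.const 1 w).congr_of_eventuallyEq this).dbarC_eq

theorem dbarC_eq_zero_of_notMem {f : ℂ → ℂ} {R : ℝ} (hf : tsupport f ⊆ Metric.closedBall 0 R)
    {w : ℂ} (hw : R < ‖w‖) : dbarC f w = 0 :=
  image_eq_zero_of_notMem_tsupport fun h => (not_le.2 hw)
    (mem_closedBall_zero_iff.1 (hf (tsupport_dbarC_subset f h)))

theorem farKer_zero : farKer 0 = 0 := by simp [farKer]

theorem nearKer_zero : nearKer 0 = 0 := by simp [nearKer]

theorem farKer_eq_zero {w : ℂ} (hw : 1 / 2 < ‖w‖) : farKer w = 0 := by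
  rw [farKer, dbarC_eq_zero_of_notMem tsupport_cutoff_subset hw, mul_zero]

theorem contDiff_farKer : ContDiff ℝ ∞ farKer := by
  rw [contDiff_iff_contDiffAt]
  intro w
  rcases eq_or_ne w 0 with rfl | hw
  · have : farKer =ᶠ[𝓝 0] fun _ => 0 := by
      filter_upwards [Metric.ball_mem_nhds (0 : ℂ) (by norm_num : (0 : ℝ) < 1 / 4)] with y hy
      rw [farKer, dbarC_cutoff_eq_zero (by simpa using hy), mul_zero]
    exact contDiffAt_const.congr_of_eventuallyEq this
  · have h1 : ContDiffAt ℝ ∞ (fun w : ℂ => ((Real.pi : ℂ) * (0 - w))⁻¹) w := by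
      refine ContDiffAt.fun_inv (f := fun w : ℂ => (Real.pi : ℂ) * (0 - w)) ?_ ?_
      · exact contDiffAt_const.mul (contDiffAt_const.sub contDiffAt_id)
      · simpa [Real.pi_ne_zero] using hw
    exact h1.mul (contDiff_dbarC contDiff_cutoff).contDiffAt

theorem integrable_farKer (z : ℂ) : Integrable farKer (discMeasure z) :=
  integrable_discMeasure (integrableOn_ball_of_continuous contDiff_farKer.continuous 1)

theorem integrable_nearKer (z : ℂ) : Integrable nearKer (discMeasure z) := by
  refine integrable_discMeasure ?_
  refine ((integrableOn_inv_norm 1).const_mul Real.pi⁻¹).mono' ?_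
    (Eventually.of_forall fun w => ?_)
  · have := contDiff_cutoff.continuous.measurable
    exact (by unfold nearKer; fun_prop : Measurable nearKer).aestronglyMeasurable
  · rw [nearKer, norm_mul]
    refine (mul_le_of_le_one_right (norm_nonneg _) (norm_cutoff_le w)).trans_eq ?_
    simp [abs_of_pos Real.pi_pos, mul_comm]

/-- The Cauchy-Pompeiu formula with a cutoff, as an identity between kernels. -/
theorem integral_discApprox_sub_farKer {v g : ℂ → ℂ} {M N : ℝ}
    (hv : ContDiffOn ℝ 1 v (Metric.ball 0 1)) (hM : ∀ w ∈ Metric.ball (0 : ℂ) 1, ‖v w‖ ≤ M)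
    (hg : ContinuousOn g (Metric.ball 0 1)) (hN : ∀ w ∈ Metric.ball (0 : ℂ) 1, ‖g w‖ ≤ N)
    (hvg : ∀ w ∈ Metric.ball (0 : ℂ) 1, dbarC v w = g w) :
    ∫ w, (discApprox 0 0 w - farKer w) * v w ∂discMeasure 0 =
      ∫ w, nearKer w * g w ∂discMeasure 0 := by
  have key : ∀ {k q : ℂ → ℂ} {C : ℝ}, Integrable k (discMeasure 0) →
      ContinuousOn q (Metric.ball 0 1) → (∀ w ∈ Metric.ball (0 : ℂ) 1, ‖q w‖ ≤ C) →
      IntegrableOn (fun w => k w * q w) (Metric.ball 0 1) := by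
    intro k q C hk hq hC
    have hk' : IntegrableOn k (Metric.ball 0 1) :=
      hk.mono_measure (by rw [discMeasure]; exact Measure.le_add_left le_rfl)
    exact Integrable.mul_bdd (c := C) hk' (hq.aestronglyMeasurable measurableSet_ball)
      ((ae_restrict_iff' measurableSet_ball).2 (Eventually.of_forall hC))
  have h0 : ‖(0 : ℂ)‖ < 1 := by simp
  have i1 := key (integrable_discApprox 0 h0).1 hv.continuousOn hM
  have i2 := key (integrable_farKer 0) hv.continuousOn hM
  have i3 := key (integrable_nearKer 0) hg hN
  have i4 : IntegrableOn (fun w => (discApprox 0 0 w - farKer w) * v w) (Metric.ball 0 1) := by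
    simp only [sub_mul]; exact i1.sub i2
  rw [integral_discMeasure i4, integral_discMeasure i3, discApprox_zero, if_pos rfl, farKer_zero,
    nearKer_zero, sub_zero, one_mul, zero_mul, zero_add]
  have e1 : ∫ w in Metric.ball 0 1, (discApprox 0 0 w - farKer w) * v w =
      -∫ w in Metric.ball 0 1, farKer w * v w := by
    rw [← integral_neg]
    refine integral_congr_ae ?_
    filter_upwards [ae_ne 0] with w hw
    rw [discApprox_zero, if_neg hw, zero_sub, neg_mul]
  rw [e1]
  -- The cutoff vanishes for `|w| ≥ 1/2`, so the product is `C¹` on the plane whatever `v` is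
  -- outside the disc.
  have hf : ContDiff ℝ 1 fun w => cutoff w * v w := by
    rw [contDiff_iff_contDiffAt]
    intro w
    rcases lt_or_ge ‖w‖ 1 with hw | hw
    · exact (contDiff_cutoff.of_le (by exact_mod_cast le_top)).contDiffAt.mul
        (hv.contDiffAt (Metric.isOpen_ball.mem_nhds (by simpa using hw)))
    · have : (fun w => cutoff w * v w) =ᶠ[𝓝 w] fun _ => 0 := by
        have h2 : (1 / 2 : ℝ) < ‖w‖ := by linarith
        filter_upwards [(isOpen_lt continuous_const continuous_norm).mem_nhds h2] with y hy
        rw [cutoff_eq_zero (le_of_lt hy), zero_mul]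
      exact contDiffAt_const.congr_of_eventuallyEq this
  have hs : tsupport (fun w => cutoff w * v w) ⊆ Metric.closedBall 0 (1 / 2) :=
    tsupport_mul_subset_left.trans tsupport_cutoff_subset
  have hcp := cauchyPompeiu hf (HasCompactSupport.of_support_subset_isCompact
    (isCompact_closedBall (0 : ℂ) (1 / 2)) ((subset_tsupport _).trans hs)) 0
  have e2 : ∫ ζ, ((Real.pi : ℂ) * (0 - ζ))⁻¹ * dbarC (fun w => cutoff w * v w) ζ =
      ∫ w in Metric.ball 0 1, (nearKer w * g w + farKer w * v w) := by
    rw [← setIntegral_ball_eq_integral]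
    · refine setIntegral_congr_fun measurableSet_ball fun w hw => ?_
      rw [dbarC_mul (contDiff_cutoff.differentiable (by simp) w)
        ((hv.contDiffAt (Metric.isOpen_ball.mem_nhds hw)).differentiableAt (by simp)), hvg w hw,
        nearKer, farKer]
      ring
    · intro w hw
      rw [dbarC_eq_zero_of_notMem hs (by linarith), mul_zero]
  rw [e2, integral_add i3 i2, cutoff_eq_one (by simp), one_mul] at hcp
  rw [← hcp]
  ring

/-! ### The interior representation formula. -/

/-- `F` solves `∂̄F = d` on the polydisc of polyradius `s`, one variable at a time. -/
structure IsSliceSolution (s : ℝ) (F : (Fin n → ℂ) → ℂ) (d : Fin n → (Fin n → ℂ) → ℂ) : Prop where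
  cont : ContinuousOn F (polyball n s)
  slice : ∀ z ∈ polyball n s, ∀ i,
    ContDiffOn ℝ 1 (fun w => F (Function.update z i w)) (Metric.ball 0 s)
  dbar : ∀ z ∈ polyball n s, ∀ i,
    dbarC (fun w => F (Function.update z i w)) (z i) = d i z

theorem update_mem_polyball {s : ℝ} {z : Fin n → ℂ} (hz : z ∈ polyball n s) (i : Fin n) {w : ℂ}
    (hw : ‖w‖ < s) : Function.update z i w ∈ polyball n s := by
  intro j
  rcases eq_or_ne j i with rfl | hj
  · simpa using hw
  · simpa [hj] using hz j

theorem add_smul_mem_polyball {ρ : ℝ} (hρ : 0 < ρ) {z w : Fin n → ℂ} (hz : z ∈ polydisc n)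
    (hw : w ∈ polydisc n) : z + ρ • w ∈ polyball n (1 + ρ) := by
  intro i
  refine (norm_add_le _ _).trans_lt (add_lt_add (hz i) ?_)
  rw [Pi.smul_apply, norm_smul, Real.norm_of_nonneg hρ.le]
  exact mul_lt_of_lt_one_right hρ (hw i)

/-- The kernel of the smooth part of the interior representation formula. -/
def farKernel (w : Fin n → ℂ) : ℂ := ∏ l, farKer (w l)

/-- The kernels of the singular part of the interior representation formula. -/
def nearKernel (i : Fin n) (w : Fin n → ℂ) : ℂ :=
  ∏ l, mixKernel (fun _ => discApprox 0 0) (fun _ => farKer) (fun _ => nearKer) i l (w l)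

theorem zero_mem_polydisc : (0 : Fin n → ℂ) ∈ polydisc n := fun i => by simp

theorem contDiff_farKernel : ContDiff ℝ ∞ (farKernel (n := n)) :=
  contDiff_prod fun l _ => contDiff_farKer.comp (contDiff_apply ℝ ℂ l)

theorem farKernel_eq_zero {w : Fin n → ℂ} (hw : w ∉ polydisc n) : farKernel w = 0 := by
  simp only [polydisc, Set.mem_ofPred_eq, not_forall, not_lt] at hw
  obtain ⟨l, hl⟩ := hw
  exact Finset.prod_eq_zero (Finset.mem_univ l) (farKer_eq_zero (by linarith))

theorem norm_le_one_of_mem_polydisc {w : Fin n → ℂ} (hw : w ∈ polydisc n) : ‖w‖ ≤ 1 :=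
  (pi_norm_le_iff_of_nonneg zero_le_one).2 fun i => (hw i).le

theorem hasCompactSupport_farKernel : HasCompactSupport (farKernel (n := n)) := by
  refine HasCompactSupport.of_support_subset_isCompact (isCompact_closedBall (0 : Fin n → ℂ) 1)
    fun w hw => ?_
  rw [mem_closedBall_zero_iff]
  by_contra h
  exact hw (farKernel_eq_zero fun h' => h (norm_le_one_of_mem_polydisc h'))

theorem integrable_nearKernel (i : Fin n) :
    Integrable (nearKernel i) (polyMeasure (0 : Fin n → ℂ)) :=
  Integrable.fintype_prod fun l => integrable_mixKernel (z := 0)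
    (fun _ => (integrable_discApprox 0 (by simp)).1) (fun _ => integrable_farKer _)
    (fun _ => integrable_nearKer _) i l

theorem ae_polyMeasure_mem {z : Fin n → ℂ} (hz : z ∈ polydisc n) :
    ∀ᵐ w ∂polyMeasure z, w ∈ polydisc n := by
  rw [← polyMeasure_restrict hz]
  exact ae_restrict_mem (measurableSet_polydisc n)

/-- The interior representation formula for solutions of `∂̄F = d`. -/
theorem IsSliceSolution.eq_integral {ρ : ℝ} (hρ : 0 < ρ) {F : (Fin n → ℂ) → ℂ}
    {d : Fin n → (Fin n → ℂ) → ℂ} (h : IsSliceSolution (1 + ρ) F d) {M N : ℝ}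
    (hF : ∀ z ∈ polyball n (1 + ρ), ‖F z‖ ≤ M) (hd : ∀ i, Continuous (d i))
    (hdN : ∀ i, ∀ z ∈ polyball n (1 + ρ), ‖d i z‖ ≤ N) {z : Fin n → ℂ} (hz : z ∈ polydisc n) :
    F z = moll F 1 ρ farKernel z +
      ρ * ∑ i, avg (polyMeasure 0) (nearKernel i) (fun w => ρ • w) (d i) z := by
  have hcont : Continuous fun w : Fin n → ℂ => z + ρ • w :=
    continuous_const.add (continuous_const_smul ρ)
  have hu : ContBddOn (fun w => F (z + ρ • w)) M :=
    ⟨h.cont.comp hcont.continuousOn fun w hw => add_smul_mem_polyball hρ hz hw,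
      fun w hw => hF _ (add_smul_mem_polyball hρ hz hw)⟩
  have hg : ∀ i, ContBddOn (fun w => (ρ : ℂ) * d i (z + ρ • w)) (ρ * N) := fun i =>
    ⟨(continuous_const.mul ((hd i).comp hcont)).continuousOn, fun w hw => by
      rw [norm_mul, norm_real, Real.norm_of_nonneg hρ.le]
      exact mul_le_mul_of_nonneg_left (hdN i _ (add_smul_mem_polyball hρ hz hw)) hρ.le⟩
  have hupd : ∀ (ζ : Fin n → ℂ) (i : Fin n) (w : ℂ), z + ρ • Function.update ζ i w =
      Function.update (z + ρ • ζ) i (z i + ρ * w) := by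
    intro ζ i w
    ext j
    rcases eq_or_ne j i with rfl | hj
    · simp
    · simp [hj]
  have hball : ∀ (i : Fin n) (w : ℂ), w ∈ Metric.ball (0 : ℂ) 1 →
      z i + ρ * w ∈ Metric.ball (0 : ℂ) (1 + ρ) := by
    intro i w hw
    rw [mem_ball_zero_iff] at hw ⊢
    refine (norm_add_le _ _).trans_lt (add_lt_add (hz i) ?_)
    rw [norm_mul, norm_real, Real.norm_of_nonneg hρ.le]
    exact mul_lt_of_lt_one_right hρ hw
  -- The telescoping is applied at the centre `0` to `w ↦ F (z + ρ w)`, whose `∂̄ᵢ` is `ρ dᵢ(z + ρ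
  -- w)`: the identity kernel is replaced, one variable at a time, by the smooth kernel `farKer`.
  have htele := integral_prod_sub_integral_prod zero_mem_polydisc
    (h := fun _ => discApprox 0 0) (h' := fun _ => farKer) (b := fun _ => nearKer)
    (fun _ => (integrable_discApprox 0 (by simp)).1) (fun _ => integrable_farKer _)
    (fun _ => integrable_nearKer _) hu hg ?_
  · have e1 := integral_discApprox_zero (0 : Fin n → ℂ) fun w => F (z + ρ • w)
    simp only [Pi.zero_apply, smul_zero, add_zero] at e1
    rw [e1, integral_polyMeasure_eq_setIntegral (0 : Fin n → ℂ)
      (k := fun _ => farKer) (fun l => farKer_zero)] at htele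
    rw [sub_eq_iff_eq_add'] at htele
    rw [htele]
    congr 1
    · rw [moll]
      simp only [one_smul, smul_eq_mul, mul_comm (F _)]
      refine setIntegral_eq_integral_of_forall_compl_eq_zero fun w hw => ?_
      have := farKernel_eq_zero hw
      rw [farKernel] at this
      rw [this, zero_mul]
    · rw [Finset.mul_sum]
      refine Finset.sum_congr rfl fun i _ => ?_
      rw [avg, ← integral_const_mul]
      congr 1; funext w
      simp only [nearKernel, smul_eq_mul]
      ring
  · intro ζ hζ i
    have hy := add_smul_mem_polyball hρ hz hζ
    have haff : ContDiff ℝ 1 fun w : ℂ => z i + ρ * w :=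
      contDiff_const.add (contDiff_const.mul contDiff_fun_id)
    have hsl := h.slice _ hy i
    refine integral_discApprox_sub_farKer (M := M) (N := ρ * N) ?_ ?_ ?_ ?_ ?_
    · simp only [hupd]
      exact hsl.comp haff.contDiffOn fun w hw => hball i w hw
    · intro w hw
      exact hu.bdd _ (update_mem_polydisc hζ i (by simpa using hw))
    · exact (hg i).cont.comp (contDiff_update ζ i 0).continuous.continuousOn
        fun w hw => update_mem_polydisc hζ i (by simpa using hw)
    · intro w hw
      exact (hg i).bdd _ (update_mem_polydisc hζ i (by simpa using hw))
    · intro w hw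
      simp only [hupd]
      have hw' := hball i w hw
      have hW := (hsl.contDiffAt (Metric.isOpen_ball.mem_nhds hw')).differentiableAt (by simp)
      have hdb := h.dbar _ (update_mem_polyball hy i (mem_ball_zero_iff.1 hw')) i
      simp only [Function.update_idem, Function.update_self] at hdb
      rw [← hdb]
      have hfd : fderiv ℝ (fun w : ℂ => F (Function.update (z + ρ • ζ) i (z i + ρ * w))) w =
          ρ • fderiv ℝ (fun w => F (Function.update (z + ρ • ζ) i w)) (z i + ρ * w) := by
        have h1 : HasFDerivAt (fun w : ℂ => z i + ρ * w) (ρ • ContinuousLinearMap.id ℝ ℂ) w := by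
          have := ((hasFDerivAt_id (𝕜 := ℝ) w).const_smul ρ).const_add (z i)
          simpa using! this
        have h2 := (hW.hasFDerivAt.comp w h1).fderiv
        rw [Function.comp_def] at h2
        rw [h2]
        ext
        simp
      unfold dbarC
      rw [hfd]
      simp only [smul_apply, real_smul]
      ring

end DbarPolydisc

end

noncomputable section

namespace DbarPolydisc

open Complex Filter Topology

variable {n : ℕ}

/-! ### The regularized solution operator for smooth forms -/

/-- Smooth forms which are closed on the polydisc of polyradius `r`. -/
structure IsSmoothClosed (r : ℝ) (d : Fin n → (Fin n → ℂ) → ℂ) : Prop where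
  smooth : ∀ i, ContDiff ℝ ∞ (d i)
  closed : ∀ i j, ∀ z ∈ polyball n r, dbar i (d j) z = dbar j (d i) z

/-- The operator `polySolve` transported to the polydisc of polyradius `s`. -/
def scaledSolve (s : ℝ) (d : Fin n → (Fin n → ℂ) → ℂ) : (Fin n → ℂ) → ℂ :=
  (polyball n s).indicator fun z => polySolve (fun i ζ => (s : ℂ) * d i (s • ζ)) (s⁻¹ • z)

theorem inv_smul_mem_polydisc {s : ℝ} (hs : 0 < s) {z : Fin n → ℂ} (hz : z ∈ polyball n s) :
    s⁻¹ • z ∈ polydisc n := by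
  intro i
  rw [Pi.smul_apply, norm_smul, Real.norm_of_nonneg (inv_nonneg.2 hs.le), inv_mul_lt_iff₀ hs,
    mul_one]
  exact hz i

theorem smul_mem_polyball {s : ℝ} (hs : 0 < s) {z : Fin n → ℂ} (hz : z ∈ polydisc n) :
    s • z ∈ polyball n s := by
  intro i
  rw [Pi.smul_apply, norm_smul, Real.norm_of_nonneg hs.le]
  exact mul_lt_of_lt_one_right hs (hz i)

theorem contBddOn_scaled {s : ℝ} (hs : 0 < s) {d : Fin n → (Fin n → ℂ) → ℂ}
    (hd : ∀ i, Continuous (d i)) {N : ℝ} (hN : ∀ i, ∀ z ∈ polyball n s, ‖d i z‖ ≤ N) (i : Fin n) :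
    ContBddOn (fun ζ => (s : ℂ) * d i (s • ζ)) (s * N) :=
  ⟨(continuous_const.mul ((hd i).comp (continuous_const_smul s))).continuousOn, fun w hw => by
    rw [norm_mul, norm_real, Real.norm_of_nonneg hs.le]
    exact mul_le_mul_of_nonneg_left (hN i _ (smul_mem_polyball hs hw)) hs.le⟩

theorem norm_scaledSolve_le {s : ℝ} (hs : 0 < s) {d : Fin n → (Fin n → ℂ) → ℂ}
    (hd : ∀ i, Continuous (d i)) {N : ℝ} (hN0 : 0 ≤ N)
    (hN : ∀ i, ∀ z ∈ polyball n s, ‖d i z‖ ≤ N) (z : Fin n → ℂ) :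
    ‖scaledSolve s d z‖ ≤ polyConst n * (s * N) := by
  by_cases hz : z ∈ polyball n s
  · rw [scaledSolve, Set.indicator_of_mem hz]
    exact norm_polySolve_le (inv_smul_mem_polydisc hs hz) (contBddOn_scaled hs hd hN)
  · rw [scaledSolve, Set.indicator_of_notMem hz, norm_zero]
    exact mul_nonneg (polyConst_nonneg n) (mul_nonneg hs.le hN0)

theorem exists_bound_polyball {d : Fin n → (Fin n → ℂ) → ℂ} (hd : ∀ i, Continuous (d i)) (s : ℝ) :
    ∃ N, 0 ≤ N ∧ ∀ i, ∀ z ∈ polyball n s, ‖d i z‖ ≤ N := by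
  rcases le_or_gt s 0 with hs | hs
  · exact ⟨0, le_rfl, fun i z hz => absurd ((norm_nonneg _).trans_lt (hz i)) (not_lt.2 hs)⟩
  have hc : Continuous fun z i => d i z := continuous_pi hd
  obtain ⟨N, hN⟩ := (isCompact_closedBall (0 : Fin n → ℂ) s).exists_bound_of_continuousOn
    hc.continuousOn
  have h0 : 0 ≤ N := (norm_nonneg _).trans (hN 0 (by simpa using hs.le))
  refine ⟨N, h0, fun i z hz => (norm_le_pi_norm (fun i => d i z) i).trans (hN z ?_)⟩
  rw [mem_closedBall_zero_iff, pi_norm_le_iff_of_nonneg hs.le]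
  exact fun i => (hz i).le

theorem scaledSolve_add {s : ℝ} (hs : 0 < s) {d e : Fin n → (Fin n → ℂ) → ℂ}
    (hd : ∀ i, Continuous (d i)) (he : ∀ i, Continuous (e i)) (z : Fin n → ℂ) :
    scaledSolve s (d + e) z = scaledSolve s d z + scaledSolve s e z := by
  by_cases hz : z ∈ polyball n s
  · obtain ⟨N, -, hN⟩ := exists_bound_polyball hd s
    obtain ⟨N', -, hN'⟩ := exists_bound_polyball he s
    simp only [scaledSolve, Set.indicator_of_mem hz]
    rw [← polySolve_add (inv_smul_mem_polydisc hs hz) (contBddOn_scaled hs hd hN)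
      (contBddOn_scaled hs he hN')]
    congr 1
    funext i ζ
    simp only [Pi.add_apply, mul_add]
  · simp only [scaledSolve, Set.indicator_of_notMem hz, add_zero]

theorem scaledSolve_smul (s : ℝ) (c : ℂ) (d : Fin n → (Fin n → ℂ) → ℂ) (z : Fin n → ℂ) :
    scaledSolve s (c • d) z = c * scaledSolve s d z := by
  by_cases hz : z ∈ polyball n s
  · simp only [scaledSolve, Set.indicator_of_mem hz]
    rw [← polySolve_smul]
    congr 1
    funext i ζ
    simp only [Pi.smul_apply, smul_eq_mul, mul_left_comm]
  · simp only [scaledSolve, Set.indicator_of_notMem hz, mul_zero]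

theorem inv_smul_update (s : ℝ) (z : Fin n → ℂ) (i : Fin n) (w : ℂ) :
    s⁻¹ • Function.update z i w = Function.update (s⁻¹ • z) i (s⁻¹ • w) := by
  ext j
  rcases eq_or_ne j i with rfl | hj
  · simp
  · simp [hj]

/-- The Dolbeault lemma on the slightly larger polydisc supplies some smooth solution `u`, without
estimates, and `polySolve_eq` shows that `scaledSolve` differs from `u` by a projection. Regularity
in each variable separately is all that the representation formula needs. -/
theorem isSliceSolution_scaledSolve {s r : ℝ} (hs : 0 < s) (hsr : s < r)
    {d : Fin n → (Fin n → ℂ) → ℂ} (hd : IsSmoothClosed r d) :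
    IsSliceSolution s (scaledSolve s d) d := by
  obtain ⟨u, hu, hud⟩ := exists_dbar_eq hd.smooth hs hsr hd.closed
  have hu1 : ContDiff ℝ 1 u := hu.of_le (by exact_mod_cast le_top)
  set v : (Fin n → ℂ) → ℂ := fun z => u (s • z) with hv
  have hv1 : ContDiff ℝ 1 v := hu1.comp (contDiff_const_smul s)
  obtain ⟨M, hM⟩ := exists_contBddOn hv1.continuous
  have hsol : ∀ z ∈ polyball n s, scaledSolve s d z = u z - polyProj v (s⁻¹ • z) := by
    intro z hz
    rw [scaledSolve, Set.indicator_of_mem hz, polySolve_eq hv1 _ (inv_smul_mem_polydisc hs hz)]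
    · simp only [hv, smul_smul, mul_inv_cancel₀ hs.ne', one_smul]
    · intro i ζ hζ
      have : fderiv ℝ v ζ = s • fderiv ℝ u (s • ζ) := fderiv_comp_smul _
      rw [← hud i _ (smul_mem_polyball hs hζ), dbar, dbar, this]
      simp only [smul_apply, real_smul]
      ring
  have hq : ∀ z ∈ polyball n s, ∀ i, DifferentiableOn ℂ
      (fun w => polyProj v (s⁻¹ • Function.update z i w)) (Metric.ball 0 s) := by
    intro z hz i
    simp only [inv_smul_update]
    refine (differentiableOn_polyProj_slice hM (inv_smul_mem_polydisc hs hz) i).comp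
      (Differentiable.differentiableOn ?_) fun w hw => ?_
    · exact differentiable_id.const_smul s⁻¹
    · rw [mem_ball_zero_iff] at hw ⊢
      rwa [norm_smul, Real.norm_of_nonneg (inv_nonneg.2 hs.le), inv_mul_lt_iff₀ hs, mul_one]
  have heq : ∀ z ∈ polyball n s, ∀ i, ∀ w ∈ Metric.ball (0 : ℂ) s,
      scaledSolve s d (Function.update z i w) =
        u (Function.update z i w) - polyProj v (s⁻¹ • Function.update z i w) := fun z hz i w hw =>
    hsol _ (update_mem_polyball hz i (mem_ball_zero_iff.1 hw))
  refine ⟨?_, fun z hz i => ?_, fun z hz i => ?_⟩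
  · refine (hu.continuous.continuousOn.sub ((continuousOn_polyProj hM).comp
      (continuous_const_smul s⁻¹).continuousOn fun z hz => ?_)).congr hsol
    exact inv_smul_mem_polydisc hs hz
  · refine ContDiffOn.congr ?_ (heq z hz i)
    exact (hu1.comp (contDiff_update z i 1)).contDiffOn.sub
      (((hq z hz i).contDiffOn Metric.isOpen_ball).restrict_scalars ℝ)
  · have hzi : z i ∈ Metric.ball (0 : ℂ) s := by simpa using hz i
    have h1 : DifferentiableAt ℝ u (Function.update z i (z i)) := hu.differentiable (by simp) _
    have h2 : DifferentiableAt ℝ (fun w => u (Function.update z i w)) (z i) :=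
      (hu1.comp (contDiff_update z i 1)).differentiable (by simp) _
    have h3 := (hq z hz i).differentiableAt (Metric.isOpen_ball.mem_nhds hzi)
    have h4 := (HasWirtingerAt.of_differentiableAt h2).sub
      (HasWirtingerAt.of_differentiableAt (h3.restrictScalars ℝ))
    have h5 := (h4.congr_of_eventuallyEq (g := fun w => scaledSolve s d (Function.update z i w)) (by
      filter_upwards [Metric.isOpen_ball.mem_nhds hzi] with w hw
      exact heq z hz i w hw)).dbarC_eq
    rw [h5, dbarC_eq_zero_of_differentiableAt h3, sub_zero, dbarC_update h1,
      Function.update_eq_self, hud i z hz]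

theorem integrable_scaledSolve {s r : ℝ} (hs : 0 < s) (hsr : s < r)
    {d : Fin n → (Fin n → ℂ) → ℂ} (hd : IsSmoothClosed r d) : Integrable (scaledSolve s d) := by
  have hdc := fun i => (hd.smooth i).continuous
  obtain ⟨N, hN0, hN⟩ := exists_bound_polyball hdc s
  have hm : MeasurableSet (polyball n s) := (isOpen_polyball n s).measurableSet
  have hfin : volume (polyball n s) < ⊤ := by
    refine (Metric.isBounded_closedBall (x := (0 : Fin n → ℂ)) (r := s)).subset ?_
      |>.measure_lt_top
    intro z hz
    rw [mem_closedBall_zero_iff, pi_norm_le_iff_of_nonneg hs.le]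
    exact fun i => (hz i).le
  have h1 : IntegrableOn (scaledSolve s d) (polyball n s) :=
    IntegrableOn.of_bound hfin
      ((isSliceSolution_scaledSolve hs hsr hd).cont.aestronglyMeasurable hm)
      (polyConst n * (s * N)) (Eventually.of_forall (norm_scaledSolve_le hs hdc hN0 hN))
  have h2 := h1.integrable_indicator hm
  rwa [scaledSolve, Set.indicator_indicator, Set.inter_self] at h2

theorem scaledSolve_eq_zero {s : ℝ} {d : Fin n → (Fin n → ℂ) → ℂ} (hs : 0 < s) {y : Fin n → ℂ}
    (hy : s < ‖y‖) : scaledSolve s d y = 0 := by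
  refine Set.indicator_of_notMem (fun h => not_le.2 hy ?_) _
  rw [pi_norm_le_iff_of_nonneg hs.le]
  exact fun i => (h i).le

/-- A solution of `∂̄u = d` on the polydisc which is a smooth function on the whole space. -/
def regSolve (ρ : ℝ) (d : Fin n → (Fin n → ℂ) → ℂ) (z : Fin n → ℂ) : ℂ :=
  moll (scaledSolve (1 + ρ) d) 1 ρ farKernel z +
    ρ • ∑ i, avg (polyMeasure 0) (nearKernel i) (fun w => ρ • w) (d i) z

section RegSolve

variable {ρ r : ℝ} {d : Fin n → (Fin n → ℂ) → ℂ}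

theorem aestronglyMeasurable_smul (ρ : ℝ) :
    AEStronglyMeasurable (fun w : Fin n → ℂ => ρ • w) (polyMeasure 0) :=
  (continuous_const_smul ρ).aestronglyMeasurable

theorem ae_norm_smul_le (ρ : ℝ) :
    ∀ᵐ w ∂polyMeasure (0 : Fin n → ℂ), ‖ρ • w‖ ≤ ‖ρ‖ := by
  filter_upwards [ae_polyMeasure_mem zero_mem_polydisc] with w hw
  rw [norm_smul]
  exact mul_le_of_le_one_right (norm_nonneg _) (norm_le_one_of_mem_polydisc hw)

/-- `regSolve` is the right side of the interior representation formula: it is smooth by its shape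
and agrees with the solution by the formula. -/
theorem regSolve_eq (hρ : 0 < ρ) (hr : 1 + ρ < r) (hd : IsSmoothClosed r d) {z : Fin n → ℂ}
    (hz : z ∈ polydisc n) : regSolve ρ d z = scaledSolve (1 + ρ) d z := by
  have hs : 0 < 1 + ρ := by linarith
  have hdc := fun i => (hd.smooth i).continuous
  obtain ⟨N, hN0, hN⟩ := exists_bound_polyball hdc (1 + ρ)
  rw [(isSliceSolution_scaledSolve hs hr hd).eq_integral hρ
    (fun z _ => norm_scaledSolve_le hs hdc hN0 hN z) hdc hN hz, regSolve, real_smul]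

theorem contDiff_avg_nearKernel (hd : IsSmoothClosed r d) (i : Fin n) :
    ContDiff ℝ ∞ (avg (polyMeasure 0) (nearKernel i) (fun w => ρ • w) (d i)) :=
  contDiff_avg (integrable_nearKernel i) (aestronglyMeasurable_smul ρ) (ae_norm_smul_le ρ)
    (hd.smooth i)

theorem contDiff_moll_scaledSolve (hρ : 0 < ρ) (hr : 1 + ρ < r) (hd : IsSmoothClosed r d) :
    ContDiff ℝ ∞ (moll (scaledSolve (1 + ρ) d) 1 ρ farKernel) :=
  have hs : 0 < 1 + ρ := by linarith
  contDiff_moll (integrable_scaledSolve hs hr hd) (fun _ hy => scaledSolve_eq_zero hs hy)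
    one_ne_zero hρ.ne' contDiff_farKernel

theorem contDiff_regSolve (hρ : 0 < ρ) (hr : 1 + ρ < r) (hd : IsSmoothClosed r d) :
    ContDiff ℝ ∞ (regSolve ρ d) :=
  (contDiff_moll_scaledSolve hρ hr hd).add
    ((ContDiff.sum fun i _ => contDiff_avg_nearKernel hd i).const_smul ρ)

theorem polydisc_subset_polyball {s : ℝ} (hs : 1 ≤ s) : polydisc n ⊆ polyball n s :=
  fun _ hz i => (hz i).trans_le hs

theorem dbar_regSolve (hρ : 0 < ρ) (hr : 1 + ρ < r) (hd : IsSmoothClosed r d) {z : Fin n → ℂ}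
    (hz : z ∈ polydisc n) (i : Fin n) : dbar i (regSolve ρ d) z = d i z := by
  have hs : 0 < 1 + ρ := by linarith
  have hz' := polydisc_subset_polyball (by linarith : 1 ≤ 1 + ρ) hz
  have h1 : DifferentiableAt ℝ (regSolve ρ d) (Function.update z i (z i)) :=
    (contDiff_regSolve hρ hr hd).differentiable (by simp) _
  have h2 := dbarC_update h1
  rw [Function.update_eq_self] at h2
  rw [← h2, ← (isSliceSolution_scaledSolve hs hr hd).dbar z hz' i]
  have h3 : (fun w => regSolve ρ d (Function.update z i w)) =ᶠ[𝓝 (z i)]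
      fun w => scaledSolve (1 + ρ) d (Function.update z i w) := by
    filter_upwards [(isOpen_lt continuous_norm continuous_const).mem_nhds (hz i)] with w hw
    exact regSolve_eq hρ hr hd (update_mem_polydisc hz i hw)
  rw [dbarC, dbarC, h3.fderiv_eq]

theorem regSolve_add (hρ : 0 < ρ) (hr : 1 + ρ < r) {e : Fin n → (Fin n → ℂ) → ℂ}
    (hd : IsSmoothClosed r d) (he : IsSmoothClosed r e) (z : Fin n → ℂ) :
    regSolve ρ (d + e) z = regSolve ρ d z + regSolve ρ e z := by
  have hs : 0 < 1 + ρ := by linarith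
  have hdc := fun i => (hd.smooth i).continuous
  have hec := fun i => (he.smooth i).continuous
  have h1 : moll (scaledSolve (1 + ρ) (d + e)) 1 ρ farKernel z =
      moll (scaledSolve (1 + ρ) d) 1 ρ farKernel z +
        moll (scaledSolve (1 + ρ) e) 1 ρ farKernel z := by
    simp only [moll, scaledSolve_add hs hdc hec, add_smul]
    exact integral_add (integrable_moll (integrable_scaledSolve hs hr hd) hρ.ne'
      contDiff_farKernel.continuous hasCompactSupport_farKernel z)
      (integrable_moll (integrable_scaledSolve hs hr he) hρ.ne'
      contDiff_farKernel.continuous hasCompactSupport_farKernel z)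
  have h2 : ∀ i, avg (polyMeasure 0) (nearKernel i) (fun w => ρ • w) ((d + e) i) z =
      avg (polyMeasure 0) (nearKernel i) (fun w => ρ • w) (d i) z +
        avg (polyMeasure 0) (nearKernel i) (fun w => ρ • w) (e i) z := by
    intro i
    simp only [avg, Pi.add_apply, smul_add]
    exact integral_add
      (integrable_avg (integrable_nearKernel i) (aestronglyMeasurable_smul ρ) (ae_norm_smul_le ρ)
        (hdc i) z)
      (integrable_avg (integrable_nearKernel i) (aestronglyMeasurable_smul ρ) (ae_norm_smul_le ρ)
        (hec i) z)
  simp only [regSolve, h1, h2, Finset.sum_add_distrib, smul_add]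
  ring

theorem regSolve_smul (c : ℂ) (z : Fin n → ℂ) : regSolve ρ (c • d) z = c * regSolve ρ d z := by
  have h1 : moll (scaledSolve (1 + ρ) (c • d)) 1 ρ farKernel z =
      c * moll (scaledSolve (1 + ρ) d) 1 ρ farKernel z := by
    simp only [moll, scaledSolve_smul, smul_eq_mul, mul_assoc]
    exact integral_const_mul _ _
  have h2 : ∀ i, avg (polyMeasure 0) (nearKernel i) (fun w => ρ • w) ((c • d) i) z =
      c * avg (polyMeasure 0) (nearKernel i) (fun w => ρ • w) (d i) z := by
    intro i
    simp only [avg, Pi.smul_apply, smul_eq_mul, mul_left_comm]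
    exact integral_const_mul _ _
  simp only [regSolve, h1, h2, ← Finset.mul_sum, mul_add, real_smul]
  ring

end RegSolve

/-- The interior estimate. Derivatives of the far part fall on `farKernel` and cost `ρ⁻¹` each,
against the supremum bound for `scaledSolve`; those of the near part fall on `d`, with the prefactor
`ρ` from rescaling. -/
theorem exists_norm_iteratedFDeriv_regSolve_le (n j : ℕ) : ∃ K : ℝ, 0 ≤ K ∧
    ∀ {ρ r : ℝ} {d : Fin n → (Fin n → ℂ) → ℂ}, 0 < ρ → ρ ≤ 1 → 1 + ρ < r → IsSmoothClosed r d →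
    ∀ {N N' : ℝ}, 0 ≤ N → (∀ i, ∀ z ∈ polyball n (1 + ρ), ‖d i z‖ ≤ N) →
    (∀ i, ∀ z ∈ polyball n (1 + ρ), ‖iteratedFDeriv ℝ j (d i) z‖ ≤ N') → 0 ≤ N' →
    ∀ z ∈ polydisc n, ‖iteratedFDeriv ℝ j (regSolve ρ d) z‖ ≤ K * (ρ⁻¹ ^ j * N + ρ * N') := by
  set A : ℝ := ∫ w : Fin n → ℂ, ‖iteratedFDeriv ℝ j farKernel w‖ with hA
  have hA0 : 0 ≤ A := integral_nonneg fun _ => norm_nonneg _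
  set B : ℝ := ∑ i : Fin n, ∫ w, ‖nearKernel i w‖ ∂polyMeasure 0 with hB
  have hB0 : 0 ≤ B := Finset.sum_nonneg fun i _ => integral_nonneg fun _ => norm_nonneg _
  have hP := polyConst_nonneg n
  refine ⟨2 * polyConst n * A + B, by positivity, ?_⟩
  intro ρ r d hρ hρ1 hr hd N N' hN0 hN hN' hN0' z hz
  have hs : 0 < 1 + ρ := by linarith
  have hdc := fun i => (hd.smooth i).continuous
  have hc1 := contDiff_moll_scaledSolve hρ hr hd
  have hc2 : ContDiff ℝ ∞ fun z => ∑ i, avg (polyMeasure 0) (nearKernel i) (fun w => ρ • w) (d i) z :=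
    ContDiff.sum fun i _ => contDiff_avg_nearKernel hd i
  have hj : (j : ℕ∞ω) ≤ (∞ : ℕ∞ω) := by exact_mod_cast le_top
  have b1 : ‖iteratedFDeriv ℝ j (moll (scaledSolve (1 + ρ) d) 1 ρ farKernel) z‖ ≤
      2 * polyConst n * A * (ρ⁻¹ ^ j * N) := by
    have h := norm_iteratedFDeriv_sum_moll_le (integrable_scaledSolve hs hr hd)
      (fun _ hy => scaledSolve_eq_zero hs hy) {()} (a := fun _ => 1) (τ := fun _ => ρ)
      (fun _ _ => one_ne_zero) (fun _ _ => hρ.ne') j (fun _ => 1) z contDiff_farKernel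
      hasCompactSupport_farKernel
    simp only [Finset.sum_singleton, one_smul, one_mul] at h
    refine h.trans ?_
    have hint : Integrable fun w : Fin n → ℂ => ‖iteratedFDeriv ℝ j farKernel w‖ :=
      ((contDiff_farKernel.continuous_iteratedFDeriv hj).norm).integrable_of_hasCompactSupport
        (hasCompactSupport_farKernel.iteratedFDeriv j).norm
    have e : 2 * polyConst n * A * (ρ⁻¹ ^ j * N) =
        ∫ w : Fin n → ℂ, (ρ⁻¹ ^ j * (polyConst n * (2 * N))) * ‖iteratedFDeriv ℝ j farKernel w‖ := by
      rw [integral_const_mul, ← hA]; ring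
    rw [e]
    refine integral_mono_of_nonneg (Eventually.of_forall fun w => by positivity)
      (hint.const_mul _) (Eventually.of_forall fun w => ?_)
    refine mul_le_mul_of_nonneg_right ?_ (norm_nonneg _)
    rw [norm_smul, norm_pow, norm_neg, one_div, norm_inv, Real.norm_of_nonneg hρ.le]
    refine mul_le_mul_of_nonneg_left ((norm_scaledSolve_le hs hdc hN0 hN _).trans ?_) (by positivity)
    gcongr
    linarith
  have b2 : ‖iteratedFDeriv ℝ j (fun z => ∑ i, avg (polyMeasure 0) (nearKernel i)
      (fun w => ρ • w) (d i) z) z‖ ≤ B * N' := by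
    rw [iteratedFDeriv_fun_sum_apply fun i _ =>
      ((contDiff_avg_nearKernel hd i).of_le hj).contDiffAt, hB, Finset.sum_mul]
    refine (norm_sum_le _ _).trans (Finset.sum_le_sum fun i _ => ?_)
    refine norm_iteratedFDeriv_avg_le (integrable_nearKernel i) (aestronglyMeasurable_smul ρ)
      (ae_norm_smul_le ρ) j (hd.smooth i) ?_
    filter_upwards [ae_polyMeasure_mem zero_mem_polydisc] with w hw
    exact hN' i _ (add_smul_mem_polyball hρ hz hw)
  have e : iteratedFDeriv ℝ j (regSolve ρ d) z =
      iteratedFDeriv ℝ j (moll (scaledSolve (1 + ρ) d) 1 ρ farKernel) z +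
      ρ • iteratedFDeriv ℝ j (fun z => ∑ i, avg (polyMeasure 0) (nearKernel i)
        (fun w => ρ • w) (d i) z) z := by
    rw [← iteratedFDeriv_const_smul_apply' (hc2.of_le hj).contDiffAt]
    exact fun_iteratedFDeriv_add_apply (hc1.of_le hj).contDiffAt
      ((hc2.const_smul ρ).of_le hj).contDiffAt
  rw [e]
  refine (norm_add_le _ _).trans ?_
  rw [norm_smul, Real.norm_of_nonneg hρ.le]
  have h1 : 0 ≤ ρ⁻¹ ^ j * N := by positivity
  have h2 : 0 ≤ polyConst n * A := by positivity
  have h3 := mul_le_mul_of_nonneg_left b2 hρ.le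
  nlinarith [mul_nonneg hB0 h1, mul_nonneg h2 (mul_nonneg hρ.le hN0')]

end DbarPolydisc

end

noncomputable section

namespace DbarPolydisc

open Complex Filter Topology

variable {n : ℕ}

/-! ### Moments and polynomial approximation -/

/-- The dilation parameters of the approximate identity. -/
def node (c : ℕ) : ℝ := ((c : ℝ) + 2)⁻¹

theorem node_pos (c : ℕ) : 0 < node c := by unfold node; positivity

theorem node_le (c : ℕ) : node c ≤ 1 / 2 := by
  rw [node, one_div]
  exact inv_anti₀ two_pos (by linarith [(Nat.cast_nonneg c : (0 : ℝ) ≤ c)])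

theorem node_anti {c c' : ℕ} (h : c ≤ c') : node c' ≤ node c := by
  unfold node
  have : (c : ℝ) ≤ c' := by exact_mod_cast h
  exact inv_anti₀ (by positivity) (by linarith)

theorem node_injective : Function.Injective node := by
  intro c c' h
  simpa [node] using h

/-- The weights of the approximate identity, with vanishing moments of positive and negative
orders. -/
def weight (k c : ℕ) : ℝ :=
  (Lagrange.basis (Finset.range (2 * k + 2)) node c).coeff (k + 1) * node c ^ (k + 1)

/-- Lagrange interpolation at `2k + 2` nodes reproduces `X^(k+1-j+i)`, of degree at most `2k + 1`;
comparing coefficients of `X^(k+1)` gives the moments of order `i - j`, from `-(k+1)` to `k`. -/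
theorem sum_weight_mul (k : ℕ) {i j : ℕ} (hj : j ≤ k + 1) (hi : i ≤ j + k) :
    ∑ c ∈ Finset.range (2 * k + 2), weight k c * (node c ^ i / node c ^ j) =
      if i = j then 1 else 0 := by
  have hdeg : ((Polynomial.X : Polynomial ℝ) ^ (k + 1 - j + i)).degree <
      ((Finset.range (2 * k + 2)).card : WithBot ℕ) := by
    rw [Polynomial.degree_X_pow, Finset.card_range]
    exact_mod_cast (by omega : k + 1 - j + i < 2 * k + 2)
  have h := Lagrange.eq_interpolate node_injective.injOn hdeg
  rw [Lagrange.interpolate_apply] at h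
  have h2 := congrArg (fun p : Polynomial ℝ => p.coeff (k + 1)) h
  simp only [Polynomial.finsetSum_coeff, Polynomial.coeff_C_mul, Polynomial.eval_pow,
    Polynomial.eval_X, Polynomial.coeff_X_pow] at h2
  have h3 : (k + 1 = k + 1 - j + i) ↔ i = j := by omega
  simp only [h3] at h2
  rw [h2]
  refine Finset.sum_congr rfl fun c _ => ?_
  have hc := (node_pos c).ne'
  have h4 : node c ^ (k + 1) = node c ^ (k + 1 - j) * node c ^ j := by
    rw [← pow_add]; congr 1; omega
  rw [weight, h4, pow_add]
  field_simp

/-- With `x = node c * t` the summand is `weight k c` times `((X-1)^j p)(x) / x^j`, and the moment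
conditions keep only its constant term. The value does not depend on `t`, so it cancels between two
scales. -/
theorem sum_weight_mul_eval (k : ℕ) {j : ℕ} (hj : j ≤ k + 1) {t : ℝ} (ht : t ≠ 0)
    (p : Polynomial ℂ) (hp : p.natDegree ≤ k) :
    ∑ c ∈ Finset.range (2 * k + 2),
      ((weight k c * (-((1 - node c * t) / (node c * t))) ^ j : ℝ) : ℂ) *
        p.eval ((node c * t : ℝ) : ℂ) = ((Polynomial.X - 1) ^ j * p).coeff j := by
  set Q := (Polynomial.X - 1) ^ j * p with hQ
  have hdeg : Q.natDegree < j + k + 1 := by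
    have h1 : ((Polynomial.X - 1 : Polynomial ℂ) ^ j).natDegree ≤ j := by
      refine Polynomial.natDegree_pow_le.trans ?_
      rw [← Polynomial.C_1, Polynomial.natDegree_X_sub_C, mul_one]
    exact Nat.lt_succ_of_le (Polynomial.natDegree_mul_le.trans (add_le_add h1 hp))
  have h1 : ∀ c ∈ Finset.range (2 * k + 2),
      ((weight k c * (-((1 - node c * t) / (node c * t))) ^ j : ℝ) : ℂ) *
        p.eval ((node c * t : ℝ) : ℂ) =
      ∑ i ∈ Finset.range (j + k + 1), Q.coeff i * ((t : ℂ) ^ i / (t : ℂ) ^ j) *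
        ((weight k c * (node c ^ i / node c ^ j) : ℝ) : ℂ) := by
    intro c _
    have hc : (node c : ℂ) ≠ 0 := ofReal_ne_zero.2 (node_pos c).ne'
    have ht' : (t : ℂ) ≠ 0 := ofReal_ne_zero.2 ht
    have h2 : Q.eval ((node c * t : ℝ) : ℂ) =
        (((node c * t : ℝ) : ℂ) - 1) ^ j * p.eval ((node c * t : ℝ) : ℂ) := by
      simp [hQ]
    have h3 : ((weight k c * (-((1 - node c * t) / (node c * t))) ^ j : ℝ) : ℂ) *
        p.eval ((node c * t : ℝ) : ℂ) =
        weight k c * (Q.eval ((node c * t : ℝ) : ℂ) / ((node c : ℂ) * t) ^ j) := by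
      rw [h2, ← neg_div, neg_sub, ofReal_mul, ofReal_pow, ofReal_div, div_pow]
      push_cast
      ring
    rw [h3, Polynomial.eval_eq_sum_range' hdeg, Finset.sum_div, Finset.mul_sum]
    refine Finset.sum_congr rfl fun i _ => ?_
    push_cast
    rw [mul_pow, mul_pow]
    field_simp
  rw [Finset.sum_congr rfl h1, Finset.sum_comm]
  simp only [← Finset.mul_sum, ← ofReal_sum]
  rw [Finset.sum_congr rfl fun i hi => by
    rw [sum_weight_mul k hj (Nat.lt_succ_iff.1 (Finset.mem_range.1 hi))]]
  rw [Finset.sum_eq_single j]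
  · have ht' : (t : ℂ) ≠ 0 := ofReal_ne_zero.2 ht
    simp [ht']
  · intro i _ hij
    simp [hij]
  · intro h
    exact absurd (Finset.mem_range.2 (by omega)) h

/-! ### Taylor approximation on an interval. -/

/-- Taylor approximation from the oscillation of the derivative of order `k`. -/
theorem exists_taylor_coeff {a b A : ℝ} (hab : a ≤ b) (k : ℕ) : ∀ {q : ℕ → ℝ → ℂ},
    (∀ i < k, ∀ x ∈ Set.Icc a b, HasDerivWithinAt (q i) (q (i + 1) x) (Set.Icc a b) x) →
    (∀ x ∈ Set.Icc a b, ‖q k x - q k a‖ ≤ A) →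
    ∃ e : ℕ → ℂ, ∀ x ∈ Set.Icc a b,
      ‖q 0 x - ∑ i ∈ Finset.range (k + 1), e i * ((x - a : ℝ) : ℂ) ^ i‖ ≤ A * (b - a) ^ k := by
  induction k with
  | zero =>
    intro q _ hA
    exact ⟨fun _ => q 0 a, fun x hx => by simpa using hA x hx⟩
  | succ k ih =>
    intro q hq hA
    obtain ⟨e, he⟩ := ih (q := fun i => q (i + 1)) (fun i hi => hq (i + 1) (by omega)) hA
    refine ⟨fun i => if i = 0 then q 0 a else e (i - 1) / i, fun x hx => ?_⟩
    have ha : a ∈ Set.Icc a b := Set.left_mem_Icc.2 hab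
    -- The approximating polynomial of the derivative is integrated from `a`; the mean value
    -- inequality then gains one factor `b - a`.
    have hd : ∀ y ∈ Set.Icc a b, HasDerivWithinAt
        (fun y => q 0 y - ∑ i ∈ Finset.range (k + 1), e i / (i + 1) * ((y - a : ℝ) : ℂ) ^ (i + 1))
        (q 1 y - ∑ i ∈ Finset.range (k + 1), e i * ((y - a : ℝ) : ℂ) ^ i) (Set.Icc a b) y := by
      intro y hy
      refine (hq 0 (Nat.succ_pos k) y hy).sub (HasDerivWithinAt.fun_sum fun i _ => ?_)
      have h1 : HasDerivWithinAt (fun y : ℝ => ((y - a : ℝ) : ℂ)) 1 (Set.Icc a b) y := by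
        have := (((hasDerivAt_id y).sub_const a).ofReal_comp).hasDerivWithinAt (s := Set.Icc a b)
        simpa using! this
      refine ((h1.fun_pow (i + 1)).const_mul (e i / (i + 1))).congr_deriv ?_
      have : ((i : ℂ) + 1) ≠ 0 := Nat.cast_add_one_ne_zero i
      simp only [Nat.cast_add, Nat.cast_one, Nat.add_sub_cancel, mul_one]
      field_simp
    have hmv := (convex_Icc a b).norm_image_sub_le_of_norm_hasDerivWithin_le hd he ha hx
    have hA0 : 0 ≤ A * (b - a) ^ k := (norm_nonneg _).trans (he a ha)
    rw [Finset.sum_range_succ']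
    simp only [sub_self, ofReal_zero, ne_eq, Nat.add_eq_zero_iff, one_ne_zero, and_false,
      not_false_eq_true, zero_pow, mul_zero, Finset.sum_const_zero, sub_zero, if_false,
      Nat.add_sub_cancel, if_true, pow_zero, mul_one] at hmv ⊢
    push_cast at hmv ⊢
    have e1 : ∀ S : ℂ, q 0 x - (S + q 0 a) = q 0 x - S - q 0 a := fun S => by ring
    rw [e1]
    refine hmv.trans ?_
    rw [pow_succ, ← mul_assoc]
    refine mul_le_mul_of_nonneg_left ?_ hA0
    rw [Real.norm_of_nonneg (sub_nonneg.2 hx.1)]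
    linarith [hx.2]

theorem exists_taylor_polynomial {a b A : ℝ} (hab : a ≤ b) (k : ℕ) {q : ℕ → ℝ → ℂ}
    (hq : ∀ i < k, ∀ x ∈ Set.Icc a b, HasDerivWithinAt (q i) (q (i + 1) x) (Set.Icc a b) x)
    (hA : ∀ x ∈ Set.Icc a b, ‖q k x - q k a‖ ≤ A) :
    ∃ p : Polynomial ℂ, p.natDegree ≤ k ∧ ∀ x ∈ Set.Icc a b,
      ‖q 0 x - p.eval (x : ℂ)‖ ≤ A * (b - a) ^ k := by
  obtain ⟨e, he⟩ := exists_taylor_coeff hab k hq hA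
  refine ⟨∑ i ∈ Finset.range (k + 1), Polynomial.C (e i) * (Polynomial.X - Polynomial.C (a : ℂ)) ^ i,
    ?_, fun x hx => ?_⟩
  · refine Polynomial.natDegree_sum_le_of_forall_le _ _ fun i hi => ?_
    refine (Polynomial.natDegree_C_mul_le _ _).trans (Polynomial.natDegree_pow_le.trans ?_)
    rw [Polynomial.natDegree_X_sub_C, mul_one]
    exact Nat.lt_succ_iff.1 (Finset.mem_range.1 hi)
  · have := he x hx
    simp only [Polynomial.eval_finsetSum, Polynomial.eval_mul, Polynomial.eval_C,
      Polynomial.eval_pow, Polynomial.eval_sub, Polynomial.eval_X]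
    simpa using this

end DbarPolydisc

end

noncomputable section

namespace DbarPolydisc

open Complex Filter Topology

variable {n : ℕ}

/-! ### Decomposition of Hölder functions into dyadic bands -/

/-- A smooth density supported in the ball of radius `1/2`. -/
def mollifier (w : Fin n → ℂ) : ℂ :=
  (((⟨1 / 4, 1 / 2, by norm_num, by norm_num⟩ : ContDiffBump (0 : Fin n → ℂ)).normed volume w : ℝ) : ℂ)

theorem contDiff_mollifier : ContDiff ℝ ∞ (mollifier (n := n)) :=
  ofRealCLM.contDiff.comp (ContDiffBump.contDiff_normed _)

theorem mollifier_eq_zero {w : Fin n → ℂ} (hw : 1 / 2 ≤ ‖w‖) : mollifier w = 0 := by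
  unfold mollifier
  rw [ofReal_eq_zero, ← Function.notMem_support, ContDiffBump.support_normed_eq]
  simpa using hw

theorem tsupport_mollifier_subset :
    tsupport (mollifier (n := n)) ⊆ Metric.closedBall 0 (1 / 2) := by
  refine closure_minimal (fun w hw => ?_) Metric.isClosed_closedBall
  rw [mem_closedBall_zero_iff]
  by_contra h
  exact hw (mollifier_eq_zero (not_le.1 h).le)

theorem hasCompactSupport_mollifier : HasCompactSupport (mollifier (n := n)) :=
  (isCompact_closedBall _ _).of_isClosed_subset (isClosed_tsupport _) tsupport_mollifier_subset

theorem integral_mollifier : ∫ w : Fin n → ℂ, mollifier w = 1 := by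
  unfold mollifier
  rw [integral_complex_ofReal, ContDiffBump.integral_normed, ofReal_one]

/-- Functions of class `C^{k+α}` on the polydisc, extended by zero. -/
structure HolderOn (k : ℕ) (α : ℝ≥0) (f : (Fin n → ℂ) → ℂ) (N : ℝ) : Prop where
  smooth : ContDiffOn ℝ k f (polydisc n)
  zero : ∀ z ∉ polydisc n, f z = 0
  bdd : ∀ z ∈ polydisc n, ‖f z‖ ≤ N
  holder : ∀ x ∈ polydisc n, ∀ y ∈ polydisc n,
    ‖iteratedFDerivWithin ℝ k f (polydisc n) x - iteratedFDerivWithin ℝ k f (polydisc n) y‖ ≤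
      N * ‖x - y‖ ^ (α : ℝ)

section HolderOn

variable {k : ℕ} {α : ℝ≥0} {f : (Fin n → ℂ) → ℂ} {N : ℝ}

theorem HolderOn.nonneg (hf : HolderOn k α f N) : 0 ≤ N :=
  (norm_nonneg _).trans (hf.bdd 0 zero_mem_polydisc)

theorem HolderOn.norm_le (hf : HolderOn k α f N) (z : Fin n → ℂ) : ‖f z‖ ≤ N := by
  by_cases hz : z ∈ polydisc n
  · exact hf.bdd z hz
  · rw [hf.zero z hz, norm_zero]; exact hf.nonneg

theorem HolderOn.integrable (hf : HolderOn k α f N) : Integrable f := by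
  have hm := measurableSet_polydisc n
  have hfin : volume (polydisc n) < ⊤ := by
    refine (Metric.isBounded_closedBall (x := (0 : Fin n → ℂ)) (r := 1)).subset ?_
      |>.measure_lt_top
    intro z hz
    rw [mem_closedBall_zero_iff]
    exact norm_le_one_of_mem_polydisc hz
  have h1 : IntegrableOn f (polydisc n) :=
    IntegrableOn.of_bound hfin (hf.smooth.continuousOn.aestronglyMeasurable hm) N
      (Eventually.of_forall hf.norm_le)
  have h2 := h1.integrable_indicator hm
  rwa [Set.indicator_eq_self.2 fun z hz => by
    by_contra h
    exact hz (hf.zero z h)] at h2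

theorem HolderOn.eq_zero (hf : HolderOn k α f N) {y : Fin n → ℂ} (hy : 1 < ‖y‖) : f y = 0 :=
  hf.zero y fun h => not_le.2 hy (norm_le_one_of_mem_polydisc h)

end HolderOn

/-- Each coordinate is at most `(1-τ)(1+τ/2) + τ/2 = 1 - τ²/2`. The dilation thus makes
mollification possible slightly beyond the boundary without extending `f`. -/
theorem dilate_mem_polydisc {τ : ℝ} (h0 : 0 < τ) (h1 : τ ≤ 1) {z w : Fin n → ℂ}
    (hz : z ∈ polyball n (1 + τ / 2)) (hw : ‖w‖ ≤ 1 / 2) : (1 - τ) • z + τ • w ∈ polydisc n := by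
  intro i
  have hwi : ‖w i‖ ≤ 1 / 2 := (norm_le_pi_norm w i).trans hw
  have hzi := hz i
  calc ‖((1 - τ) • z + τ • w) i‖ ≤ (1 - τ) * ‖z i‖ + τ * ‖w i‖ := by
        refine (norm_add_le _ _).trans_eq ?_
        rw [Pi.smul_apply, Pi.smul_apply, norm_smul, norm_smul, Real.norm_of_nonneg h0.le,
          Real.norm_of_nonneg (sub_nonneg.2 h1)]
    _ < 1 := by nlinarith [mul_le_mul_of_nonneg_left hzi.le (sub_nonneg.2 h1)]

/-- The derivative `∂/∂z̄ᵢ` of a mollification falls on the mollifier. -/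
theorem dbar_moll {f : (Fin n → ℂ) → ℂ} {R a τ : ℝ} (hf : Integrable f)
    (hfR : ∀ y, R < ‖y‖ → f y = 0) (ha : a ≠ 0) (hτ : τ ≠ 0) {Φ : (Fin n → ℂ) → ℂ}
    (hΦ : ContDiff ℝ 1 Φ) (hc : HasCompactSupport Φ) (i : Fin n) (z : Fin n → ℂ) :
    dbar i (moll f a τ Φ) z = (-(a / τ)) • ∫ w, f (a • z + τ • w) * dbar i Φ w := by
  have hint := integrable_moll (a := a) hf hτ (hΦ.continuous_fderiv (by simp)) (hc.fderiv ℝ) z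
  have happ : ∀ e, moll f a τ (fderiv ℝ Φ) z e = ∫ w, f (a • z + τ • w) * fderiv ℝ Φ w e := by
    intro e
    unfold moll
    rw [ContinuousLinearMap.integral_apply hint]
    simp
  have hinte : ∀ e, Integrable (fun w => f (a • z + τ • w) * fderiv ℝ Φ w e) := by
    intro e
    have := hint.apply_continuousLinearMap e
    simpa using this
  have h1 : ∫ w, f (a • z + τ • w) * dbar i Φ w =
      ((∫ w, f (a • z + τ • w) * fderiv ℝ Φ w (Pi.single i 1)) +
        I * ∫ w, f (a • z + τ • w) * fderiv ℝ Φ w (Pi.single i I)) / 2 := by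
    rw [← integral_const_mul, ← integral_add (hinte _) ((hinte _).const_mul I), ← integral_div]
    congr 1; funext w
    simp only [dbar]
    ring
  rw [dbar, (hasFDerivAt_moll hf hfR ha hτ hΦ z).fderiv, smul_apply, smul_apply, happ, happ, h1]
  simp only [real_smul]
  ring

/-- A change of variables which turns the rescaled mollifier into a test function. -/
theorem integral_mul_dbar_mollifier {f : (Fin n → ℂ) → ℂ} {a τ : ℝ} (hτ : 0 < τ) (i : Fin n)
    (z : Fin n → ℂ) :
    ∫ w, f (a • z + τ • w) * dbar i mollifier w =
      |(τ ^ Module.finrank ℝ (Fin n → ℂ))⁻¹| • (τ * ∫ y, f y *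
        dbar i (fun y => mollifier (τ⁻¹ • (y - a • z))) y) := by
  have hd : ∀ y, dbar i (fun y => mollifier (τ⁻¹ • (y - a • z))) y =
      τ⁻¹ * dbar i mollifier (τ⁻¹ • (y - a • z)) := by
    intro y
    have h1 : HasFDerivAt (fun y : Fin n → ℂ => τ⁻¹ • (y - a • z))
        (τ⁻¹ • ContinuousLinearMap.id ℝ (Fin n → ℂ)) y :=
      ((hasFDerivAt_id (𝕜 := ℝ) y).sub_const (a • z)).const_smul τ⁻¹
    have h2 := ((contDiff_mollifier.differentiable (by simp) _).hasFDerivAt.comp y h1).fderiv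
    rw [Function.comp_def] at h2
    rw [dbar, dbar, h2]
    simp only [ContinuousLinearMap.comp_apply, smul_apply, ContinuousLinearMap.id_apply,
      map_smul, real_smul]
    push_cast
    ring
  have h1 : ∀ w, f (a • z + τ • w) * dbar i mollifier w =
      (fun y => f (a • z + y) * dbar i mollifier (τ⁻¹ • y)) (τ • w) := by
    intro w
    simp only [smul_smul, inv_mul_cancel₀ hτ.ne', one_smul]
  rw [integral_congr_ae (Eventually.of_forall h1),
    Measure.integral_comp_smul volume (fun y => f (a • z + y) * dbar i mollifier (τ⁻¹ • y)) τ]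
  congr 1
  have h2 : ∀ y, f (a • z + y) * dbar i mollifier (τ⁻¹ • y) =
      (fun y => f y * dbar i mollifier (τ⁻¹ • (y - a • z))) (a • z + y) := by
    intro y
    simp only [add_sub_cancel_left]
  rw [integral_congr_ae (Eventually.of_forall h2),
    integral_add_left_eq_self (fun y => f y * dbar i mollifier (τ⁻¹ • (y - a • z))),
    ← integral_const_mul]
  congr 1; funext y
  rw [hd]
  have : (τ : ℂ) ≠ 0 := ofReal_ne_zero.2 hτ.ne'
  push_cast
  field_simp

/-- This lets the distributional closedness of `g` be tested against the kernel of the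
mollification, even for `z` slightly outside the polydisc. -/
theorem isTest_mollifier {τ : ℝ} (h0 : 0 < τ) (h1 : τ ≤ 1) {z : Fin n → ℂ}
    (hz : z ∈ polyball n (1 + τ / 2)) :
    IsTest fun y : Fin n → ℂ => mollifier (τ⁻¹ • (y - (1 - τ) • z)) := by
  have hs : tsupport (fun y : Fin n → ℂ => mollifier (τ⁻¹ • (y - (1 - τ) • z))) ⊆
      {y | ‖τ⁻¹ • (y - (1 - τ) • z)‖ ≤ 1 / 2} := by
    refine closure_minimal (fun y hy => ?_) (isClosed_le (by fun_prop) continuous_const)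
    by_contra h
    exact hy (mollifier_eq_zero (not_le.1 h).le)
  have hy : ∀ y : Fin n → ℂ, y = (1 - τ) • z + τ • (τ⁻¹ • (y - (1 - τ) • z)) := by
    intro y
    rw [smul_smul, mul_inv_cancel₀ h0.ne', one_smul, add_sub_cancel]
  have hsub : tsupport (fun y : Fin n → ℂ => mollifier (τ⁻¹ • (y - (1 - τ) • z))) ⊆
      polydisc n := fun y hyt => by
    rw [hy y]
    exact dilate_mem_polydisc h0 h1 hz (hs hyt)
  refine ⟨?_, ?_, hsub⟩
  · exact contDiff_mollifier.comp ((contDiff_id.sub contDiff_const).const_smul _)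
  · refine (isCompact_closedBall (0 : Fin n → ℂ) 1).of_isClosed_subset (isClosed_tsupport _)
      fun y hyt => ?_
    rw [mem_closedBall_zero_iff]
    exact norm_le_one_of_mem_polydisc (hsub hyt)

/-! ### The approximate identity of order `k`. -/

/-- The smallest dilation parameter, divided by `2`. -/
def gap (k : ℕ) : ℝ := node (2 * k + 1) / 2

theorem gap_pos (k : ℕ) : 0 < gap k := half_pos (node_pos _)

theorem gap_le (k : ℕ) : gap k ≤ 1 / 4 := by
  have := node_le (2 * k + 1)
  unfold gap; linarith

theorem two_mul_gap_le {k c : ℕ} (hc : c ∈ Finset.range (2 * k + 2)) : 2 * gap k ≤ node c := by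
  have := node_anti (Nat.lt_succ_iff.1 (Finset.mem_range.1 hc))
  unfold gap; linarith

/-- The approximate identity of order `k` at scale `t`. -/
def lowPass (k : ℕ) (t : ℝ) (f : (Fin n → ℂ) → ℂ) (z : Fin n → ℂ) : ℂ :=
  ∑ c ∈ Finset.range (2 * k + 2), weight k c • moll f (1 - node c * t) (node c * t) mollifier z

section LowPass

variable {k : ℕ} {α : ℝ≥0} {f : (Fin n → ℂ) → ℂ} {N t : ℝ}

theorem node_mul_pos (ht : 0 < t) (c : ℕ) : 0 < node c * t := mul_pos (node_pos c) ht

theorem node_mul_le (ht : 0 < t) (ht1 : t ≤ 1) (c : ℕ) : node c * t ≤ 1 / 2 := by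
  have := node_le c
  have := node_pos c
  nlinarith

theorem one_sub_node_mul_pos (ht : 0 < t) (ht1 : t ≤ 1) (c : ℕ) : 0 < 1 - node c * t := by
  have := node_mul_le ht ht1 c
  linarith

theorem contDiff_lowPass (hf : HolderOn k α f N) (ht : 0 < t) (ht1 : t ≤ 1) :
    ContDiff ℝ ∞ (lowPass k t f) :=
  ContDiff.sum fun c _ => (contDiff_moll hf.integrable (fun _ hy => hf.eq_zero hy)
    (one_sub_node_mul_pos ht ht1 c).ne' (node_mul_pos ht c).ne' contDiff_mollifier).const_smul _

theorem lowPass_add (hf : HolderOn k α f N) {g : (Fin n → ℂ) → ℂ} {N' : ℝ} (hg : HolderOn k α g N')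
    (ht : 0 < t) (z : Fin n → ℂ) :
    lowPass k t (f + g) z = lowPass k t f z + lowPass k t g z := by
  unfold lowPass
  rw [← Finset.sum_add_distrib]
  refine Finset.sum_congr rfl fun c _ => ?_
  rw [← smul_add]
  congr 1
  simp only [moll, Pi.add_apply, add_smul]
  exact integral_add
    (integrable_moll hf.integrable (node_mul_pos ht c).ne' contDiff_mollifier.continuous
      hasCompactSupport_mollifier z)
    (integrable_moll hg.integrable (node_mul_pos ht c).ne' contDiff_mollifier.continuous
      hasCompactSupport_mollifier z)

theorem lowPass_smul (c : ℂ) (z : Fin n → ℂ) : lowPass k t (c • f) z = c * lowPass k t f z := by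
  unfold lowPass
  rw [Finset.mul_sum]
  refine Finset.sum_congr rfl fun l _ => ?_
  have : moll (c • f) (1 - node l * t) (node l * t) mollifier z =
      c * moll f (1 - node l * t) (node l * t) mollifier z := by
    simp only [moll, Pi.smul_apply, smul_eq_mul, mul_assoc]
    exact integral_const_mul _ _
  rw [this, mul_smul_comm]

theorem norm_lowPass_le (hf : HolderOn k α f N) (z : Fin n → ℂ) :
    ‖lowPass k t f z‖ ≤ (∑ c ∈ Finset.range (2 * k + 2), |weight k c|) *
      (N * ∫ w : Fin n → ℂ, ‖mollifier w‖) := by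
  rw [Finset.sum_mul]
  refine (norm_sum_le _ _).trans (Finset.sum_le_sum fun c _ => ?_)
  rw [norm_smul, Real.norm_eq_abs]
  refine mul_le_mul_of_nonneg_left ?_ (abs_nonneg _)
  rw [← integral_const_mul]
  refine norm_integral_le_of_norm_le ((contDiff_mollifier.continuous.integrable_of_hasCompactSupport
    hasCompactSupport_mollifier).norm.const_mul N) (Eventually.of_forall fun w => ?_)
  rw [norm_smul]
  exact mul_le_mul_of_nonneg_right (hf.norm_le _) (norm_nonneg _)

theorem tendsto_moll (hf : HolderOn k α f N) {τ : ℕ → ℝ} (hτ : Tendsto τ atTop (𝓝 0))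
    (hτ0 : ∀ m, τ m ≠ 0)
    {z : Fin n → ℂ} (hz : z ∈ polydisc n) :
    Tendsto (fun m => moll f (1 - τ m) (τ m) mollifier z) atTop (𝓝 (f z)) := by
  have h1 : f z = ∫ w : Fin n → ℂ, f z • mollifier w := by
    simp only [smul_eq_mul]
    rw [integral_const_mul, integral_mollifier, mul_one]
  rw [h1]
  have hcf : ContinuousAt f z :=
    hf.smooth.continuousOn.continuousAt ((isOpen_polydisc n).mem_nhds hz)
  refine tendsto_integral_of_dominated_convergence (fun w => N * ‖mollifier w‖)
    (fun m => (integrable_moll hf.integrable (hτ0 m) contDiff_mollifier.continuous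
      hasCompactSupport_mollifier z).aestronglyMeasurable)
    ((contDiff_mollifier.continuous.integrable_of_hasCompactSupport
      hasCompactSupport_mollifier).norm.const_mul N)
    (fun m => Eventually.of_forall fun w => ?_) (Eventually.of_forall fun w => ?_)
  · rw [norm_smul]
    exact mul_le_mul_of_nonneg_right (hf.norm_le _) (norm_nonneg _)
  · have h2 : Tendsto (fun m => (1 - τ m) • z + τ m • w) atTop (𝓝 z) := by
      have := ((hτ.const_sub 1).smul_const z).add (hτ.smul_const w)
      simpa using this
    exact (hcf.tendsto.comp h2).smul_const (mollifier w)

theorem tendsto_lowPass (hf : HolderOn k α f N) {t : ℕ → ℝ} (ht : Tendsto t atTop (𝓝 0))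
    (ht0 : ∀ m, t m ≠ 0)
    {z : Fin n → ℂ} (hz : z ∈ polydisc n) :
    Tendsto (fun m => lowPass k (t m) f z) atTop (𝓝 (f z)) := by
  have h1 : f z = ∑ c ∈ Finset.range (2 * k + 2), weight k c • f z := by
    -- The moment of order zero: the weights sum to `1`.
    have := sum_weight_mul k (i := 0) (j := 0) (Nat.zero_le _) (Nat.zero_le _)
    simp only [pow_zero, div_one, mul_one, if_true] at this
    rw [← Finset.sum_smul, this, one_smul]
  rw [h1]
  refine tendsto_finsetSum _ fun c _ => (tendsto_moll hf ?_
    (fun m => mul_ne_zero (node_pos c).ne' (ht0 m)) hz).const_smul (weight k c)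
  simpa using ht.const_mul (node c)

end LowPass

end DbarPolydisc

end

noncomputable section

namespace DbarPolydisc

open Complex Filter Topology

variable {n : ℕ}

/-! ### Estimates for the bands -/

/-- The dyadic scales. -/
def scale (m : ℕ) : ℝ := (2 : ℝ)⁻¹ ^ m

theorem scale_pos (m : ℕ) : 0 < scale m := by unfold scale; positivity

theorem scale_le_one (m : ℕ) : scale m ≤ 1 := pow_le_one₀ (by norm_num) (by norm_num)

theorem scale_succ (m : ℕ) : scale m = 2 * scale (m + 1) := by
  rw [scale, scale, pow_succ]; ring

theorem scale_succ_le (m : ℕ) : scale (m + 1) ≤ 1 / 2 := by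
  have := scale_le_one m
  rw [scale_succ] at this; linarith

theorem tendsto_scale : Tendsto scale atTop (𝓝 0) :=
  tendsto_pow_atTop_nhds_zero_of_lt_one (by norm_num) (by norm_num)

/-- The part of a function at the scale `2⁻ᵐ`. -/
def band (k : ℕ) : ℕ → ((Fin n → ℂ) → ℂ) → (Fin n → ℂ) → ℂ
  | 0, f => lowPass k 1 f
  | m + 1, f => fun z => lowPass k (scale (m + 1)) f z - lowPass k (scale m) f z

theorem sum_band (k M : ℕ) (f : (Fin n → ℂ) → ℂ) (z : Fin n → ℂ) :
    ∑ m ∈ Finset.range (M + 1), band k m f z = lowPass k (scale M) f z := by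
  induction M with
  | zero => simp [band, scale]
  | succ M ih => rw [Finset.sum_range_succ, ih, band]; ring

section Band

variable {k : ℕ} {α : ℝ≥0} {f : (Fin n → ℂ) → ℂ} {N : ℝ}

theorem contDiff_band (hf : HolderOn k α f N) (m : ℕ) : ContDiff ℝ ∞ (band k m f) := by
  cases m with
  | zero => exact contDiff_lowPass hf one_pos le_rfl
  | succ m =>
    exact (contDiff_lowPass hf (scale_pos (m + 1)) (scale_le_one (m + 1))).sub
      (contDiff_lowPass hf (scale_pos m) (scale_le_one m))

theorem band_add (hf : HolderOn k α f N) {g : (Fin n → ℂ) → ℂ} {N' : ℝ} (hg : HolderOn k α g N')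
    (m : ℕ) : band k m (f + g) = band k m f + band k m g := by
  funext z
  cases m with
  | zero => exact lowPass_add hf hg one_pos z
  | succ m =>
    simp only [band, Pi.add_apply]
    rw [lowPass_add hf hg (scale_pos _), lowPass_add hf hg (scale_pos _)]
    ring

theorem band_smul (c : ℂ) (m : ℕ) : band k m (c • f) = c • band k m f := by
  funext z
  cases m with
  | zero => exact lowPass_smul c z
  | succ m =>
    simp only [band, Pi.smul_apply, smul_eq_mul]
    rw [lowPass_smul, lowPass_smul]
    ring

theorem hasDerivAt_iteratedFDerivWithin_line (hf : ContDiffOn ℝ k f (polydisc n)) {i : ℕ}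
    (hi : i < k) (z w : Fin n → ℂ) {x : ℝ} (hx : (1 - x) • z + x • w ∈ polydisc n) :
    HasDerivAt
      (fun x : ℝ => iteratedFDerivWithin ℝ i f (polydisc n) ((1 - x) • z + x • w) fun _ => w - z)
      (iteratedFDerivWithin ℝ (i + 1) f (polydisc n) ((1 - x) • z + x • w) fun _ => w - z) x := by
  have ho := isOpen_polydisc n
  have hl : HasDerivAt (fun x : ℝ => (1 - x) • z + x • w) (w - z) x := by
    have h1 := (((hasDerivAt_id x).const_sub 1).smul_const z).add
      ((hasDerivAt_id x).smul_const w)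
    refine h1.congr_deriv ?_
    simp only [neg_smul, one_smul]
    abel
  have hd : DifferentiableAt ℝ (iteratedFDerivWithin ℝ i f (polydisc n)) ((1 - x) • z + x • w) :=
    ((hf.differentiableOn_iteratedFDerivWithin (by exact_mod_cast hi) ho.uniqueDiffOn) _
      hx).differentiableAt (ho.mem_nhds hx)
  have h2 := hd.hasFDerivAt.comp_hasDerivAt x hl
  have h3 := ((ContinuousMultilinearMap.apply ℝ (fun _ : Fin i => Fin n → ℂ) ℂ
    (fun _ => w - z)).hasFDerivAt.comp_hasDerivAt x h2)
  refine h3.congr_deriv ?_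
  rw [iteratedFDerivWithin_succ_apply_left, fderivWithin_of_isOpen ho hx]
  rfl

/-- The approximation of `f` by polynomials along a segment. -/
theorem HolderOn.exists_polynomial (hf : HolderOn k α f N) (hα1 : α ≤ 1) {a t : ℝ} (ha : 0 < a)
    (hat : a ≤ t) (ht1 : t ≤ 1) {z w : Fin n → ℂ} (hz : z ∈ polyball n (1 + a / 2))
    (hw : ‖w‖ ≤ 1 / 2) :
    ∃ p : Polynomial ℂ, p.natDegree ≤ k ∧ ∀ x ∈ Set.Icc a t,
      ‖f ((1 - x) • z + x • w) - p.eval (x : ℂ)‖ ≤ 3 ^ (k + 1) * N * (t ^ k * t ^ (α : ℝ)) := by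
  have hN := hf.nonneg
  -- The parameter stays above `a > 0`: at `x = 0` the segment starts at `z`, which may lie outside
  -- the polydisc.
  have hmem : ∀ x ∈ Set.Icc a t, (1 - x) • z + x • w ∈ polydisc n := fun x hx =>
    dilate_mem_polydisc (ha.trans_le hx.1) (hx.2.trans ht1)
      (polyball_mono (by linarith [hx.1]) hz) hw
  have hzn : ‖z‖ ≤ 3 / 2 := by
    rw [pi_norm_le_iff_of_nonneg (by norm_num)]
    intro i
    linarith [hz i]
  have hwz : ‖w - z‖ ≤ 3 := (norm_sub_le _ _).trans (by linarith)
  have ht : 0 < t := ha.trans_le hat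
  -- The factor `3^k` comes from evaluating the `k`-th derivative on copies of `w - z`, and one more
  -- `3` bounds `‖w - z‖ ^ α`.
  obtain ⟨p, hp, hp'⟩ := exists_taylor_polynomial (A := 3 ^ (k + 1) * N * t ^ (α : ℝ)) hat k
    (q := fun i x =>
      iteratedFDerivWithin ℝ i f (polydisc n) ((1 - x) • z + x • w) fun _ => w - z)
    (fun i hi x hx =>
      (hasDerivAt_iteratedFDerivWithin_line hf.smooth hi z w (hmem x hx)).hasDerivWithinAt) (by
    intro x hx
    have h1 := hf.holder _ (hmem x hx) _ (hmem a (Set.left_mem_Icc.2 hat))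
    have h2 : (1 - x) • z + x • w - ((1 - a) • z + a • w) = (x - a) • (w - z) := by
      simp only [sub_smul, smul_sub, one_smul]; abel
    rw [h2, norm_smul, Real.norm_of_nonneg (sub_nonneg.2 hx.1)] at h1
    have h3 : ((x - a) * ‖w - z‖) ^ (α : ℝ) ≤ 3 * t ^ (α : ℝ) := by
      calc ((x - a) * ‖w - z‖) ^ (α : ℝ) ≤ (t * 3) ^ (α : ℝ) := by
            refine Real.rpow_le_rpow (mul_nonneg (sub_nonneg.2 hx.1) (norm_nonneg _)) ?_ α.2
            exact mul_le_mul (by linarith [hx.2]) hwz (norm_nonneg _) ht.le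
        _ = 3 ^ (α : ℝ) * t ^ (α : ℝ) := by
            rw [Real.mul_rpow ht.le (by norm_num), mul_comm]
        _ ≤ 3 * t ^ (α : ℝ) := by
            refine mul_le_mul_of_nonneg_right ?_ (Real.rpow_nonneg ht.le _)
            exact (Real.rpow_le_rpow_of_exponent_le (by norm_num)
              (by exact_mod_cast hα1)).trans_eq (Real.rpow_one 3)
    rw [← sub_apply]
    refine (ContinuousMultilinearMap.le_opNorm _ _).trans ?_
    simp only [Finset.prod_const, Finset.card_univ, Fintype.card_fin]
    calc _ ≤ (N * (3 * t ^ (α : ℝ))) * 3 ^ k :=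
          mul_le_mul (h1.trans (mul_le_mul_of_nonneg_left h3 hN))
            (pow_le_pow_left₀ (norm_nonneg _) hwz k) (by positivity) (by positivity)
      _ = _ := by ring)
  refine ⟨p, hp, fun x hx => ?_⟩
  have h1 := hp' x hx
  simp only [iteratedFDerivWithin_zero_apply] at h1
  refine h1.trans ?_
  rw [mul_assoc (3 ^ (k + 1) * N), mul_comm (t ^ k)]
  refine mul_le_mul_of_nonneg_left (mul_le_mul_of_nonneg_left ?_ (Real.rpow_nonneg ht.le _))
    (by positivity)
  exact pow_le_pow_left₀ (by linarith) (by linarith) k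

/-- The sum of the absolute values of the weights. -/
def weightSum (k : ℕ) : ℝ := ∑ c ∈ Finset.range (2 * k + 2), |weight k c|

theorem weightSum_nonneg (k : ℕ) : 0 ≤ weightSum k := Finset.sum_nonneg fun _ _ => abs_nonneg _

theorem abs_neg_div_pow_le {a x : ℝ} (ha : 0 < a) (hx : a ≤ x) (hx1 : x ≤ 1) (j : ℕ) :
    |(-((1 - x) / x)) ^ j| ≤ a⁻¹ ^ j := by
  have hx0 : 0 < x := ha.trans_le hx
  rw [abs_pow, abs_neg, abs_of_nonneg (div_nonneg (sub_nonneg.2 hx1) hx0.le)]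
  refine pow_le_pow_left₀ (div_nonneg (sub_nonneg.2 hx1) hx0.le) ?_ j
  rw [div_eq_mul_inv]
  refine (mul_le_of_le_one_left (inv_nonneg.2 hx0.le) (by linarith)).trans (inv_anti₀ ha hx)

theorem norm_sum_weight_sub_le {a t E : ℝ} {q : ℝ → ℂ} {p : Polynomial ℂ} {s : ℝ} {j : ℕ}
    (ha : 0 < a) (ht1 : t ≤ 1) (hs : ∀ c ∈ Finset.range (2 * k + 2), node c * s ∈ Set.Icc a t)
    (hE : ∀ x ∈ Set.Icc a t, ‖q x - p.eval (x : ℂ)‖ ≤ E) :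
    ‖∑ c ∈ Finset.range (2 * k + 2),
      (weight k c * (-((1 - node c * s) / (node c * s))) ^ j) • q (node c * s) -
      ∑ c ∈ Finset.range (2 * k + 2),
      ((weight k c * (-((1 - node c * s) / (node c * s))) ^ j : ℝ) : ℂ) *
        p.eval ((node c * s : ℝ) : ℂ)‖ ≤ weightSum k * (a⁻¹ ^ j * E) := by
  rw [← Finset.sum_sub_distrib, weightSum, Finset.sum_mul]
  refine (norm_sum_le _ _).trans (Finset.sum_le_sum fun c hc => ?_)
  rw [real_smul, ← mul_sub, norm_mul, norm_real, Real.norm_eq_abs, abs_mul, mul_assoc]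
  refine mul_le_mul_of_nonneg_left ?_ (abs_nonneg _)
  exact mul_le_mul (abs_neg_div_pow_le ha (hs c hc).1 ((hs c hc).2.trans ht1) j)
    (hE _ (hs c hc)) (norm_nonneg _) (by positivity)

/-- The cancellation between consecutive scales. -/
theorem HolderOn.norm_sum_sub_sum_le (hf : HolderOn k α f N) (hα1 : α ≤ 1) {t : ℝ} (ht : 0 < t)
    (ht1 : t ≤ 1 / 2) {j : ℕ} (hj : j ≤ k + 1) {z w : Fin n → ℂ}
    (hz : z ∈ polyball n (1 + gap k * t)) (hw : ‖w‖ ≤ 1 / 2) :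
    ‖∑ c ∈ Finset.range (2 * k + 2), (weight k c * (-((1 - node c * t) / (node c * t))) ^ j) •
        f ((1 - node c * t) • z + (node c * t) • w) -
      ∑ c ∈ Finset.range (2 * k + 2),
        (weight k c * (-((1 - node c * (2 * t)) / (node c * (2 * t)))) ^ j) •
          f ((1 - node c * (2 * t)) • z + (node c * (2 * t)) • w)‖ ≤
      2 * (weightSum k * ((2 * gap k * t)⁻¹ ^ j * (3 ^ (k + 1) * N * (t ^ k * t ^ (α : ℝ))))) := by
  have hg := gap_pos k
  have hg1 := gap_le k
  have ha : 0 < 2 * gap k * t := by positivity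
  have hat : 2 * gap k * t ≤ t := by nlinarith
  -- One polynomial serves both scales: since the nodes lie in `[2 gap, 1/2]`, the parameters for
  -- `t` and for `2 t` all lie in `[2 gap t, t]`.
  obtain ⟨p, hp, hpE⟩ := hf.exists_polynomial hα1 ha hat (by linarith) (z := z) (w := w)
    (polyball_mono (by linarith) hz) hw
  have hs1 : ∀ c ∈ Finset.range (2 * k + 2), node c * t ∈ Set.Icc (2 * gap k * t) t :=
    fun c hc => ⟨mul_le_mul_of_nonneg_right (two_mul_gap_le hc) ht.le, by
      have := node_le c; nlinarith⟩
  have hs2 : ∀ c ∈ Finset.range (2 * k + 2), node c * (2 * t) ∈ Set.Icc (2 * gap k * t) t :=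
    fun c hc => ⟨by have := two_mul_gap_le hc; nlinarith, by
      have := node_le c; nlinarith⟩
  have b1 := norm_sum_weight_sub_le (q := fun x => f ((1 - x) • z + x • w)) (j := j) ha
    (by linarith) hs1 hpE
  have b2 := norm_sum_weight_sub_le (q := fun x => f ((1 - x) • z + x • w)) (j := j) ha
    (by linarith) hs2 hpE
  rw [sum_weight_mul_eval k hj ht.ne' p hp] at b1
  rw [sum_weight_mul_eval k hj (by positivity) p hp] at b2
  rw [← sub_sub_sub_cancel_right _ _ (((Polynomial.X - 1) ^ j * p).coeff j)]
  exact (norm_sub_le _ _).trans ((add_le_add b1 b2).trans_eq (two_mul _).symm)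

theorem integral_norm_mul_iteratedFDeriv_le {S : (Fin n → ℂ) → ℂ} {E : ℝ}
    (hE : ∀ w, ‖w‖ ≤ 1 / 2 → ‖S w‖ ≤ E) (j : ℕ) :
    ∫ w, ‖S w‖ * ‖iteratedFDeriv ℝ j mollifier w‖ ≤
      E * ∫ w : Fin n → ℂ, ‖iteratedFDeriv ℝ j mollifier w‖ := by
  have hj : (j : ℕ∞ω) ≤ (∞ : ℕ∞ω) := by exact_mod_cast le_top
  rw [← integral_const_mul]
  refine integral_mono_of_nonneg (Eventually.of_forall fun w => by positivity)
    ((((contDiff_mollifier.continuous_iteratedFDeriv hj).norm).integrable_of_hasCompactSupport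
      (hasCompactSupport_mollifier.iteratedFDeriv j).norm).const_mul E)
    (Eventually.of_forall fun w => ?_)
  by_cases hw : ‖w‖ ≤ 1 / 2
  · exact mul_le_mul_of_nonneg_right (hE w hw) (norm_nonneg _)
  · have : iteratedFDeriv ℝ j mollifier w = 0 := image_eq_zero_of_notMem_tsupport fun h =>
      hw (mem_closedBall_zero_iff.1 (tsupport_mollifier_subset (tsupport_iteratedFDeriv_subset j h)))
    simp only [this, norm_zero, mul_zero, le_refl]

/-- Derivatives are thrown on the mollifier, with a factor of order `1 / scale m` each, and the
combination of values of `f` that remains is only of size `scale m ^ (k + α)` by the polynomial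
cancellation. The order `j = k + 1`, one more than `f` possesses, is the one that yields Hölder
continuity later. -/
theorem exists_norm_iteratedFDeriv_band_le (n k : ℕ) {j : ℕ} (hj : j ≤ k + 1) :
    ∃ C : ℝ, 0 ≤ C ∧ ∀ {α : ℝ≥0} {f : (Fin n → ℂ) → ℂ} {N : ℝ}, α ≤ 1 → HolderOn k α f N →
    ∀ (m : ℕ), ∀ z ∈ polyball n (1 + gap k * scale m), ‖iteratedFDeriv ℝ j (band k m f) z‖ ≤
      C * N * (scale m ^ k * scale m ^ (α : ℝ) * (scale m)⁻¹ ^ j) := by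
  set A : ℝ := ∫ w : Fin n → ℂ, ‖iteratedFDeriv ℝ j mollifier w‖ with hA
  have hA0 : 0 ≤ A := integral_nonneg fun _ => norm_nonneg _
  have hW := weightSum_nonneg k
  have hg := gap_pos k
  have hg1 := gap_le k
  refine ⟨2 * weightSum k * (2 * gap k)⁻¹ ^ j * 3 ^ (k + 1) * A, by positivity, ?_⟩
  intro α f N hα1 hf m z hz
  have hN := hf.nonneg
  cases m with
  | zero =>
    -- At scale one there is no cancellation to exploit and the supremum bound suffices.
    have h := norm_iteratedFDeriv_sum_moll_le hf.integrable (fun _ hy => hf.eq_zero hy)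
      (Finset.range (2 * k + 2)) (a := fun c => 1 - node c * 1) (τ := fun c => node c * 1)
      (fun c _ => (one_sub_node_mul_pos one_pos le_rfl c).ne') (fun c _ => (node_mul_pos one_pos c).ne')
      j (weight k) z contDiff_mollifier hasCompactSupport_mollifier
    refine h.trans ((integral_norm_mul_iteratedFDeriv_le
      (E := weightSum k * ((2 * gap k)⁻¹ ^ j * N)) (fun w _ => ?_) j).trans ?_)
    · rw [weightSum, Finset.sum_mul]
      refine (norm_sum_le _ _).trans (Finset.sum_le_sum fun c hc => ?_)
      rw [norm_smul, Real.norm_eq_abs, abs_mul, mul_assoc]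
      refine mul_le_mul_of_nonneg_left ?_ (abs_nonneg _)
      refine mul_le_mul (abs_neg_div_pow_le (by positivity) ?_ ?_ j) (hf.norm_le _)
        (norm_nonneg _) (by positivity)
      · rw [mul_one]; exact two_mul_gap_le hc
      · have := node_le c; linarith
    · simp only [scale, pow_zero, one_pow, Real.one_rpow, inv_one, mul_one]
      have h3 : (1 : ℝ) ≤ 2 * 3 ^ (k + 1) := by
        have : (1 : ℝ) ≤ 3 ^ (k + 1) := one_le_pow₀ (by norm_num)
        linarith
      calc _ = weightSum k * (2 * gap k)⁻¹ ^ j * A * N * 1 := by ring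
        _ ≤ weightSum k * (2 * gap k)⁻¹ ^ j * A * N * (2 * 3 ^ (k + 1)) :=
            mul_le_mul_of_nonneg_left h3 (by positivity)
        _ = _ := by ring
  | succ m =>
    set t := scale (m + 1) with ht
    have ht0 : 0 < t := scale_pos _
    have ht1 : t ≤ 1 / 2 := scale_succ_le m
    -- The difference of two scales is written as a single sum: `x.1 = 0` is the scale `t` with sign
    -- `+`, and `x.1 = 1` the scale `2 t` with sign `-`.
    have h := norm_iteratedFDeriv_sum_moll_le hf.integrable (fun _ hy => hf.eq_zero hy)
      (Finset.range 2 ×ˢ Finset.range (2 * k + 2))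
      (a := fun x => 1 - node x.2 * ((x.1 + 1) * t)) (τ := fun x => node x.2 * ((x.1 + 1) * t))
      (fun x hx => ?_) (fun x _ => ?_)
      j (fun x => (-1) ^ x.1 * weight k x.2) z contDiff_mollifier hasCompactSupport_mollifier
    · have e : band k (m + 1) f = fun z => ∑ x ∈ Finset.range 2 ×ˢ Finset.range (2 * k + 2),
          ((-1) ^ x.1 * weight k x.2) • moll f (1 - node x.2 * ((x.1 + 1) * t))
            (node x.2 * ((x.1 + 1) * t)) mollifier z := by
        funext z
        rw [Finset.sum_product, Finset.sum_range_succ, Finset.sum_range_one]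
        simp only [band, lowPass, scale_succ m, ← ht]
        norm_num
        ring
      rw [e]
      refine h.trans ((integral_norm_mul_iteratedFDeriv_le (E := 2 * (weightSum k *
        ((2 * gap k * t)⁻¹ ^ j * (3 ^ (k + 1) * N * (t ^ k * t ^ (α : ℝ))))))
        (fun w hw => ?_) j).trans_eq ?_)
      · have := hf.norm_sum_sub_sum_le hα1 ht0 ht1 hj hz hw
        refine le_of_eq_of_le ?_ this
        congr 1
        rw [Finset.sum_product, Finset.sum_range_succ, Finset.sum_range_one, sub_eq_add_neg,
          ← Finset.sum_neg_distrib]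
        norm_num
      · rw [← hA, mul_inv, mul_pow]
        ring
    · rw [Finset.mem_product, Finset.mem_range] at hx
      have h1 : (x.1 : ℝ) ≤ 1 := by exact_mod_cast Nat.lt_succ_iff.1 hx.1
      have h2 := node_le x.2
      have h3 := node_pos x.2
      have h4 : ((x.1 : ℝ) + 1) * t ≤ 1 := by nlinarith
      have h5 : 0 ≤ ((x.1 : ℝ) + 1) * t := by positivity
      have h6 : node x.2 * ((x.1 + 1) * t) ≤ 1 / 2 := by nlinarith
      linarith
    · have h3 := node_pos x.2
      positivity

end Band

/-! ### Closedness of the bands -/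

/-- For each node `∂̄ᵢ` falls on the mollifier with the same real factor for all `i` and `j`, and
what remains is the distributional closedness of `g` tested on a translated, rescaled mollifier. -/
theorem isSmoothClosed_lowPass {k : ℕ} {α : ℝ≥0} {g : Form n k α} (hg : IsDbarClosed g) {N t : ℝ}
    (hN : ∀ i, HolderOn k α (zeroExt (g i : polydisc n → ℂ)) N) (ht : 0 < t) (ht1 : t ≤ 1) :
    IsSmoothClosed (1 + gap k * t) fun i => lowPass k t (zeroExt (g i : polydisc n → ℂ)) := by
  refine ⟨fun i => contDiff_lowPass (hN i) ht ht1, fun i j z hz => ?_⟩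
  have hd : ∀ i j, dbar i (lowPass k t (zeroExt (g j : polydisc n → ℂ))) z =
      ∑ c ∈ Finset.range (2 * k + 2), weight k c • dbar i
        (moll (zeroExt (g j : polydisc n → ℂ)) (1 - node c * t) (node c * t) mollifier) z := by
    intro i j
    have hdiff : ∀ c ∈ Finset.range (2 * k + 2), HasFDerivAt
        (fun z => weight k c • moll (zeroExt (g j : polydisc n → ℂ)) (1 - node c * t) (node c * t)
          mollifier z) (weight k c • fderiv ℝ (moll (zeroExt (g j : polydisc n → ℂ))
            (1 - node c * t) (node c * t) mollifier) z) z := fun c _ =>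
      (((contDiff_moll (hN j).integrable (fun _ hy => (hN j).eq_zero hy)
        (one_sub_node_mul_pos ht ht1 c).ne' (node_mul_pos ht c).ne'
        contDiff_mollifier).differentiable (by simp) z).hasFDerivAt).const_smul (weight k c)
    have h1 : HasFDerivAt (lowPass k t (zeroExt (g j : polydisc n → ℂ))) _ z :=
      HasFDerivAt.fun_sum hdiff
    rw [dbar, h1.fderiv]
    simp only [sum_apply, smul_apply, dbar, real_smul]
    rw [Finset.mul_sum, ← Finset.sum_add_distrib, Finset.sum_div]
    refine Finset.sum_congr rfl fun c _ => ?_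
    ring
  rw [hd, hd]
  refine Finset.sum_congr rfl fun c hc => ?_
  have hτ := node_mul_pos ht c
  have hτ1 : node c * t ≤ 1 := (node_mul_le ht ht1 c).trans (by norm_num)
  have hz' : z ∈ polyball n (1 + node c * t / 2) := by
    refine polyball_mono ?_ hz
    have := two_mul_gap_le hc
    nlinarith
  have h1 : ContDiff ℝ 1 (mollifier (n := n)) := contDiff_mollifier.of_le (by exact_mod_cast le_top)
  have ha := (one_sub_node_mul_pos ht ht1 c).ne'
  rw [dbar_moll (hN j).integrable (fun _ hy => (hN j).eq_zero hy) ha hτ.ne' h1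
      hasCompactSupport_mollifier,
    dbar_moll (hN i).integrable (fun _ hy => (hN i).eq_zero hy) ha hτ.ne' h1
      hasCompactSupport_mollifier, integral_mul_dbar_mollifier hτ, integral_mul_dbar_mollifier hτ,
    hg _ (isTest_mollifier hτ hτ1 hz') i j]

theorem isSmoothClosed_band {k : ℕ} {α : ℝ≥0} {g : Form n k α} (hg : IsDbarClosed g) {N : ℝ}
    (hN : ∀ i, HolderOn k α (zeroExt (g i : polydisc n → ℂ)) N) (m : ℕ) :
    IsSmoothClosed (1 + gap k * scale m) fun i => band k m (zeroExt (g i : polydisc n → ℂ)) := by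
  cases m with
  | zero =>
    have h := isSmoothClosed_lowPass hg hN one_pos le_rfl
    simpa [scale, band] using h
  | succ m =>
    have h1 := isSmoothClosed_lowPass hg hN (scale_pos (m + 1)) (scale_le_one _)
    have h2 := isSmoothClosed_lowPass hg hN (scale_pos m) (scale_le_one _)
    refine ⟨fun i => contDiff_band (hN i) (m + 1), fun i j z hz => ?_⟩
    have hz2 : z ∈ polyball n (1 + gap k * scale m) := by
      refine polyball_mono ?_ hz
      have := gap_pos k
      have := scale_pos (m + 1)
      rw [scale_succ m]
      nlinarith [mul_pos (gap_pos k) (scale_pos (m + 1))]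
    simp only [band]
    rw [dbar_sub ((h1.smooth j).differentiable (by simp) z) ((h2.smooth j).differentiable (by simp) z),
      dbar_sub ((h1.smooth i).differentiable (by simp) z) ((h2.smooth i).differentiable (by simp) z),
      h1.closed i j z hz, h2.closed i j z hz2]

end DbarPolydisc

end

noncomputable section

namespace DbarPolydisc

open Complex Filter Topology

variable {n : ℕ}

/-! ### Series of functions with dyadic bounds -/

theorem scale_rpow (α : ℝ) (m : ℕ) : scale m ^ α = ((2 : ℝ)⁻¹ ^ α) ^ m :=
  (Real.rpow_pow_comm (by norm_num) α m).symm

theorem summable_scale_rpow {α : ℝ} (hα : 0 < α) : Summable fun m => scale m ^ α := by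
  simp only [scale_rpow]
  exact summable_geometric_of_lt_one (by positivity) (Real.rpow_lt_one (by norm_num) (by norm_num) hα)

/-- Split at the first scale not exceeding `δ`. Over the coarser scales the bound with `δ` is a
geometric series of ratio `2^(1-α) > 1`, over the finer ones the other bound has ratio `2^(-α) < 1`;
both are comparable to their term at scale `δ`, namely `δ ^ α`. -/
theorem exists_tsum_le_rpow {α : ℝ} (hα0 : 0 < α) (hα1 : α < 1) : ∃ C : ℝ, 0 ≤ C ∧
    ∀ {δ : ℝ} {b : ℕ → ℝ}, 0 < δ → (∀ m, 0 ≤ b m) → (∀ m, b m ≤ 2 * scale m ^ α) →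
      (∀ m, b m ≤ scale m ^ α * (scale m)⁻¹ * δ) → ∑' m, b m ≤ C * δ ^ α := by
  set q : ℝ := (2 : ℝ)⁻¹ ^ α with hq
  have hq0 : 0 < q := by positivity
  have hq1 : q < 1 := Real.rpow_lt_one (by norm_num) (by norm_num) hα0
  have hs1 : 1 < 2 * q := by
    have : (2 : ℝ)⁻¹ ^ (1 : ℝ) < (2 : ℝ)⁻¹ ^ α :=
      Real.rpow_lt_rpow_of_exponent_gt (by norm_num) (by norm_num) hα1
    rw [Real.rpow_one, ← hq] at this
    linarith
  have hs : ∀ m, scale m ^ α * (scale m)⁻¹ = (2 * q) ^ m := fun m => by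
    rw [scale_rpow, scale, mul_pow, inv_pow, inv_inv, mul_comm]
  have c1 : 0 < 2 * q - 1 := by linarith
  have c2 : 0 < 1 - q := by linarith
  refine ⟨2 * q / (2 * q - 1) + 2 / (1 - q), by positivity, ?_⟩
  intro δ b hδ hb0 hb1 hb2
  have hbs : Summable b := Summable.of_nonneg_of_le hb0 hb1
    ((summable_scale_rpow hα0).mul_left 2)
  have hex : ∃ m, scale m ≤ δ := by
    obtain ⟨m, hm⟩ := exists_pow_lt_of_lt_one hδ (by norm_num : (2 : ℝ)⁻¹ < 1)
    exact ⟨m, hm.le⟩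
  classical
  set M := Nat.find hex with hM
  have hMle : scale M ≤ δ := Nat.find_spec hex
  rw [← hbs.sum_add_tsum_nat_add M, add_mul]
  refine add_le_add ?_ ?_
  · rcases Nat.eq_zero_or_pos M with h0 | h0
    · rw [h0, Finset.sum_range_zero]; positivity
    · obtain ⟨M', hM'⟩ : ∃ M', M = M' + 1 := ⟨M - 1, by omega⟩
      have hlt : δ < scale M' := not_le.1 (Nat.find_min hex (m := M') (by omega))
      have h1 : ∑ m ∈ Finset.range M, b m ≤ (2 * q) ^ M / (2 * q - 1) * δ := by
        calc ∑ m ∈ Finset.range M, b m ≤ ∑ m ∈ Finset.range M, (2 * q) ^ m * δ :=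
              Finset.sum_le_sum fun m _ => (hb2 m).trans_eq (by rw [hs])
          _ = ((2 * q) ^ M - 1) / (2 * q - 1) * δ := by
              rw [← Finset.sum_mul, geom_sum_eq hs1.ne']
          _ ≤ (2 * q) ^ M / (2 * q - 1) * δ := by
              gcongr
              linarith
      refine h1.trans ?_
      have h2 : (2 * q) ^ M' * δ ≤ δ ^ α := by
        rw [← hs, ← div_eq_mul_inv, ← Real.rpow_sub_one (scale_pos _).ne']
        have h3 : scale M' ^ (α - 1) ≤ δ ^ (α - 1) :=
          Real.rpow_le_rpow_of_nonpos hδ hlt.le (by linarith)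
        calc scale M' ^ (α - 1) * δ ≤ δ ^ (α - 1) * δ := mul_le_mul_of_nonneg_right h3 hδ.le
          _ = δ ^ α := by
            rw [Real.rpow_sub_one hδ.ne']; field_simp
      calc (2 * q) ^ M / (2 * q - 1) * δ = 2 * q / (2 * q - 1) * ((2 * q) ^ M' * δ) := by
            rw [hM', pow_succ]; ring
        _ ≤ _ := mul_le_mul_of_nonneg_left h2 (by positivity)
  · have h1 : ∑' m, b (m + M) ≤ ∑' m, 2 * q ^ M * q ^ m := by
      refine Summable.tsum_le_tsum (fun m => (hb1 (m + M)).trans_eq ?_)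
        ((summable_nat_add_iff M).2 hbs)
        ((summable_geometric_of_lt_one hq0.le hq1).mul_left _)
      rw [scale_rpow, pow_add]; ring
    refine h1.trans ?_
    rw [tsum_mul_left, tsum_geometric_of_lt_one hq0.le hq1]
    have h2 : q ^ M ≤ δ ^ α := by
      rw [hq, ← scale_rpow]
      exact Real.rpow_le_rpow (scale_pos _).le hMle hα0.le
    calc 2 * q ^ M * (1 - q)⁻¹ = 2 / (1 - q) * q ^ M := by ring
      _ ≤ _ := mul_le_mul_of_nonneg_left h2 (by positivity)

theorem convex_polydisc (n : ℕ) : Convex ℝ (polydisc n) := by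
  rw [polydisc_eq_pi]
  exact convex_pi fun _ _ => convex_ball 0 1

/-- Smooth functions whose derivatives satisfy dyadic bounds on the polydisc. -/
structure IsDyadic (k : ℕ) (α : ℝ≥0) (U : ℕ → (Fin n → ℂ) → ℂ) (A : ℝ) : Prop where
  smooth : ∀ m, ContDiff ℝ ∞ (U m)
  bound : ∀ j ≤ k + 1, ∀ m, ∀ z ∈ polydisc n, ‖iteratedFDeriv ℝ j (U m) z‖ ≤
    A * (scale m ^ k * scale m ^ (α : ℝ) * (scale m)⁻¹ ^ j)

namespace IsDyadic

variable {k : ℕ} {α : ℝ≥0} {U : ℕ → (Fin n → ℂ) → ℂ} {A : ℝ}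

theorem nonneg (h : IsDyadic k α U A) : 0 ≤ A := by
  have := (norm_nonneg _).trans (h.bound 0 (Nat.zero_le _) 0 0 zero_mem_polydisc)
  simpa [scale] using this

theorem norm_le (h : IsDyadic k α U A) {j : ℕ} (hj : j ≤ k) (m : ℕ) {z : Fin n → ℂ}
    (hz : z ∈ polydisc n) : ‖iteratedFDeriv ℝ j (U m) z‖ ≤ A * scale m ^ (α : ℝ) := by
  refine (h.bound j (hj.trans (Nat.le_succ k)) m z hz).trans
    (mul_le_mul_of_nonneg_left ?_ h.nonneg)
  have ht := scale_pos m
  have h1 : scale m ^ k * (scale m)⁻¹ ^ j ≤ 1 := by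
    rw [inv_pow, ← div_eq_mul_inv, div_le_one (by positivity)]
    exact pow_le_pow_of_le_one ht.le (scale_le_one m) hj
  calc _ = scale m ^ k * (scale m)⁻¹ ^ j * scale m ^ (α : ℝ) := by ring
    _ ≤ 1 * scale m ^ (α : ℝ) := mul_le_mul_of_nonneg_right h1 (by positivity)
    _ = _ := one_mul _

theorem summable_bound (hα : 0 < α) : Summable fun m => A * scale m ^ (α : ℝ) :=
  (summable_scale_rpow (by exact_mod_cast hα)).mul_left A

theorem summable (h : IsDyadic k α U A) (hα : 0 < α) {j : ℕ} (hj : j ≤ k) {z : Fin n → ℂ}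
    (hz : z ∈ polydisc n) : Summable fun m => iteratedFDeriv ℝ j (U m) z :=
  Summable.of_norm_bounded (summable_bound hα) fun m => h.norm_le hj m hz

/-- Up to order `k` the derivatives are dominated by the summable `A * scale m ^ α`, so the series
may be differentiated term by term on the convex polydisc. -/
theorem hasFTaylorSeriesUpToOn (h : IsDyadic k α U A) (hα : 0 < α) :
    HasFTaylorSeriesUpToOn k (fun z => ∑' m, U m z) (fun z j => ∑' m, iteratedFDeriv ℝ j (U m) z)
      (polydisc n) := by
  have hd : ∀ (j m : ℕ) z, HasFDerivAt (iteratedFDeriv ℝ j (U m))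
      (iteratedFDeriv ℝ (j + 1) (U m) z).curryLeft z := by
    intro j m z
    have h1 : DifferentiableAt ℝ (iteratedFDeriv ℝ j (U m)) z :=
      ((h.smooth m).differentiable_iteratedFDeriv (by exact_mod_cast WithTop.coe_lt_top j)) z
    refine h1.hasFDerivAt.congr_fderiv ?_
    ext v w
    simp only [ContinuousMultilinearMap.curryLeft_apply, iteratedFDeriv_succ_apply_left,
      Fin.cons_zero, Fin.tail_cons]
  refine ⟨fun z hz => ?_, fun j hj z hz => ?_, fun j hj => ?_⟩
  · exact (continuousMultilinearCurryFin0 ℝ (Fin n → ℂ) ℂ).toContinuousLinearEquiv.map_tsum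
  · have hj' : j < k := by exact_mod_cast hj
    have h1 := hasFDerivAt_tsum_of_isPreconnected (summable_bound (A := A) hα) (isOpen_polydisc n)
      (convex_polydisc n).isPreconnected (fun m z _ => hd j m z)
      (fun m z hz => by
        rw [ContinuousMultilinearMap.curryLeft_norm]
        exact h.norm_le (Nat.succ_le_of_lt hj') m hz)
      hz (h.summable hα hj'.le hz) hz
    refine (h1.congr_fderiv ?_).hasFDerivWithinAt
    exact ((continuousMultilinearCurryLeftEquiv ℝ (fun _ : Fin (j + 1) => Fin n → ℂ)
      ℂ).toContinuousLinearEquiv.map_tsum).symm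
  · have hj' : j ≤ k := by exact_mod_cast hj
    exact continuousOn_tsum (fun m => ((h.smooth m).continuous_iteratedFDeriv
      (by exact_mod_cast le_top)).continuousOn) (summable_bound (A := A) hα)
      fun m z hz => h.norm_le hj' m hz

theorem contDiffOn (h : IsDyadic k α U A) (hα : 0 < α) :
    ContDiffOn ℝ k (fun z => ∑' m, U m z) (polydisc n) :=
  (h.hasFTaylorSeriesUpToOn hα).contDiffOn

theorem iteratedFDerivWithin_eq (h : IsDyadic k α U A) (hα : 0 < α) {j : ℕ} (hj : j ≤ k)
    {z : Fin n → ℂ} (hz : z ∈ polydisc n) :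
    iteratedFDerivWithin ℝ j (fun z => ∑' m, U m z) (polydisc n) z =
      ∑' m, iteratedFDeriv ℝ j (U m) z :=
  ((h.hasFTaylorSeriesUpToOn hα).eq_iteratedFDerivWithin_of_uniqueDiffOn (by exact_mod_cast hj)
    (isOpen_polydisc n).uniqueDiffOn hz).symm

theorem norm_iteratedFDerivWithin_le (h : IsDyadic k α U A) (hα : 0 < α) {j : ℕ} (hj : j ≤ k)
    {z : Fin n → ℂ} (hz : z ∈ polydisc n) :
    ‖iteratedFDerivWithin ℝ j (fun z => ∑' m, U m z) (polydisc n) z‖ ≤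
      A * ∑' m, scale m ^ (α : ℝ) := by
  rw [h.iteratedFDerivWithin_eq hα hj hz, ← tsum_mul_left]
  exact tsum_of_norm_bounded (summable_bound hα).hasSum fun m => h.norm_le hj m hz

theorem norm_sub_le (h : IsDyadic k α U A) (m : ℕ) {x y : Fin n → ℂ} (hx : x ∈ polydisc n)
    (hy : y ∈ polydisc n) : ‖iteratedFDeriv ℝ k (U m) x - iteratedFDeriv ℝ k (U m) y‖ ≤
      A * (scale m ^ (α : ℝ) * (scale m)⁻¹ * ‖x - y‖) := by
  have hd : ∀ z ∈ polydisc n, DifferentiableAt ℝ (iteratedFDeriv ℝ k (U m)) z := fun z _ =>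
    ((h.smooth m).differentiable_iteratedFDeriv (by exact_mod_cast WithTop.coe_lt_top k)) z
  have hb : ∀ z ∈ polydisc n, ‖fderiv ℝ (iteratedFDeriv ℝ k (U m)) z‖ ≤
      A * (scale m ^ (α : ℝ) * (scale m)⁻¹) := by
    intro z hz
    rw [norm_fderiv_iteratedFDeriv]
    refine (h.bound (k + 1) le_rfl m z hz).trans_eq ?_
    have := (scale_pos m).ne'
    rw [pow_succ, inv_pow]
    field_simp
  refine ((convex_polydisc n).norm_image_sub_le_of_norm_fderiv_le hd hb hy hx).trans_eq ?_
  ring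

theorem exists_holder_le (n k : ℕ) {α : ℝ≥0} (hα0 : 0 < α) (hα1 : α < 1) : ∃ C : ℝ, 0 ≤ C ∧
    ∀ {U : ℕ → (Fin n → ℂ) → ℂ} {A : ℝ}, IsDyadic k α U A →
    ∀ x ∈ polydisc n, ∀ y ∈ polydisc n,
    ‖iteratedFDerivWithin ℝ k (fun z => ∑' m, U m z) (polydisc n) x -
      iteratedFDerivWithin ℝ k (fun z => ∑' m, U m z) (polydisc n) y‖ ≤
      A * C * ‖x - y‖ ^ (α : ℝ) := by
  obtain ⟨C, hC0, hC⟩ := exists_tsum_le_rpow (α := α) (by exact_mod_cast hα0) (by exact_mod_cast hα1)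
  refine ⟨C, hC0, ?_⟩
  intro U A h x hx y hy
  have hA := h.nonneg
  rcases eq_or_ne x y with rfl | hxy
  · simp only [sub_self, norm_zero]
    positivity
  have hδ : 0 < ‖x - y‖ := norm_pos_iff.2 (sub_ne_zero.2 hxy)
  rw [h.iteratedFDerivWithin_eq hα0 le_rfl hx, h.iteratedFDerivWithin_eq hα0 le_rfl hy,
    ← (h.summable hα0 le_rfl hx).tsum_sub (h.summable hα0 le_rfl hy)]
  -- The triangle inequality is better at fine scales, the mean value inequality with the derivative
  -- of order `k + 1` at coarse ones.
  set b : ℕ → ℝ := fun m =>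
    min (2 * scale m ^ (α : ℝ)) (scale m ^ (α : ℝ) * (scale m)⁻¹ * ‖x - y‖) with hb
  have hb0 : ∀ m, 0 ≤ b m := fun m => by
    have := scale_pos m
    exact le_min (by positivity) (by positivity)
  have hbs : Summable b := Summable.of_nonneg_of_le hb0 (fun m => min_le_left _ _)
    ((summable_scale_rpow (by exact_mod_cast hα0)).mul_left 2)
  have h1 : ‖∑' m, (iteratedFDeriv ℝ k (U m) x - iteratedFDeriv ℝ k (U m) y)‖ ≤ A * ∑' m, b m := by
    rw [← tsum_mul_left]
    refine tsum_of_norm_bounded (hbs.mul_left A).hasSum fun m => ?_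
    rw [hb, mul_min_of_nonneg _ _ hA]
    refine le_min ?_ (h.norm_sub_le m hx hy)
    refine (_root_.norm_sub_le _ _).trans ?_
    linarith [h.norm_le le_rfl m hx, h.norm_le le_rfl m hy]
  refine h1.trans ?_
  rw [mul_assoc]
  exact mul_le_mul_of_nonneg_left (hC hδ hb0 (fun m => min_le_left _ _) fun m => min_le_right _ _) hA

end IsDyadic

end DbarPolydisc

end

noncomputable section

namespace DbarPolydisc

open Complex Filter Topology

variable {n k : ℕ} {α : ℝ≥0}

/-! ### The solution operator on Hölder forms -/

theorem HolderOn.mono {f : (Fin n → ℂ) → ℂ} {N N' : ℝ} (hf : HolderOn k α f N) (h : N ≤ N') :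
    HolderOn k α f N' :=
  ⟨hf.smooth, hf.zero, fun z hz => (hf.bdd z hz).trans h, fun x hx y hy =>
    (hf.holder x hx y hy).trans (mul_le_mul_of_nonneg_right h (Real.rpow_nonneg (norm_nonneg _) _))⟩

theorem zeroExt_of_notMem (f : polydisc n → ℂ) {z : Fin n → ℂ} (hz : z ∉ polydisc n) :
    zeroExt f z = 0 :=
  Function.extend_apply' _ _ _ fun ⟨y, hy⟩ => hz (hy ▸ y.2)

theorem zeroExt_of_mem (f : polydisc n → ℂ) {z : Fin n → ℂ} (hz : z ∈ polydisc n) :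
    zeroExt f z = f ⟨z, hz⟩ :=
  zeroExt_coe f ⟨z, hz⟩

theorem holderOn_zeroExt (f : holderSpace n k α) :
    HolderOn k α (zeroExt (f : polydisc n → ℂ)) (cNorm k α (f : polydisc n → ℂ)).toReal := by
  have htop : cNorm k α (f : polydisc n → ℂ) ≠ ⊤ := f.2.2.ne
  refine ⟨f.2.1, fun z hz => zeroExt_of_notMem _ hz, fun z hz => ?_, fun x hx y hy => ?_⟩
  · have h1 : ‖iterDeriv 0 (f : polydisc n → ℂ) ⟨z, hz⟩‖ₑ ≤ cNorm k α (f : polydisc n → ℂ) := by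
      refine le_trans ?_ le_self_add
      refine le_trans (le_iSup (fun z => ‖iterDeriv 0 (f : polydisc n → ℂ) z‖ₑ) ⟨z, hz⟩) ?_
      exact Finset.single_le_sum
        (f := fun j => ⨆ z, ‖iterDeriv j (f : polydisc n → ℂ) z‖ₑ)
        (fun _ _ => zero_le) (Finset.mem_range.2 (Nat.succ_pos k))
    have h2 := ENNReal.toReal_mono htop h1
    rwa [toReal_enorm, iterDeriv, norm_iteratedFDerivWithin_zero] at h2
  · have hH : eHolderNorm α (iterDeriv k (f : polydisc n → ℂ)) ≤ cNorm k α (f : polydisc n → ℂ) :=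
      le_add_self
    have hm : MemHolder α (iterDeriv k (f : polydisc n → ℂ)) :=
      eHolderNorm_lt_top.1 (hH.trans_lt f.2.2)
    have h1 := hm.holderWith.dist_le ⟨x, hx⟩ ⟨y, hy⟩
    rw [dist_eq_norm, Subtype.dist_eq, dist_eq_norm] at h1
    refine h1.trans (mul_le_mul_of_nonneg_right ?_ (Real.rpow_nonneg (norm_nonneg _) _))
    have h2 := ENNReal.toReal_mono htop hH
    rwa [← hm.coe_nnHolderNorm_eq_eHolderNorm, ENNReal.coe_toReal] at h2

theorem formNorm_ne_top (g : Form n k α) : formNorm g ≠ ⊤ :=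
  ENNReal.sum_ne_top.2 fun j _ => (g j).2.2.ne

theorem holderOn_form (g : Form n k α) (i : Fin n) :
    HolderOn k α (zeroExt (g i : polydisc n → ℂ)) (formNorm g).toReal := by
  refine (holderOn_zeroExt (g i)).mono (ENNReal.toReal_mono (formNorm_ne_top g) ?_)
  exact Finset.single_le_sum (f := fun j => cNorm k α (g j : polydisc n → ℂ))
    (fun _ _ => zero_le) (Finset.mem_univ i)

/-- The coefficients of a form at the scale `2⁻ᵐ`. -/
def formBand (m : ℕ) (g : Form n k α) (i : Fin n) : (Fin n → ℂ) → ℂ :=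
  band k m (zeroExt (g i : polydisc n → ℂ))

/-- The solution at the scale `2⁻ᵐ`. -/
def piece (m : ℕ) (g : Form n k α) : (Fin n → ℂ) → ℂ := regSolve (gap k * scale m / 2) (formBand m g)

theorem isSmoothClosed_formBand {g : Form n k α} (hg : IsDbarClosed g) (m : ℕ) :
    IsSmoothClosed (1 + gap k * scale m) (formBand m g) :=
  isSmoothClosed_band hg (holderOn_form g) m

theorem half_gap_pos (k m : ℕ) : 0 < gap k * scale m / 2 :=
  half_pos (mul_pos (gap_pos k) (scale_pos m))

theorem one_add_half_gap_lt (k m : ℕ) : 1 + gap k * scale m / 2 < 1 + gap k * scale m := by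
  linarith [half_gap_pos k m]

theorem piece_add {f g : Form n k α} (hf : IsDbarClosed f) (hg : IsDbarClosed g) (m : ℕ)
    (z : Fin n → ℂ) : piece m (f + g) z = piece m f z + piece m g z := by
  have : formBand m (f + g) = formBand m f + formBand m g := by
    funext i
    simp only [formBand, Pi.add_apply, Submodule.coe_add, zeroExt_add]
    exact band_add (holderOn_form f i) (holderOn_form g i) m
  rw [piece, this, regSolve_add (half_gap_pos k m) (one_add_half_gap_lt k m)
    (isSmoothClosed_formBand hf m) (isSmoothClosed_formBand hg m), piece, piece]

theorem piece_smul (c : ℂ) (g : Form n k α) (m : ℕ) (z : Fin n → ℂ) :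
    piece m (c • g) z = c * piece m g z := by
  have : formBand m (c • g) = c • formBand m g := by
    funext i
    simp only [formBand, Pi.smul_apply, Submodule.coe_smul, zeroExt_smul]
    exact band_smul c m
  rw [piece, this, regSolve_smul, piece]

/-- The margin `ρ = gap k * scale m / 2` is half of that on which the band is closed, hence
comparable to the scale. In the interior estimate `ρ^(-j) sup |band|` then matches the size of the
`j`-th derivative of the band, so solving loses nothing in each order. -/
theorem exists_isDyadic_piece (n k : ℕ) : ∃ C : ℝ, 0 ≤ C ∧
    ∀ {α : ℝ≥0} {g : Form n k α}, α ≤ 1 → IsDbarClosed g →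
    IsDyadic k α (fun m => piece m g) (C * (formNorm g).toReal) := by
  obtain ⟨B, hB0, hB⟩ := exists_norm_iteratedFDeriv_band_le n k (Nat.zero_le (k + 1))
  have hj : ∀ j, ∃ C : ℝ, 0 ≤ C ∧ (j ≤ k + 1 → ∀ {α : ℝ≥0} {g : Form n k α}, α ≤ 1 →
      IsDbarClosed g → ∀ m, ∀ z ∈ polydisc n, ‖iteratedFDeriv ℝ j (piece m g) z‖ ≤
      C * (formNorm g).toReal * (scale m ^ k * scale m ^ (α : ℝ) * (scale m)⁻¹ ^ j)) := by
    intro j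
    by_cases hjk : j ≤ k + 1
    swap
    · exact ⟨0, le_rfl, fun h => absurd h hjk⟩
    obtain ⟨K, hK0, hK⟩ := exists_norm_iteratedFDeriv_regSolve_le n j
    obtain ⟨B', hB0', hB'⟩ := exists_norm_iteratedFDeriv_band_le n k hjk
    have hg := gap_pos k
    have hg1 := gap_le k
    refine ⟨K * ((gap k / 2)⁻¹ ^ j * B + B'), by positivity, fun _ {α} {g} hα hgc m z hz => ?_⟩
    have ht := scale_pos m
    have ht1 := scale_le_one m
    have hρ := half_gap_pos k m
    have hρ1 : gap k * scale m / 2 ≤ 1 := by nlinarith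
    have hsub := polyball_mono (n := n) (one_add_half_gap_lt k m).le
    set N := (formNorm g).toReal with hN
    have hN0 : 0 ≤ N := ENNReal.toReal_nonneg
    set T := scale m ^ k * scale m ^ (α : ℝ) with hT
    have hT0 : 0 ≤ T := by positivity
    have h0 : ∀ i, ∀ z ∈ polyball n (1 + gap k * scale m / 2), ‖formBand m g i z‖ ≤ B * N * T := by
      intro i z hz
      have := hB hα (holderOn_form g i) m z (hsub hz)
      simpa only [norm_iteratedFDeriv_zero, pow_zero, mul_one] using! this
    have h1 := hK hρ hρ1 (one_add_half_gap_lt k m) (isSmoothClosed_formBand hgc m)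
      (N := B * N * T) (N' := B' * N * (T * (scale m)⁻¹ ^ j)) (by positivity) h0
      (fun i z hz => hB' hα (holderOn_form g i) m z (hsub hz)) (by positivity) z hz
    refine h1.trans ?_
    have e : (gap k * scale m / 2)⁻¹ = (gap k / 2)⁻¹ * (scale m)⁻¹ := by
      rw [← mul_inv]; congr 1; ring
    rw [e, mul_pow]
    calc _ = K * ((gap k / 2)⁻¹ ^ j * B * (N * (T * (scale m)⁻¹ ^ j)) +
          (gap k * scale m / 2) * (B' * (N * (T * (scale m)⁻¹ ^ j)))) := by ring
      _ ≤ K * ((gap k / 2)⁻¹ ^ j * B * (N * (T * (scale m)⁻¹ ^ j)) +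
          1 * (B' * (N * (T * (scale m)⁻¹ ^ j)))) := by gcongr
      _ = _ := by ring
  choose C hC0 hC using hj
  refine ⟨∑ j ∈ Finset.range (k + 2), C j, Finset.sum_nonneg fun j _ => hC0 j, ?_⟩
  intro α g hα hg
  refine ⟨fun m => contDiff_regSolve (half_gap_pos k m) (one_add_half_gap_lt k m)
    (isSmoothClosed_formBand hg m), fun j hj m z hz => (hC j hj hα hg m z hz).trans ?_⟩
  have ht := scale_pos m
  refine mul_le_mul_of_nonneg_right (mul_le_mul_of_nonneg_right ?_ ENNReal.toReal_nonneg)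
    (by positivity)
  exact Finset.single_le_sum (fun j _ => hC0 j) (Finset.mem_range.2 (Nat.lt_succ_of_le hj))

/-! ### Summation of the pieces and the equation for distributions. -/

/-- The solution of `∂̄u = g`. -/
def solution (g : Form n k α) (z : Fin n → ℂ) : ℂ := ∑' m, piece m g z

theorem zeroExt_restrict_eqOn (v : (Fin n → ℂ) → ℂ) :
    Set.EqOn (zeroExt fun z : polydisc n => v z) v (polydisc n) :=
  fun _ hz => zeroExt_of_mem _ hz

theorem iterDeriv_restrict (v : (Fin n → ℂ) → ℂ) (j : ℕ) (z : polydisc n) :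
    iterDeriv j (fun z : polydisc n => v z) z = iteratedFDerivWithin ℝ j v (polydisc n) z :=
  iteratedFDerivWithin_congr (zeroExt_restrict_eqOn v) z.2 j

theorem cNorm_restrict_le {v : (Fin n → ℂ) → ℂ} {M M' : ℝ} (hM0 : 0 ≤ M')
    (hM : ∀ j ≤ k, ∀ z ∈ polydisc n, ‖iteratedFDerivWithin ℝ j v (polydisc n) z‖ ≤ M)
    (hM' : ∀ x ∈ polydisc n, ∀ y ∈ polydisc n,
      ‖iteratedFDerivWithin ℝ k v (polydisc n) x - iteratedFDerivWithin ℝ k v (polydisc n) y‖ ≤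
        M' * ‖x - y‖ ^ (α : ℝ)) :
    cNorm k α (fun z : polydisc n => v z) ≤ ENNReal.ofReal ((k + 1) * M + M') := by
  have hMn : 0 ≤ M := (norm_nonneg _).trans (hM 0 (Nat.zero_le k) 0 zero_mem_polydisc)
  rw [ENNReal.ofReal_add (by positivity) hM0]
  refine add_le_add ?_ ?_
  · calc _ ≤ ∑ j ∈ Finset.range (k + 1), ENNReal.ofReal M := by
          refine Finset.sum_le_sum fun j hj => iSup_le fun z => ?_
          rw [iterDeriv_restrict, ← ofReal_norm]
          exact ENNReal.ofReal_le_ofReal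
            (hM j (Nat.lt_succ_iff.1 (Finset.mem_range.1 hj)) z z.2)
      _ = ENNReal.ofReal ((k + 1) * M) := by
          rw [Finset.sum_const, Finset.card_range, nsmul_eq_mul, ENNReal.ofReal_mul (by positivity)]
          congr 1
          rw [← Nat.cast_succ, ENNReal.ofReal_natCast]
  · have h : HolderWith M'.toNNReal α (iterDeriv k fun z : polydisc n => v z) := by
      intro x y
      have h1 := hM' x x.2 y y.2
      rw [edist_dist, dist_eq_norm, iterDeriv_restrict, iterDeriv_restrict, edist_dist,
        ENNReal.ofReal_rpow_of_nonneg (dist_nonneg (x := x) (y := y)) (NNReal.coe_nonneg α), Subtype.dist_eq, dist_eq_norm]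
      refine (ENNReal.ofReal_le_ofReal h1).trans_eq ?_
      rw [ENNReal.ofReal_mul hM0]
      rfl
    exact h.eHolderNorm_le

theorem integral_mul_dbar_eq {u φ : (Fin n → ℂ) → ℂ} (hu : ContDiff ℝ 1 u) (hφ : ContDiff ℝ 1 φ)
    (hc : HasCompactSupport φ) (i : Fin n) :
    ∫ z, u z * dbar i φ z = -∫ z, dbar i u z * φ z := by
  have hu' := hu.continuous_fderiv (by simp)
  have hφ' := hφ.continuous_fderiv (by simp)
  have i0 : Integrable (fun x ↦ u x * φ x) :=
    (hu.continuous.mul hφ.continuous).integrable_of_hasCompactSupport hc.mul_left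
  have i1 : ∀ v, Integrable (fun x ↦ u x * fderiv ℝ φ x v) := fun v =>
    (hu.continuous.mul (by fun_prop)).integrable_of_hasCompactSupport
      ((hc.fderiv_apply ℝ v).mul_left)
  have i2 : ∀ v, Integrable (fun x ↦ fderiv ℝ u x v * φ x) := fun v =>
    ((by fun_prop : Continuous fun x => fderiv ℝ u x v).mul
      hφ.continuous).integrable_of_hasCompactSupport hc.mul_left
  have key := fun v => integral_mul_fderiv_eq_neg_fderiv_mul_of_integrable (i2 v) (i1 v) i0
    (fun x _ => (hu.differentiable (by simp)) x) (fun x _ => (hφ.differentiable (by simp)) x)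
  have e1 : (fun z => u z * dbar i φ z) = fun z => (2 : ℂ)⁻¹ * (u z * fderiv ℝ φ z (Pi.single i 1)) +
      (I / 2) * (u z * fderiv ℝ φ z (Pi.single i I)) := by
    funext z; simp only [dbar]; ring
  have e2 : (fun z => dbar i u z * φ z) = fun z => (2 : ℂ)⁻¹ * (fderiv ℝ u z (Pi.single i 1) * φ z) +
      (I / 2) * (fderiv ℝ u z (Pi.single i I) * φ z) := by
    funext z; simp only [dbar]; ring
  rw [e1, e2, integral_add ((i1 _).const_mul _) ((i1 _).const_mul _),
    integral_add ((i2 _).const_mul _) ((i2 _).const_mul _), integral_const_mul,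
    integral_const_mul, integral_const_mul, integral_const_mul, key, key]
  ring

theorem IsTest.dbar_eq_zero {φ : (Fin n → ℂ) → ℂ} (hφ : IsTest φ) (i : Fin n) {z : Fin n → ℂ}
    (hz : z ∉ polydisc n) : dbar i φ z = 0 := by
  have : fderiv ℝ φ z = 0 := image_eq_zero_of_notMem_tsupport fun h =>
    hz (hφ.support (tsupport_fderiv_subset ℝ h))
  simp [dbar, this]

theorem IsTest.eq_zero {φ : (Fin n → ℂ) → ℂ} (hφ : IsTest φ) {z : Fin n → ℂ}
    (hz : z ∉ polydisc n) : φ z = 0 :=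
  image_eq_zero_of_notMem_tsupport fun h => hz (hφ.support h)

theorem IsTest.integrable_dbar {φ : (Fin n → ℂ) → ℂ} (hφ : IsTest φ) (i : Fin n) :
    Integrable (dbar i φ) := by
  refine (contDiff_dbar hφ.smooth i).continuous.integrable_of_hasCompactSupport
    (hφ.compact.of_isClosed_subset (isClosed_tsupport _) ?_)
  refine (closure_mono fun z hz h0 => ?_).trans (tsupport_fderiv_subset ℝ (f := φ))
  exact hz (by simp [dbar, h0])

theorem dbar_piece {g : Form n k α} (hg : IsDbarClosed g) (m : ℕ) {z : Fin n → ℂ}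
    (hz : z ∈ polydisc n) (i : Fin n) : dbar i (piece m g) z = formBand m g i z :=
  dbar_regSolve (half_gap_pos k m) (one_add_half_gap_lt k m) (isSmoothClosed_formBand hg m) hz i

/-- The partial sums are smooth with `∂̄` equal to `lowPass` of `g` on the polydisc. Integrating
them by parts and passing to the limit on both sides by dominated convergence requires no derivative
of `g` or of the sum, so `k = 0` is included. -/
theorem integral_solution_mul_dbar {g : Form n k α} (hg : IsDbarClosed g) (hα : 0 < α) {A : ℝ}
    (hA : IsDyadic k α (fun m => piece m g) A) {φ : (Fin n → ℂ) → ℂ} (hφ : IsTest φ) (i : Fin n) :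
    ∫ z, solution g z * dbar i φ z = -∫ z, zeroExt (g i : polydisc n → ℂ) z * φ z := by
  have hφ1 : ContDiff ℝ 1 φ := hφ.smooth.of_le (by exact_mod_cast le_top)
  have hφi : Integrable φ := hφ.smooth.continuous.integrable_of_hasCompactSupport hφ.compact
  have hb : ∀ m, ∀ z ∈ polydisc n, ‖piece m g z‖ ≤ A * scale m ^ (α : ℝ) := fun m z hz => by
    have := hA.norm_le (Nat.zero_le k) m hz
    rwa [norm_iteratedFDeriv_zero] at this
  have hsum := IsDyadic.summable_bound (A := A) hα
  have hsm : ∀ M, ContDiff ℝ 1 fun z => ∑ m ∈ Finset.range (M + 1), piece m g z := fun M =>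
    ContDiff.sum fun m _ => (hA.smooth m).of_le (by exact_mod_cast le_top)
  have hM : ∀ M, ∫ z, (∑ m ∈ Finset.range (M + 1), piece m g z) * dbar i φ z =
      -∫ z, lowPass k (scale M) (zeroExt (g i : polydisc n → ℂ)) z * φ z := by
    intro M
    rw [integral_mul_dbar_eq (hsm M) hφ1 hφ.compact]
    congr 2
    funext z
    by_cases hz : z ∈ polydisc n
    · congr 1
      have hd : HasFDerivAt (fun z => ∑ m ∈ Finset.range (M + 1), piece m g z)
          (∑ m ∈ Finset.range (M + 1), fderiv ℝ (piece m g) z) z :=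
        HasFDerivAt.fun_sum fun m _ => ((hA.smooth m).differentiable (by simp) z).hasFDerivAt
      rw [← sum_band, dbar, hd.fderiv, sum_apply, sum_apply, Finset.mul_sum,
        ← Finset.sum_add_distrib, Finset.sum_div]
      exact Finset.sum_congr rfl fun m _ => dbar_piece hg m hz i
    · rw [hφ.eq_zero hz, mul_zero, mul_zero]
  have l1 : Tendsto (fun M => ∫ z, (∑ m ∈ Finset.range (M + 1), piece m g z) * dbar i φ z) atTop
      (𝓝 (∫ z, solution g z * dbar i φ z)) := by
    refine tendsto_integral_of_dominated_convergence
      (fun z => (∑' m, A * scale m ^ (α : ℝ)) * ‖dbar i φ z‖) (fun M => ?_)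
      ((hφ.integrable_dbar i).norm.const_mul _) (fun M => Eventually.of_forall fun z => ?_)
      (Eventually.of_forall fun z => ?_)
    · exact ((hsm M).continuous.mul
        (contDiff_dbar hφ.smooth i).continuous).aestronglyMeasurable
    · by_cases hz : z ∈ polydisc n
      · rw [norm_mul]
        refine mul_le_mul_of_nonneg_right ?_ (norm_nonneg _)
        refine (norm_sum_le _ _).trans ((Finset.sum_le_sum fun m _ => hb m z hz).trans ?_)
        exact hsum.sum_le_tsum _ fun m _ =>
          mul_nonneg hA.nonneg (Real.rpow_nonneg (scale_pos m).le _)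
      · rw [hφ.dbar_eq_zero i hz]; simp
    · by_cases hz : z ∈ polydisc n
      · refine Tendsto.mul_const _ ?_
        have : Summable fun m => piece m g z := Summable.of_norm_bounded hsum fun m => hb m z hz
        exact this.hasSum.tendsto_sum_nat.comp (tendsto_add_atTop_nat 1)
      · rw [hφ.dbar_eq_zero i hz]; simp
  have l2 : Tendsto (fun M => ∫ z, lowPass k (scale M) (zeroExt (g i : polydisc n → ℂ)) z * φ z)
      atTop (𝓝 (∫ z, zeroExt (g i : polydisc n → ℂ) z * φ z)) := by
    refine tendsto_integral_of_dominated_convergence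
      (fun z => (∑ c ∈ Finset.range (2 * k + 2), |weight k c|) *
        ((formNorm g).toReal * ∫ w : Fin n → ℂ, ‖mollifier w‖) * ‖φ z‖) (fun M => ?_)
      (hφi.norm.const_mul _) (fun M => Eventually.of_forall fun z => ?_)
      (Eventually.of_forall fun z => ?_)
    · exact ((contDiff_lowPass (holderOn_form g i) (scale_pos M) (scale_le_one M)).continuous.mul
        hφ.smooth.continuous).aestronglyMeasurable
    · rw [norm_mul]
      exact mul_le_mul_of_nonneg_right (norm_lowPass_le (holderOn_form g i) z) (norm_nonneg _)
    · by_cases hz : z ∈ polydisc n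
      · exact (tendsto_lowPass (holderOn_form g i) tendsto_scale (fun m => (scale_pos m).ne')
          hz).mul_const _
      · rw [hφ.eq_zero hz]; simp
  simp only [hM] at l1
  exact tendsto_nhds_unique l1 l2.neg

end DbarPolydisc

end

theorem theorem1 (n k : ℕ) (α : NNReal) (hα0 : 0 < α) (hα1 : α < 1) :
    ∃ H : DbarPolydisc.closedForms n k α →ₗ[ℂ] DbarPolydisc.holderSpace n k α,
      (∃ C : NNReal, ∀ g : DbarPolydisc.closedForms n k α,
        DbarPolydisc.cNorm k α (H g : DbarPolydisc.polydisc n → ℂ) ≤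
          C * DbarPolydisc.formNorm (g : DbarPolydisc.Form n k α)) ∧
      ∀ g : DbarPolydisc.closedForms n k α,
        DbarPolydisc.IsDbarSolution (H g) (g : DbarPolydisc.Form n k α) := by
  open DbarPolydisc in
  obtain ⟨C, hC0, hC⟩ := exists_isDyadic_piece n k
  obtain ⟨D, hD0, hD⟩ := IsDyadic.exists_holder_le n k hα0 hα1
  have hcl : ∀ g : closedForms n k α, IsDbarClosed (g : Form n k α) := fun g => g.2
  have hdy : ∀ g : closedForms n k α, IsDyadic k α (fun m => piece m (g : Form n k α))
      (C * (formNorm (g : Form n k α)).toReal) := fun g => hC hα1.le (hcl g)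
  set S : ℝ := ∑' m, scale m ^ (α : ℝ) with hS
  have hS0 : 0 ≤ S := tsum_nonneg fun m => Real.rpow_nonneg (scale_pos m).le _
  have hnorm : ∀ g : closedForms n k α,
      cNorm k α (fun z : polydisc n => solution (g : Form n k α) z) ≤
        ((C * ((k + 1) * S + D)).toNNReal : NNReal) * formNorm (g : Form n k α) := by
    intro g
    have hN : 0 ≤ (formNorm (g : Form n k α)).toReal := ENNReal.toReal_nonneg
    refine (cNorm_restrict_le (M := C * (formNorm (g : Form n k α)).toReal * S)
      (M' := C * (formNorm (g : Form n k α)).toReal * D) (by positivity)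
      (fun j hj z hz => (hdy g).norm_iteratedFDerivWithin_le hα0 hj hz)
      (fun x hx y hy => hD (hdy g) x hx y hy)).trans_eq ?_
    have e : (k + 1) * (C * (formNorm (g : Form n k α)).toReal * S) +
        C * (formNorm (g : Form n k α)).toReal * D =
        C * ((k + 1) * S + D) * (formNorm (g : Form n k α)).toReal := by ring
    rw [e, ENNReal.ofReal_mul (by positivity), ENNReal.ofReal_toReal (formNorm_ne_top _)]
    rfl
  have hmem : ∀ g : closedForms n k α,
      (fun z : polydisc n => solution (g : Form n k α) z) ∈ holderSpace n k α := fun g =>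
    ⟨((hdy g).contDiffOn hα0).congr (zeroExt_restrict_eqOn _),
      (hnorm g).trans_lt (ENNReal.mul_lt_top ENNReal.coe_lt_top (formNorm_ne_top _).lt_top)⟩
  have hsum : ∀ (g : closedForms n k α) (z : polydisc n),
      Summable fun m => piece m (g : Form n k α) z := fun g z =>
    Summable.of_norm_bounded (IsDyadic.summable_bound hα0) fun m => by
      have := (hdy g).norm_le (Nat.zero_le k) m z.2
      rwa [norm_iteratedFDeriv_zero] at this
  refine ⟨{ toFun := fun g => ⟨_, hmem g⟩, map_add' := fun f g => ?_, map_smul' := fun c g => ?_ },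
    ⟨_, hnorm⟩, fun g φ hφ i => ?_⟩
  · ext z
    simp only [solution, Submodule.coe_add, Pi.add_apply]
    rw [← (hsum f z).tsum_add (hsum g z)]
    exact tsum_congr fun m => piece_add (hcl f) (hcl g) m (z : Fin n → ℂ)
  · ext z
    simp only [solution, Submodule.coe_smul, Pi.smul_apply, RingHom.id_apply, smul_eq_mul]
    rw [← tsum_mul_left]
    exact tsum_congr fun m => piece_smul c (g : Form n k α) m (z : Fin n → ℂ)
  · rw [← integral_solution_mul_dbar (hcl g) hα0 (hdy g) hφ i]
    refine MeasureTheory.integral_congr_ae (Filter.Eventually.of_forall fun z => ?_)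
    by_cases hz : z ∈ polydisc n
    · simp only [LinearMap.coe_mk, AddHom.coe_mk, zeroExt_restrict_eqOn _ hz]
    · simp only [hφ.dbar_eq_zero i hz, mul_zero]
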